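/- **Setting.** Let $\mathcal K=L^2(\mathbb R^3,d^3k)$, $\omega(k)=|k|$, and $\hat h(k)=\int e^{-ik\cdot x}h(x)\,d^3x$. Let $\mathcal H$ be the bosonic Fock space over $\mathcal K$, with Weyl operators $W(v)$, $v\in\mathcal K$, normalised by $W(u)W(v)=e^{-\frac i2\mathrm{Im}\langle u,v\rangle}W(u+v)$ and $\langle\Omega,W(v)\Omega\rangle=e^{-\frac14\|v\|^2}$, where $\Omega$ is the vacuum vector. Let $U(t,x)$ be multiplication by $e^{i(\omega(k)t-k\cdot x)}$. For a subset $X$ of Minkowski space $\mathbb R^{1+3}$, let $X'$ be its causal complement (the set of points spacelike to every point of $X$) and $X''$ its causal completion. Write $\mathcal D_{\mathbb R}(O)$ for the real-valued smooth functions with compact support in $O\subset\mathbb R^3$. For an open ball $B\subset\mathbb R^3$ put $\mathcal L((\{0\}\times B)'')=\omega^{-1/2}\widehat{\mathcal D_{\mathbb R}(B)}+i\,\omega^{1/2}\widehat{\mathcal D_{\mathbb R}(B)}$; for other regions $\mathcal R$, the real linear space $\mathcal L(\mathcal R)\subset\mathcal K$ is defined by translation covariance and additivity. For a double cone $\mathcal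 O$ let $\mathfrak A(\mathcal O)=\{W(f):f\in\mathcal L(\mathcal O)\}''$ (bicommutant), for an arbitrary region $\mathcal R$ let $\mathfrak A(\mathcal R)$ be the C$^*$-algebra generated by the $\mathfrak A(\mathcal O)$ for all double cones $\mathcal O\subset\mathcal R$, and let $\mathfrak A=\mathfrak A(\mathbb R^{1+3})$. Put $\mathcal L=\bigcup_{\mathcal O}\mathcal L(\mathcal O)$, the union over all double cones. Let $\gamma=\omega^{-1/2}\hat\sigma+i\,\omega^{-3/2}\hat\rho$ with $\sigma,\rho\in\mathcal D_{\mathbb R}(\mathbb R^3)$ (that is, $\gamma\in\mathcal L_\Gamma$), let $q_\gamma=\int\rho(x)\,d^3x$ be its charge, and put $l_\gamma(f)=-\mathrm{Im}\int\overline{\gamma(k)}f(k)\,d^3k$ for $f\in\mathcal L$. For a $*$-automorphism $\alpha$ of $\mathfrak A$ and a region $\mathcal R$, write $\alpha|_{\mathfrak A(\mathcal R)}\cong\mathrm{id}|_{\mathfrak A(\mathcal R)}$ if there is a unitary $V$ on $\mathcal H$ with $V\alpha(A)V^*=A$ for all $A\in\mathfrak A(\mathcal R)$. A *spacelike cone*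 is the image, under a Poincaré transformation, of $(\{0\}\times C)''$ for some nonempty open convex cone $C\subsetneq\mathbb R^3$ with apex $0$. **Proposition 2.1.** There is exactly one $*$-automorphism of $\mathfrak A$, again denoted by $\gamma$, with $\gamma(W(f))=e^{il_\gamma(f)}W(f)$ for all $f\in\mathcal L$ and whose restriction to $\mathfrak A(\mathcal O)$ is continuous in the weak operator topology for every double cone $\mathcal O$. It has the following properties. 1. For every nonempty open convex cone $C\subset\mathbb R^3$ with apex $0$ and its causal completion $\mathcal C=(\{0\}\times C)''$, $$\gamma|_{\mathfrak A(\mathcal C)}\cong\mathrm{id}|_{\mathfrak A(\mathcal C)}\quad\text{if and only if}\quad q_\gamma=0 .$$ 2. If $q_\gamma\neq0$, then for no spacelike cone $\mathcal S$ is $\gamma|_{\mathfrak A(\mathcal S')}\cong\mathrm{id}|_{\mathfrak A(\mathcal S')}$: the charged sectors are not localisable in spacelike cones relative to the vacuum, so the Buchholz–Fredenhagen (BF) criterion fails for them. -/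

import Mathlib

namespace ScalarField

open scoped Matrix ComplexOrder InnerProductSpace

noncomputable section

/-! ### The bosonic Fock space and its Weyl operators -/

section Fock

variable (K : Type*) [NormedAddCommGroup K] [InnerProductSpace ℂ K]

/-- The kernel `(u, v) ↦ exp ⟪u, v⟫` (as an operator-valued kernel on the one-dimensional space). -/
def fockKernel : Matrix K K (ℂ →L[ℂ] ℂ) :=
  Matrix.of fun u v => Complex.exp ⟪u, v⟫_ℂ • ContinuousLinearMap.id ℂ ℂ

theorem powKernel_posSemidef {ι : Type*} [Fintype ι] (v : ι → K) (n : ℕ) :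
    (Matrix.of fun i j => ⟪v i, v j⟫_ℂ ^ n).PosSemidef := by
  induction n with
  | zero =>
    have h := Matrix.posSemidef_gram ℂ (fun _ : ι => (1 : ℂ))
    have e : Matrix.gram ℂ (fun _ : ι => (1 : ℂ)) = Matrix.of fun i j => ⟪v i, v j⟫_ℂ ^ 0 := by
      ext i j
      simp
    rw [← e]
    exact h
  | succ n ih =>
    have h := Matrix.PosSemidef.hadamard (𝕜 := ℂ) ih (Matrix.posSemidef_gram ℂ v)
    exact h

theorem expKernel_nonneg {ι : Type*} [Fintype ι] (v : ι → K) (x : ι → ℂ) :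
    0 ≤ (∑ i, ∑ j, starRingEnd ℂ (x i) * x j * Complex.exp ⟪v i, v j⟫_ℂ).re := by
  have hs : ∀ i j, HasSum (fun n : ℕ => starRingEnd ℂ (x i) * x j *
      ((n.factorial : ℂ)⁻¹ * ⟪v i, v j⟫_ℂ ^ n))
      (starRingEnd ℂ (x i) * x j * Complex.exp ⟪v i, v j⟫_ℂ) := by
    intro i j
    apply HasSum.mul_left
    rw [Complex.exp_eq_exp_ℂ]
    simpa [smul_eq_mul] using NormedSpace.exp_series_hasSum_exp' (𝕂 := ℂ) ⟪v i, v j⟫_ℂ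
  have hsum := hasSum_sum (s := Finset.univ) fun i _ =>
    hasSum_sum (s := Finset.univ) fun j _ => hs i j
  have hre := Complex.hasSum_re hsum
  refine hre.nonneg fun n => ?_
  have h := (powKernel_posSemidef K v n).dotProduct_mulVec_nonneg x
  have e : (∑ i, ∑ j, starRingEnd ℂ (x i) * x j * ((n.factorial : ℂ)⁻¹ * ⟪v i, v j⟫_ℂ ^ n)) =
      (((n.factorial : ℝ)⁻¹ : ℝ) : ℂ) *
        (star x ⬝ᵥ (Matrix.of fun i j => ⟪v i, v j⟫_ℂ ^ n) *ᵥ x) := by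
    simp only [dotProduct, Matrix.mulVec, Finset.mul_sum, Matrix.of_apply, Pi.star_apply]
    refine Finset.sum_congr rfl fun i _ => Finset.sum_congr rfl fun j _ => ?_
    push_cast
    simp only [RCLike.star_def]
    ring
  rw [e, Complex.re_ofReal_mul]
  exact mul_nonneg (by positivity) (Complex.le_def.mp h).1

theorem fockKernel_posSemidef : (fockKernel K).PosSemidef := by
  refine (RKHS.posSemidef_tfae.out 0 2).mpr (And.intro ?_ fun f => ?_)
  · ext u v
    have h1 : star (ContinuousLinearMap.id ℂ ℂ) = ContinuousLinearMap.id ℂ ℂ :=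
      star_one (ℂ →L[ℂ] ℂ)
    simp [fockKernel, Matrix.conjTranspose_apply, ← Complex.exp_conj, h1]
  · have h := expKernel_nonneg K (fun i : f.support => (i : K))
      (fun i => f i)
    convert h using 2
    rw [Finset.sum_coe_sort f.support fun i => ∑ j : f.support,
      starRingEnd ℂ (f i) * f j * Complex.exp ⟪i, (j : K)⟫_ℂ]
    simp only [Finsupp.sum, fockKernel, Matrix.of_apply]
    refine congrArg Complex.re (Finset.sum_congr rfl fun i _ => ?_)
    rw [Finset.sum_coe_sort f.support fun j =>
      starRingEnd ℂ (f i) * f j * Complex.exp ⟪i, j⟫_ℂ]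
    refine Finset.sum_congr rfl fun j _ => ?_
    simp [← Complex.exp_conj]
    ring

instance fockKernel_fact : Fact (fockKernel K).PosSemidef := ⟨fockKernel_posSemidef K⟩

/-- The bosonic Fock space over `K`. The exponential (coherent) vectors `e(v) = ⨁ₙ v^{⊗ n} / √n!` are
total in it and have the inner products `⟪e(u), e(v)⟫ = exp ⟪u, v⟫`. So it is the Hilbert space
completion of the linear span of the `e(v)` in this inner product, that is, the Hilbert space
generated by the kernel `exp ⟪u, v⟫`. The vacuum vector is `e(0)`. -/
abbrev FockSpace : Type _ := RKHS.OfKernel (fockKernel K)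

variable {K}

/-- The exponential vector `e(v)` in Fock space. -/
def expVec (v : K) : FockSpace K := RKHS.kerFun (FockSpace K) v 1

theorem inner_expVec (u v : K) : ⟪expVec u, expVec v⟫_ℂ = Complex.exp ⟪u, v⟫_ℂ := by
  unfold expVec
  rw [← RKHS.kernel_inner, RKHS.OfKernel.kernel_ofKernel]
  simp [fockKernel, ← Complex.exp_conj]

theorem expVec_dense :
    (Submodule.span ℂ (Set.range (expVec : K → FockSpace K))).topologicalClosure = ⊤ := by
  rw [← RKHS.kerFun_dense (H := FockSpace K)]
  congr 1
  apply le_antisymm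
  · refine Submodule.span_mono ?_
    rintro _ ⟨v, rfl⟩
    exact ⟨v, 1, rfl⟩
  · refine Submodule.span_le.mpr ?_
    rintro _ ⟨v, z, rfl⟩
    have : RKHS.kerFun (FockSpace K) v z = z • expVec v := by
      rw [expVec, ← map_smul, smul_eq_mul, mul_one]
    rw [this]
    exact Submodule.smul_mem _ _ (Submodule.subset_span ⟨v, rfl⟩)

theorem expVec_denseRange :
    DenseRange (Finsupp.linearCombination ℂ (expVec : K → FockSpace K)) := by
  have h := expVec_dense (K := K)
  rw [← Finsupp.range_linearCombination] at h
  rw [DenseRange, ← LinearMap.coe_range]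
  exact Submodule.dense_iff_topologicalClosure_eq_top.mpr h

theorem ext_expVec {A B : FockSpace K →L[ℂ] FockSpace K}
    (h : ∀ v, A (expVec v) = B (expVec v)) : A = B := by
  refine ContinuousLinearMap.ext_on
    (Submodule.dense_iff_topologicalClosure_eq_top.mpr expVec_dense) ?_
  rintro _ ⟨v, rfl⟩
  exact h v

/-- The Weyl operator `W(u)`: the (unique) bounded operator on Fock space with
`W(u) e(v) = exp (-‖u‖² / 4 - ⟪u, v⟫ / √2) e(v + u / √2)` for all `v`. -/
def weyl (u : K) : FockSpace K →L[ℂ] FockSpace K :=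
  (Finsupp.linearCombination ℂ fun v : K =>
      Complex.exp (-(‖u‖ : ℂ) ^ 2 / 4 - ⟪u, v⟫_ℂ / (√2 : ℝ)) •
        expVec (v + ((√2 : ℝ) : ℂ)⁻¹ • u)).extendOfNorm
    (Finsupp.linearCombination ℂ (expVec : K → FockSpace K))

theorem weyl_expVec (u v : K) :
    weyl u (expVec v) = Complex.exp (-(‖u‖ : ℂ) ^ 2 / 4 - ⟪u, v⟫_ℂ / (√2 : ℝ)) •
        expVec (v + ((√2 : ℝ) : ℂ)⁻¹ • u) := by
  have hs : ((√2 : ℝ) : ℂ)⁻¹ * ((√2 : ℝ) : ℂ)⁻¹ = 1 / 2 := by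
    rw [← mul_inv, ← Complex.ofReal_mul, Real.mul_self_sqrt (by norm_num)]
    norm_num
  have key : ∀ x y : K,
      ⟪Complex.exp (-(‖u‖ : ℂ) ^ 2 / 4 - ⟪u, x⟫_ℂ / (√2 : ℝ)) •
          expVec (x + ((√2 : ℝ) : ℂ)⁻¹ • u),
        Complex.exp (-(‖u‖ : ℂ) ^ 2 / 4 - ⟪u, y⟫_ℂ / (√2 : ℝ)) •
          expVec (y + ((√2 : ℝ) : ℂ)⁻¹ • u)⟫_ℂ = ⟪expVec x, expVec y⟫_ℂ := by
    intro x y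
    rw [inner_smul_left, inner_smul_right, inner_expVec, inner_expVec, ← Complex.exp_conj,
      ← Complex.exp_add, ← Complex.exp_add]
    congr 1
    simp only [inner_add_left, inner_add_right, inner_smul_left, inner_smul_right, map_sub,
      map_div₀, map_neg, map_pow, Complex.conj_ofReal, inner_conj_symm, map_inv₀, map_ofNat,
      inner_self_eq_norm_sq_to_K, Complex.coe_algebraMap]
    linear_combination (‖u‖ : ℂ) ^ 2 * hs
  have hnorm : ∀ x : K →₀ ℂ,
      ‖Finsupp.linearCombination ℂ (fun v : K =>
        Complex.exp (-(‖u‖ : ℂ) ^ 2 / 4 - ⟪u, v⟫_ℂ / (√2 : ℝ)) •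
          expVec (v + ((√2 : ℝ) : ℂ)⁻¹ • u)) x‖ ≤
      1 * ‖Finsupp.linearCombination ℂ (expVec : K → FockSpace K) x‖ := by
    intro x
    rw [one_mul]
    apply le_of_eq
    refine (@norm_eq_sqrt_re_inner ℂ _ _ _ _ _).trans
      (Eq.trans ?_ (@norm_eq_sqrt_re_inner ℂ _ _ _ _ _).symm)
    refine congrArg (fun z : ℂ => √(RCLike.re z)) ?_
    rw [Finsupp.linearCombination_apply, Finsupp.linearCombination_apply, Finsupp.sum, Finsupp.sum]
    simp only [sum_inner, inner_sum]
    refine Finset.sum_congr rfl fun i _ => ?_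
    refine Finset.sum_congr rfl fun j _ => ?_
    rw [inner_smul_left, inner_smul_right, key, inner_smul_left, inner_smul_right]
  have h : weyl u (Finsupp.linearCombination ℂ (expVec : K → FockSpace K) (Finsupp.single v 1)) =
      Finsupp.linearCombination ℂ (fun v : K =>
        Complex.exp (-(‖u‖ : ℂ) ^ 2 / 4 - ⟪u, v⟫_ℂ / (√2 : ℝ)) •
          expVec (v + ((√2 : ℝ) : ℂ)⁻¹ • u)) (Finsupp.single v 1) :=
    LinearMap.extendOfNorm_eq expVec_denseRange ⟨1, hnorm⟩ _
  simpa using h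

theorem weyl_mul (u v : K) :
    weyl u * weyl v = Complex.exp (-(Complex.I / 2) * (⟪u, v⟫_ℂ).im) • weyl (u + v) := by
  refine ext_expVec fun x => ?_
  have hs : ((√2 : ℝ) : ℂ)⁻¹ * ((√2 : ℝ) : ℂ)⁻¹ = 1 / 2 := by
    rw [← mul_inv, ← Complex.ofReal_mul, Real.mul_self_sqrt (by norm_num)]
    norm_num
  have hn : ((‖u + v‖ : ℝ) : ℂ) ^ (2 : ℕ) =
      (‖u‖ : ℂ) ^ 2 + ⟪u, v⟫_ℂ + starRingEnd ℂ ⟪u, v⟫_ℂ + (‖v‖ : ℂ) ^ 2 := by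
    have h := inner_self_eq_norm_sq_to_K (𝕜 := ℂ) (u + v : K)
    have hu := inner_self_eq_norm_sq_to_K (𝕜 := ℂ) u
    have hv := inner_self_eq_norm_sq_to_K (𝕜 := ℂ) v
    simp only [Complex.coe_algebraMap] at h hu hv
    rw [← h, ← hu, ← hv, inner_conj_symm]
    simp only [inner_add_left, inner_add_right]
    ring
  have hi : starRingEnd ℂ ⟪u, v⟫_ℂ = ⟪u, v⟫_ℂ - 2 * Complex.I * (⟪u, v⟫_ℂ).im := by
    apply Complex.ext
    · simp [-inner_conj_symm]
    · simp [-inner_conj_symm]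
      ring
  rw [mul_apply_eq_comp, smul_apply, weyl_expVec, map_smul, weyl_expVec, weyl_expVec,
    smul_smul, smul_smul]
  rw [← Complex.exp_add, ← Complex.exp_add]
  have e : x + ((√2 : ℝ) : ℂ)⁻¹ • v + ((√2 : ℝ) : ℂ)⁻¹ • u =
      x + ((√2 : ℝ) : ℂ)⁻¹ • (u + v) := by
    rw [smul_add]
    abel
  rw [e]
  congr 2
  rw [hn, hi]
  simp only [inner_add_left, inner_add_right, inner_smul_right]
  linear_combination -⟪u, v⟫_ℂ * hs

theorem star_weyl (u : K) : star (weyl u) = weyl (-u) := by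
  refine ext_expVec fun x => ?_
  have hext : ∀ a b : FockSpace K, (∀ y, ⟪expVec y, a⟫_ℂ = ⟪expVec y, b⟫_ℂ) → a = b := by
    intro a b h
    have h2 : innerSL ℂ (a - b) = 0 := by
      refine ContinuousLinearMap.ext_on
        (Submodule.dense_iff_topologicalClosure_eq_top.mpr expVec_dense) ?_
      rintro _ ⟨y, rfl⟩
      rw [innerSL_apply_apply, ← inner_conj_symm, inner_sub_right, h y]
      simp
    have h3 := congrArg (fun T => T (a - b)) h2
    simp only [innerSL_apply_apply, zero_apply, inner_self_eq_zero] at h3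
    exact sub_eq_zero.mp h3
  refine hext _ _ fun y => ?_
  rw [ContinuousLinearMap.star_eq_adjoint, ContinuousLinearMap.adjoint_inner_right, weyl_expVec,
    weyl_expVec, inner_smul_left, inner_smul_right, inner_expVec, inner_expVec,
    ← Complex.exp_conj, ← Complex.exp_add, ← Complex.exp_add]
  congr 1
  simp only [inner_add_left, inner_add_right, inner_smul_left, inner_smul_right, map_sub,
    map_div₀, map_neg, map_pow, Complex.conj_ofReal, inner_conj_symm, map_inv₀, map_ofNat,
    inner_neg_left, inner_neg_right, norm_neg, smul_neg]
  ring

theorem weyl_zero : weyl (0 : K) = 1 := by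
  refine ext_expVec fun x => ?_
  simp [weyl_expVec]

theorem weyl_mem_unitary (u : K) : weyl u ∈ unitary (FockSpace K →L[ℂ] FockSpace K) := by
  rw [Unitary.mem_iff, star_weyl]
  constructor <;> rw [weyl_mul] <;> simp [weyl_zero, inner_neg_left, inner_neg_right,
    ← Complex.ofReal_pow]

end Fock

/-! ### Minkowski space -/

/-- Physical space. It also serves as momentum space. -/
abbrev E3 : Type := EuclideanSpace ℝ (Fin 3)

/-- Minkowski space, with points `(t, x)`. -/
abbrev Spacetime : Type := ℝ × E3

/-- The Minkowski bilinear form, with signature `(+, -, -, -)`. -/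
def minkowski (x y : Spacetime) : ℝ := x.1 * y.1 - ⟪x.2, y.2⟫_ℝ

/-- The causal complement `X'`: all points that are spacelike to every point of `X`. -/
def causalCompl (X : Set Spacetime) : Set Spacetime :=
  {y | ∀ x ∈ X, minkowski (y - x) (y - x) < 0}

/-- The causal completion `X''`. -/
def causalCompletion (X : Set Spacetime) : Set Spacetime := causalCompl (causalCompl X)

/-- The open forward light cone. -/
def forwardCone : Set Spacetime := {x | 0 < minkowski x x ∧ 0 < x.1}

/-- `O` is an open double cone `(p + V₊) ∩ (q - V₊)` with `q - p ∈ V₊`. -/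
def IsDoubleCone (O : Set Spacetime) : Prop :=
  ∃ p q : Spacetime, q - p ∈ forwardCone ∧ O = {z | z - p ∈ forwardCone ∧ q - z ∈ forwardCone}

/-- `C` is a (nonempty) open convex cone with apex `0`. -/
structure IsOpenConvexCone (C : Set E3) : Prop where
  isOpen : IsOpen C
  convex : Convex ℝ C
  nonempty : C.Nonempty
  smul_mem : ∀ r : ℝ, 0 < r → ∀ x ∈ C, r • x ∈ C

/-- `S` is a spacelike cone: the image, under a Poincaré transformation, of the causal completion
of an open convex cone (other than the whole space) at time `0`. -/
def IsSpacelikeCone (S : Set Spacetime) : Prop :=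
  ∃ (C : Set E3) (Λ : Spacetime →ₗ[ℝ] Spacetime) (a : Spacetime),
    IsOpenConvexCone C ∧ C ≠ Set.univ ∧
    (∀ x y, minkowski (Λ x) (Λ y) = minkowski x y) ∧
    S = (fun x => a + Λ x) '' causalCompletion ({0} ×ˢ C)

/-! ### One-particle space and local symplectic spaces -/

/-- The one-particle space `L²(ℝ³, d³k)` of momentum space wave functions. -/
abbrev OneParticle : Type := MeasureTheory.Lp ℂ 2 (MeasureTheory.volume : MeasureTheory.Measure E3)

/-- Real-valued smooth functions with compact support in the open set `Ω`. -/
abbrev RealTest (Ω : TopologicalSpace.Opens E3) : Type := TestFunction Ω ℝ ⊤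

/-- The Fourier transform `ĥ(k) = ∫ h(x) exp(-i k·x) d³x`. -/
def hat (h : E3 → ℝ) (k : E3) : ℂ :=
  ∫ x, Complex.exp (-(Complex.I * ((⟪k, x⟫_ℝ : ℝ) : ℂ))) * (h x : ℂ)

/-- `ω^{-1/2} ĥ + i ω^{1/2} ĝ`, where `ω(k) = |k|`. -/
def timeZeroFn (h g : E3 → ℝ) (k : E3) : ℂ :=
  ((‖k‖ ^ (-(1 / 2) : ℝ) : ℝ) : ℂ) * hat h k +
    Complex.I * ((‖k‖ ^ (1 / 2 : ℝ) : ℝ) : ℂ) * hat g k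

/-- The multiplier `exp(i (ω(k) t - k·x))` which represents the translation by `(t, x)`. -/
def translationPhase (a : Spacetime) (k : E3) : ℂ :=
  Complex.exp (Complex.I * ((‖k‖ * a.1 - ⟪k, a.2⟫_ℝ : ℝ) : ℂ))

/-- The open ball as a bundled open set. -/
def ballOpens (c : E3) (r : ℝ) : TopologicalSpace.Opens E3 := ⟨Metric.ball c r, Metric.isOpen_ball⟩

/-- The real linear space `ℒ(R)` of a region `R`. For the causal completion of a ball `B` at time
`0` the local space consists of the `ω^{-1/2} ĥ + i ω^{1/2} ĝ` with `h, g` supported in `B`;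
for other regions it is determined by translation covariance and additivity. -/
def localSpace (R : Set Spacetime) : Submodule ℝ OneParticle :=
  Submodule.span ℝ {f | ∃ (c : E3) (r : ℝ) (a : Spacetime) (h g : RealTest (ballOpens c r)),
    0 < r ∧ (fun z => a + z) '' causalCompletion ({0} ×ˢ Metric.ball c r) ⊆ R ∧
    (f : E3 → ℂ) =ᵐ[MeasureTheory.volume] fun k => translationPhase a k * timeZeroFn h g k}

/-! ### Local algebras -/

/-- Bounded operators on the vacuum Hilbert space. -/
abbrev Op : Type := FockSpace OneParticle →L[ℂ] FockSpace OneParticle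

/-- The C⋆-algebra `𝒲(ℒ)` generated by the Weyl operators `W(f)`, `f ∈ ℒ`. -/
def weylAlgebra (L : Submodule ℝ OneParticle) : StarSubalgebra ℂ Op :=
  (StarAlgebra.adjoin ℂ (weyl '' (L : Set OneParticle))).topologicalClosure

/-- The local von Neumann algebra `𝒲(ℒ(O))''` of a double cone `O`. -/
def localAlgebra (O : Set Spacetime) : StarSubalgebra ℂ Op :=
  StarSubalgebra.centralizer ℂ
    (StarSubalgebra.centralizer ℂ (weylAlgebra (localSpace O) : Set Op) : Set Op)

/-- The C⋆-algebra `𝔄(R)` of an arbitrary region `R`: the norm closure of the algebra generated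
by the local von Neumann algebras of all double cones contained in `R`. -/
def regionAlgebra (R : Set Spacetime) : StarSubalgebra ℂ Op :=
  (StarAlgebra.adjoin ℂ
    {A : Op | ∃ O, IsDoubleCone O ∧ O ⊆ R ∧ A ∈ localAlgebra O}).topologicalClosure

/-- The quasilocal algebra `𝔄`. -/
abbrev quasilocal : StarSubalgebra ℂ Op := regionAlgebra Set.univ

theorem weyl_mem_localAlgebra {O : Set Spacetime} {f : OneParticle} (hf : f ∈ localSpace O) :
    weyl f ∈ localAlgebra O := by
  have h : weyl f ∈ weylAlgebra (localSpace O) :=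
    StarSubalgebra.le_topologicalClosure _ (StarAlgebra.subset_adjoin ℂ _ ⟨f, hf, rfl⟩)
  rw [localAlgebra, StarSubalgebra.mem_centralizer_iff]
  intro g hg
  rw [SetLike.mem_coe, StarSubalgebra.mem_centralizer_iff] at hg
  have h1 := hg _ h
  refine ⟨h1.1.symm, ?_⟩
  have h2 := congrArg star h1.2
  simpa using h2

theorem weyl_mem_quasilocal {O : Set Spacetime} (hO : IsDoubleCone O) {f : OneParticle}
    (hf : f ∈ localSpace O) : weyl f ∈ quasilocal :=
  StarSubalgebra.le_topologicalClosure _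
    (StarAlgebra.subset_adjoin ℂ _ ⟨O, hO, Set.subset_univ O, weyl_mem_localAlgebra hf⟩)

/-- The weak operator topology on the quasilocal algebra. -/
abbrev weakTopology : TopologicalSpace quasilocal :=
  TopologicalSpace.induced
    (fun A => (ContinuousLinearMapWOT.ofCLM (A : Op) :
      FockSpace OneParticle →WOT[ℂ] FockSpace OneParticle)) inferInstance

/-! ### Charged automorphisms -/

/-- The element `γ = ω^{-1/2} σ̂ + i ω^{-3/2} ρ̂` of `ℒ_Γ`. -/
def chargeFn (σ ρ : RealTest ⊤) (k : E3) : ℂ :=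
  ((‖k‖ ^ (-(1 / 2) : ℝ) : ℝ) : ℂ) * hat σ k +
    Complex.I * ((‖k‖ ^ (-(3 / 2) : ℝ) : ℝ) : ℂ) * hat ρ k

/-- The charge `q_γ = ∫ ρ(x) d³x` of `γ = ω^{-1/2} σ̂ + i ω^{-3/2} ρ̂`. -/
def charge (ρ : RealTest ⊤) : ℝ := ∫ x, ρ x

/-- The real linear form `l_γ(f) = - Im ∫ conj(γ(k)) f(k) d³k`. -/
def chargeForm (γ : E3 → ℂ) (f : OneParticle) : ℝ :=
  -(∫ k, starRingEnd ℂ (γ k) * f k).im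

/-- `α` is the automorphism of the quasilocal algebra given by `γ`: it acts on the Weyl operators of
localised `f` by `W(f) ↦ exp(i l_γ(f)) W(f)` and is weakly continuous on each local von Neumann
algebra. -/
structure IsChargeAut (γ : E3 → ℂ) (α : quasilocal ≃⋆ₐ[ℂ] quasilocal) : Prop where
  map_weyl : ∀ (O : Set Spacetime) (hO : IsDoubleCone O) (f : OneParticle) (hf : f ∈ localSpace O),
    α ⟨weyl f, weyl_mem_quasilocal hO hf⟩ =
      Complex.exp (Complex.I * (chargeForm γ f : ℂ)) • ⟨weyl f, weyl_mem_quasilocal hO hf⟩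
  weaklyContinuous : ∀ O : Set Spacetime, IsDoubleCone O →
    @ContinuousOn _ _ weakTopology weakTopology α {A : quasilocal | (A : Op) ∈ localAlgebra O}

/-- The restriction of `α` to `𝔄(R)` is unitarily equivalent to the identity representation of
`𝔄(R)` on the vacuum Hilbert space. -/
def EquivIdOn (α : quasilocal ≃⋆ₐ[ℂ] quasilocal) (R : Set Spacetime) : Prop :=
  ∃ V ∈ unitary Op, ∀ A : quasilocal, (A : Op) ∈ regionAlgebra R → V * (α A : Op) * star V = A

end

end ScalarField

/-!
The form `l_γ` is not continuous on `L²(ℝ³)` if the charge `q` is not zero, because `γ` behaves like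
`i q ω^{-3/2}` near `k = 0`. But inside a bounded region it is implemented by a one-particle vector:
add to `γ` two charged spheres, the charge `q` on the sphere of radius `R` and `-2q` on the sphere of
radius `2R`. The total charge is then zero, so the sum is the square integrable vector `chargeVec`;
and since the potential of the two spheres vanishes in the ball of radius `R`, by causality no
field in the double cone over this ball notices them (`chargeForm_eq_inner`, from
`im_integral_conj_shellFn_mul`). The key vanishing is `integral_cos_mul_re_hat`: in polar coordinates
it reduces to one-dimensional Fourier inversion along each direction.

Hence the Weyl operators of these vectors implement automorphisms which stabilise on each local
algebra as `R → ∞`, and their limit on the quasilocal algebra is the wanted automorphism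
(`exists_isChargeAut`). It is unique since the double commutant theorem (`mem_closure_weak`) makes
the algebra generated by the local Weyl operators weakly dense in the local von Neumann algebra
(`IsChargeAut.eq_weylAut`). If `q = 0` the spheres carry no charge, `γ` itself is in `L²(ℝ³)`, and a
single Weyl operator implements the automorphism everywhere (`IsChargeAut.equivIdOn`).

If `q ≠ 0`, the charge is measured at infinity in any region which contains dilated copies, of
every scale `l`, of one ball (`IsChargeAut.not_equivIdOn`). The packets `ω^{-1/2} ĥ_l` with
`h_l(x) = l⁻² h(x / l)` have constant norm and tend weakly to zero, so their Weyl operators tend weakly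
to a nonzero multiple of the identity (`tendsto_inner_weyl`). Meanwhile `l_γ` tends on them to `q`
times a Coulomb integral (`tendsto_chargeForm_packet`), which is positive for `h ≥ 0`
(`re_integral_inv_sq_mul_hat_pos`). A unitary equivalence to the identity would force the limit of
the phases `exp (i l_γ)` to be `1` (`phase_limit_eq_one`), but `h` can be normalised so that it is
`-1`. A cone contains all dilates of a ball in it. The causal complement of a spacelike cone contains
a translate of a wedge, which meets a time slice in such dilates
(`IsSpacelikeCone.exists_diamond_subset`).
-/

namespace ScalarField

open scoped InnerProductSpace ContDiff Topology
open MeasureTheory Filter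

/-! ### A dominating function in momentum space -/

/-- The integrable function `|k|^{-5/2} (1 + |k|)⁻¹`, which dominates, up to constants, all the
momentum space integrands below. -/
noncomputable def domFn (k : E3) : ℝ := ‖k‖ ^ (-(5 / 2) : ℝ) * (1 + ‖k‖)⁻¹

theorem domFn_nonneg (k : E3) : 0 ≤ domFn k := by unfold domFn; positivity

theorem integrable_domFn : Integrable domFn := by
  have h := (integrable_fun_norm_addHaar (volume : Measure E3)
    (f := fun y : ℝ => y ^ (-(5 / 2) : ℝ) * (1 + y)⁻¹)).mpr
  refine h ?_
  rw [show Module.finrank ℝ E3 - 1 = 2 by simp]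
  have hm : ∀ s : Set ℝ, AEStronglyMeasurable
      (fun y : ℝ => y ^ 2 • (y ^ (-(5 / 2) : ℝ) * (1 + y)⁻¹)) (volume.restrict s) := by
    intro s
    apply Measurable.aestronglyMeasurable
    fun_prop
  have hpow : ∀ y : ℝ, 0 < y → y ^ 2 * y ^ (-(5 / 2) : ℝ) = y ^ (-(1 / 2) : ℝ) := by
    intro y hy
    rw [← Real.rpow_natCast, ← Real.rpow_add hy]
    norm_num
  rw [← Set.Ioc_union_Ioi_eq_Ioi (zero_le_one (α := ℝ))]
  refine IntegrableOn.union ?_ ?_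
  · have h1 : IntegrableOn (fun y : ℝ => y ^ (-(1 / 2) : ℝ)) (Set.Ioc 0 1) :=
      (intervalIntegrable_iff_integrableOn_Ioc_of_le zero_le_one).mp
        (intervalIntegral.intervalIntegrable_rpow' (by norm_num))
    refine Integrable.mono' h1 (hm _) ?_
    filter_upwards [ae_restrict_mem measurableSet_Ioc] with y hy
    rw [smul_eq_mul, ← mul_assoc, hpow y hy.1, Real.norm_of_nonneg
      (mul_nonneg (Real.rpow_nonneg hy.1.le _) (inv_nonneg.mpr (by linarith [hy.1])))]
    exact mul_le_of_le_one_right (Real.rpow_nonneg hy.1.le _)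
      (inv_le_one_of_one_le₀ (by linarith [hy.1]))
  · have h1 : IntegrableOn (fun y : ℝ => y ^ (-(3 / 2) : ℝ)) (Set.Ioi 1) :=
      integrableOn_Ioi_rpow_of_lt (by norm_num) zero_lt_one
    refine Integrable.mono' h1 (hm _) ?_
    filter_upwards [ae_restrict_mem measurableSet_Ioi] with y hy
    have hy' : (1 : ℝ) < y := hy
    have hy0 : 0 < y := by linarith
    rw [smul_eq_mul, ← mul_assoc, hpow y hy0, Real.norm_of_nonneg
      (mul_nonneg (Real.rpow_nonneg hy0.le _) (inv_nonneg.mpr (by linarith)))]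
    calc y ^ (-(1 / 2) : ℝ) * (1 + y)⁻¹ ≤ y ^ (-(1 / 2) : ℝ) * y⁻¹ := by
          gcongr
          linarith
      _ = y ^ (-(3 / 2) : ℝ) := by
          rw [← Real.rpow_neg_one y, ← Real.rpow_add hy0]
          norm_num

theorem ae_ne_zero : ∀ᵐ k : E3, k ≠ 0 := by
  simp [ae_iff]

theorem integrable_of_le_domFn {F : Type*} [NormedAddCommGroup F] {f : E3 → F}
    (hf : AEStronglyMeasurable f volume) (C : ℝ) (h : ∀ k ≠ 0, ‖f k‖ ≤ C * domFn k) :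
    Integrable f := by
  refine Integrable.mono' (integrable_domFn.const_mul C) hf ?_
  filter_upwards [ae_ne_zero] with k hk using h k hk

theorem rpow_mul_le_domFn {k : E3} (hk : k ≠ 0) {a : ℝ} (h1 : -(3 / 2) ≤ a) (h2 : a ≤ 5 / 2) :
    ‖k‖ ^ (-a) * ((1 + ‖k‖) ^ 5)⁻¹ ≤ domFn k := by
  have hk0 : 0 < ‖k‖ := norm_pos_iff.mpr hk
  have e : ‖k‖ ^ (-a) = ‖k‖ ^ (-(5 / 2) : ℝ) * ‖k‖ ^ (5 / 2 - a) := by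
    rw [← Real.rpow_add hk0]
    ring_nf
  have h3 : ‖k‖ ^ (5 / 2 - a) ≤ (1 + ‖k‖) ^ 4 := by
    calc ‖k‖ ^ (5 / 2 - a) ≤ (1 + ‖k‖) ^ (5 / 2 - a) := by
          apply Real.rpow_le_rpow hk0.le (by linarith) (by linarith)
      _ ≤ (1 + ‖k‖) ^ (4 : ℝ) := by
          apply Real.rpow_le_rpow_of_exponent_le (by linarith) (by linarith)
      _ = (1 + ‖k‖) ^ 4 := by norm_cast
  rw [e, domFn, mul_assoc]
  gcongr
  calc ‖k‖ ^ (5 / 2 - a) * ((1 + ‖k‖) ^ 5)⁻¹ ≤ (1 + ‖k‖) ^ 4 * ((1 + ‖k‖) ^ 5)⁻¹ := by gcongr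
    _ = (1 + ‖k‖)⁻¹ := by field_simp

/-! ### Fourier transforms of test functions -/

section Hat

variable {h : E3 → ℝ}

theorem hat_eq_fourier (h : E3 → ℝ) (k : E3) :
    hat h k = FourierTransform.fourier (fun x => (h x : ℂ)) ((2 * Real.pi)⁻¹ • k) := by
  rw [Real.fourier_eq', hat]
  refine integral_congr_ae (Eventually.of_forall fun x => ?_)
  simp only [smul_eq_mul]
  congr 2
  rw [inner_smul_right, real_inner_comm]
  have : Real.pi ≠ 0 := Real.pi_ne_zero
  push_cast
  field_simp

theorem exists_norm_hat_le (hc : HasCompactSupport h) (hs : ContDiff ℝ ∞ h) :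
    ∃ C, 0 ≤ C ∧ ∀ k, ‖hat h k‖ ≤ C * ((1 + ‖k‖) ^ 5)⁻¹ := by
  have hc' : HasCompactSupport fun x => (h x : ℂ) := hc.comp_left Complex.ofReal_zero
  have hs' : ContDiff ℝ ∞ fun x => (h x : ℂ) := Complex.ofRealCLM.contDiff.comp hs
  set f : SchwartzMap E3 ℂ := hc'.toSchwartzMap hs'
  have key := SchwartzMap.one_add_le_sup_seminorm_apply (𝕜 := ℂ) (m := (5, 0)) (k := 5) (n := 0)
    le_rfl le_rfl (FourierTransform.fourier f)
  set D := 2 ^ (5, 0).1 * ((Finset.Iic (5, 0)).sup fun m => SchwartzMap.seminorm ℂ m.1 m.2)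
    (FourierTransform.fourier f)
  have hD : 0 ≤ D := le_trans (by positivity) (key 0)
  have hpi : 1 ≤ 2 * Real.pi := by linarith [Real.pi_gt_three]
  have hpi0 : 0 < 2 * Real.pi := by linarith
  refine ⟨(2 * Real.pi) ^ 5 * D, by positivity, fun k => ?_⟩
  have h1 := key ((2 * Real.pi)⁻¹ • k)
  rw [norm_iteratedFDeriv_zero] at h1
  have e : FourierTransform.fourier f ((2 * Real.pi)⁻¹ • k) = hat h k := by
    rw [hat_eq_fourier, SchwartzMap.fourier_coe]
    rfl
  rw [e, norm_smul, Real.norm_of_nonneg (by positivity)] at h1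
  rw [← div_eq_mul_inv, le_div_iff₀ (by positivity)]
  have h2 : 1 + ‖k‖ ≤ 2 * Real.pi * (1 + (2 * Real.pi)⁻¹ * ‖k‖) := by
    rw [mul_add, ← mul_assoc, mul_inv_cancel₀ hpi0.ne']
    linarith
  calc ‖hat h k‖ * (1 + ‖k‖) ^ 5 ≤
        ‖hat h k‖ * (2 * Real.pi * (1 + (2 * Real.pi)⁻¹ * ‖k‖)) ^ 5 := by gcongr
    _ = (2 * Real.pi) ^ 5 * ((1 + (2 * Real.pi)⁻¹ * ‖k‖) ^ 5 * ‖hat h k‖) := by ring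
    _ ≤ _ := by gcongr

theorem norm_exp_neg_I_mul (t : ℝ) : ‖Complex.exp (-(Complex.I * (t : ℂ)))‖ = 1 := by
  rw [Complex.norm_exp]
  simp

theorem integrable_hat_integrand (hi : Integrable h) (k : E3) :
    Integrable fun x => Complex.exp (-(Complex.I * ((⟪k, x⟫_ℝ : ℝ) : ℂ))) * (h x : ℂ) := by
  refine Integrable.mono' hi.norm ?_ (Eventually.of_forall fun x => ?_)
  · exact (Continuous.aestronglyMeasurable (by fun_prop)).mul
      (Complex.continuous_ofReal.comp_aestronglyMeasurable hi.1)
  · rw [norm_mul, norm_exp_neg_I_mul, one_mul, Complex.norm_real]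

theorem norm_hat_le_integral (h : E3 → ℝ) (k : E3) : ‖hat h k‖ ≤ ∫ x, ‖h x‖ := by
  refine (norm_integral_le_integral_norm _).trans (le_of_eq ?_)
  refine integral_congr_ae (Eventually.of_forall fun x => ?_)
  simp only
  rw [norm_mul, norm_exp_neg_I_mul, one_mul, Complex.norm_real]

theorem continuous_hat (hi : Integrable h) : Continuous (hat h) := by
  refine continuous_of_dominated (bound := fun x => ‖h x‖)
    (fun k => (integrable_hat_integrand hi k).1) (fun k => Eventually.of_forall fun x => ?_)
    hi.norm (Eventually.of_forall fun x => by fun_prop)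
  rw [norm_mul, norm_exp_neg_I_mul, one_mul, Complex.norm_real]

theorem hat_zero (h : E3 → ℝ) : hat h 0 = ((∫ x, h x : ℝ) : ℂ) := by
  simp [hat, integral_complex_ofReal]

theorem hat_neg (h : E3 → ℝ) (k : E3) : hat h (-k) = starRingEnd ℂ (hat h k) := by
  rw [hat, hat, ← integral_conj]
  refine integral_congr_ae (Eventually.of_forall fun x => ?_)
  simp [← Complex.exp_conj]

theorem hat_translate (h : E3 → ℝ) (y k : E3) :
    hat (fun x => h (x - y)) k = Complex.exp (-(Complex.I * ((⟪k, y⟫_ℝ : ℝ) : ℂ))) * hat h k := by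
  rw [hat, hat, ← integral_const_mul, ← integral_add_right_eq_self _ y]
  refine integral_congr_ae (Eventually.of_forall fun x => ?_)
  simp only [add_sub_cancel_right]
  rw [← mul_assoc, ← Complex.exp_add, inner_add_right]
  congr 2
  push_cast
  ring

theorem hat_dilate (h : E3 → ℝ) {l : ℝ} (hl : 0 < l) (k : E3) :
    hat (fun x => h (l⁻¹ • x)) k = (l : ℂ) ^ 3 * hat h (l • k) := by
  have e := Measure.integral_comp_smul (volume : Measure E3)
    (fun x => Complex.exp (-(Complex.I * ((⟪l • k, x⟫_ℝ : ℝ) : ℂ))) * (h x : ℂ)) l⁻¹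
  rw [hat, hat]
  have e2 : ∀ x : E3, ⟪l • k, l⁻¹ • x⟫_ℝ = ⟪k, x⟫_ℝ := fun x => by
    rw [inner_smul_left, inner_smul_right]
    simp [hl.ne']
  simp only [e2] at e
  rw [e]
  simp [abs_of_pos hl, Complex.real_smul]

theorem re_hat (hi : Integrable h) (k : E3) :
    (hat h k).re = ∫ x, Real.cos ⟪k, x⟫_ℝ * h x := by
  rw [hat, ← RCLike.re_eq_complex_re, ← integral_re (integrable_hat_integrand hi k)]
  refine integral_congr_ae (Eventually.of_forall fun x => ?_)
  have e : Complex.exp (-(Complex.I * ((⟪k, x⟫_ℝ : ℝ) : ℂ))) =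
      Complex.exp (((-⟪k, x⟫_ℝ : ℝ) : ℂ) * Complex.I) := by
    congr 1
    push_cast
    ring
  simp only [RCLike.re_eq_complex_re, Complex.mul_re, Complex.ofReal_re, Complex.ofReal_im,
    mul_zero, sub_zero]
  rw [e, Complex.exp_ofReal_mul_I_re, Real.cos_neg]

theorem exists_norm_hat_sub_le (hc : HasCompactSupport h) (hs : Continuous h) :
    ∃ C, 0 ≤ C ∧ ∀ k, ‖hat h k - ((∫ x, h x : ℝ) : ℂ)‖ ≤ C * ‖k‖ := by
  have hi : Integrable h := hs.integrable_of_hasCompactSupport hc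
  have hi2 : Integrable fun x => ‖x‖ * ‖h x‖ :=
    Continuous.integrable_of_hasCompactSupport (by fun_prop) hc.norm.mul_left
  refine ⟨∫ x, ‖x‖ * ‖h x‖, by positivity, fun k => ?_⟩
  have hi3 : Integrable fun x => (h x : ℂ) := hi.ofReal
  rw [hat, ← integral_complex_ofReal, ← integral_sub (integrable_hat_integrand hi k) hi3,
    ← integral_mul_const]
  refine norm_integral_le_of_norm_le (hi2.mul_const _) (Eventually.of_forall fun x => ?_)
  rw [← sub_one_mul, norm_mul, Complex.norm_real]
  have h1 : ‖Complex.exp (-(Complex.I * ((⟪k, x⟫_ℝ : ℝ) : ℂ))) - 1‖ ≤ ‖x‖ * ‖k‖ := by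
    have h2 := Real.norm_exp_I_mul_ofReal_sub_one_le (x := -⟪k, x⟫_ℝ)
    rw [show Complex.I * ((-⟪k, x⟫_ℝ : ℝ) : ℂ) = -(Complex.I * ((⟪k, x⟫_ℝ : ℝ) : ℂ)) by
      push_cast; ring] at h2
    refine h2.trans ?_
    rw [norm_neg, mul_comm]
    exact norm_inner_le_norm k x
  calc _ ≤ ‖x‖ * ‖k‖ * ‖h x‖ := by gcongr
    _ = _ := by ring

end Hat

/-! ### Waves with spherical symmetry -/

section SphericalWaves

/-- Integration in polar coordinates. -/
theorem integral_eq_integral_sphere {E F : Type*} [NormedAddCommGroup E] [NormedSpace ℝ E]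
    [MeasurableSpace E] [Nontrivial E] [FiniteDimensional ℝ E] [BorelSpace E]
    [NormedAddCommGroup F] [NormedSpace ℝ F] (μ : Measure E) [μ.IsAddHaarMeasure] {f : E → F}
    (hf : Integrable f μ) :
    ∫ x, f x ∂μ = ∫ θ : Metric.sphere (0 : E) 1, (∫ r in Set.Ioi (0 : ℝ),
      r ^ (Module.finrank ℝ E - 1) • f (r • (θ : E))) ∂μ.toSphere := by
  set g : Metric.sphere (0 : E) 1 × Set.Ioi (0 : ℝ) → F := fun p => f ((p.2 : ℝ) • (p.1 : E))
  have hg : ∀ x : ({0}ᶜ : Set E), g (homeomorphUnitSphereProd E x) = f x := by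
    intro x
    have hx : ‖(x : E)‖ ≠ 0 := norm_ne_zero_iff.mpr x.2
    simp [g, smul_smul, hx]
  have hmp := μ.measurePreserving_homeomorphUnitSphereProd
  have hme := (homeomorphUnitSphereProd E).measurableEmbedding
  have hgi : Integrable g (μ.toSphere.prod (.volumeIoiPow (Module.finrank ℝ E - 1))) := by
    rw [← hmp.integrable_comp_emb hme]
    have : g ∘ homeomorphUnitSphereProd E = f ∘ Subtype.val := funext hg
    rw [this, ← integrableOn_iff_comap_subtypeVal (measurableSet_singleton _).compl]
    exact hf.integrableOn
  calc ∫ x, f x ∂μ = ∫ x : ({(0)}ᶜ : Set E), f x ∂(μ.comap (↑)) := by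
        rw [integral_subtype_comap (measurableSet_singleton _).compl f, restrict_compl_singleton]
    _ = ∫ p, g p ∂(μ.toSphere.prod (.volumeIoiPow (Module.finrank ℝ E - 1))) := by
        rw [← hmp.integral_comp hme]
        exact integral_congr_ae (Eventually.of_forall fun x => (hg x).symm)
    _ = _ := by
        rw [integral_prod _ hgi]
        refine integral_congr_ae (Eventually.of_forall fun θ => ?_)
        simp only [Measure.volumeIoiPow, ENNReal.ofReal, g]
        rw [integral_withDensity_eq_integral_smul
            ((measurable_subtype_coe.pow_const _).real_toNNReal),
          integral_subtype_comap measurableSet_Ioi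
            fun a : ℝ => Real.toNNReal (a ^ (Module.finrank ℝ E - 1)) • f (a • (θ : E))]
        refine setIntegral_congr_fun measurableSet_Ioi fun x hx => ?_
        rw [NNReal.smul_def, Real.coe_toNNReal _ (pow_nonneg (Set.mem_Ioi.mp hx).le _)]

theorem integral_gaussian_mul_cos {ε : ℝ} (hε : 0 < ε) (t : ℝ) :
    ∫ r : ℝ, Real.exp (-ε * r ^ 2) * Real.cos (t * r) =
      √(Real.pi / ε) * Real.exp (-t ^ 2 / (4 * ε)) := by
  have h := fourierIntegral_gaussian (b := (ε : ℂ)) (by simpa using hε) (t : ℂ)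
  have hi : Integrable fun r : ℝ =>
      Complex.exp (Complex.I * t * r) * Complex.exp (-(ε : ℂ) * (r : ℂ) ^ 2) := by
    refine (integrable_exp_neg_mul_sq hε).mono' (by fun_prop) (Eventually.of_forall fun r => ?_)
    rw [norm_mul, Complex.norm_exp, Complex.norm_exp]
    simp [← Complex.ofReal_pow]
  have h2 := congrArg Complex.re h
  rw [← RCLike.re_eq_complex_re, ← integral_re hi] at h2
  convert h2 using 1
  · refine integral_congr_ae (Eventually.of_forall fun r => ?_)
    simp only [RCLike.re_eq_complex_re]
    rw [show Complex.I * t * r = ((t * r : ℝ) : ℂ) * Complex.I by push_cast; ring,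
      show -(ε : ℂ) * (r : ℂ) ^ 2 = ((-ε * r ^ 2 : ℝ) : ℂ) by push_cast; ring,
      ← Complex.ofReal_exp, Complex.re_mul_ofReal, Complex.exp_ofReal_mul_I_re, mul_comm]
  · rw [Real.sqrt_eq_rpow, show (-(t : ℂ) ^ 2 / (4 * ε)) = ((-t ^ 2 / (4 * ε) : ℝ) : ℂ) by
      push_cast; ring, ← Complex.ofReal_exp, RCLike.re_eq_complex_re, Complex.re_mul_ofReal,
      ← Complex.ofReal_div, show (1 / 2 : ℂ) = ((1 / 2 : ℝ) : ℂ) by push_cast; ring,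
      ← Complex.ofReal_cpow (by positivity), Complex.ofReal_re]

theorem integrable_gaussian_mul_cos {ε : ℝ} (hε : 0 < ε) (t : ℝ) :
    Integrable fun r : ℝ => Real.exp (-ε * r ^ 2) * Real.cos (t * r) := by
  refine (integrable_exp_neg_mul_sq hε).mono' (by fun_prop) (Eventually.of_forall fun r => ?_)
  rw [norm_mul, Real.norm_of_nonneg (Real.exp_pos _).le]
  exact mul_le_of_le_one_right (Real.exp_pos _).le (Real.abs_cos_le_one _)

theorem integral_Ioi_gaussian_mul_cos_mul_cos {ε : ℝ} (hε : 0 < ε) (s p : ℝ) :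
    ∫ r in Set.Ioi (0 : ℝ), Real.exp (-ε * r ^ 2) * (Real.cos (s * r) * Real.cos (p * r)) =
      √(Real.pi / ε) / 4 *
        (Real.exp (-(s + p) ^ 2 / (4 * ε)) + Real.exp (-(s - p) ^ 2 / (4 * ε))) := by
  have h := integral_comp_abs
    (f := fun r : ℝ => Real.exp (-ε * r ^ 2) * (Real.cos (s * r) * Real.cos (p * r)))
  have e1 : ∀ r : ℝ, Real.exp (-ε * |r| ^ 2) * (Real.cos (s * |r|) * Real.cos (p * |r|)) =
      1 / 2 * (Real.exp (-ε * r ^ 2) * Real.cos ((s + p) * r) +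
        Real.exp (-ε * r ^ 2) * Real.cos ((s - p) * r)) := by
    intro r
    have hc : ∀ t : ℝ, Real.cos (t * |r|) = Real.cos (t * r) := by
      intro t
      rcases abs_cases r with ⟨h, _⟩ | ⟨h, _⟩ <;> rw [h]
      rw [mul_neg, Real.cos_neg]
    rw [sq_abs, hc, hc, add_mul, sub_mul, Real.cos_add, Real.cos_sub]
    ring
  simp only [e1] at h
  rw [integral_const_mul, integral_add (integrable_gaussian_mul_cos hε _)
    (integrable_gaussian_mul_cos hε _), integral_gaussian_mul_cos hε,
    integral_gaussian_mul_cos hε] at h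
  linarith

variable {h : E3 → ℝ}

theorem integrable_re_hat_line (hc : HasCompactSupport h) (hs : ContDiff ℝ ∞ h) {θ : E3}
    (hθ : ‖θ‖ = 1) : Integrable fun r : ℝ => (hat h (r • θ)).re := by
  obtain ⟨C, hC, hb⟩ := exists_norm_hat_le hc hs
  have hi := hs.continuous.integrable_of_hasCompactSupport hc (μ := volume)
  have h1 : Integrable fun r : ℝ => (1 + ‖r‖) ^ (-(5 : ℝ)) :=
    integrable_one_add_norm (by simp)
  have hcont := continuous_hat hi
  refine (h1.const_mul C).mono' (by fun_prop) (Eventually.of_forall fun r => ?_)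
  refine (Complex.abs_re_le_norm _).trans ((hb _).trans (le_of_eq ?_))
  rw [norm_smul, hθ, mul_one, Real.rpow_neg (by positivity)]
  norm_cast

/-- The restriction of `ĥ` to a line through `0` is the one-dimensional Fourier transform of the
integrals of `h` over parallel planes; so it has no frequencies beyond the support of `h`. -/
theorem integral_cos_mul_re_hat_line (hc : HasCompactSupport h) (hs : ContDiff ℝ ∞ h) {r₀ s : ℝ}
    (hsupp : ∀ x, r₀ < ‖x‖ → h x = 0) (hr : r₀ < s) {θ : E3} (hθ : ‖θ‖ = 1) :
    ∫ r in Set.Ioi (0 : ℝ), Real.cos (s * r) * (hat h (r • θ)).re = 0 := by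
  have hi := hs.continuous.integrable_of_hasCompactSupport hc (μ := volume)
  have hline := integrable_re_hat_line hc hs hθ
  have hcont := continuous_hat hi
  -- a Gaussian regulator makes Fubini's theorem applicable
  set G : ℝ → ℝ := fun ε => ∫ r in Set.Ioi (0 : ℝ),
    Real.exp (-ε * r ^ 2) * (Real.cos (s * r) * (hat h (r • θ)).re) with hG
  have hlim : Tendsto G (𝓝[>] 0) (𝓝 (∫ r in Set.Ioi (0 : ℝ),
      Real.cos (s * r) * (hat h (r • θ)).re)) := by
    refine tendsto_integral_filter_of_dominated_convergence
      (fun r => ‖(hat h (r • θ)).re‖) ?_ ?_ hline.norm.integrableOn ?_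
    · exact Eventually.of_forall fun ε => Continuous.aestronglyMeasurable (by fun_prop)
    · filter_upwards [self_mem_nhdsWithin] with ε hε
      refine Eventually.of_forall fun r => ?_
      rw [norm_mul, norm_mul, ← mul_assoc]
      refine mul_le_of_le_one_left (norm_nonneg _) (mul_le_one₀ ?_ (norm_nonneg _) ?_)
      · rw [Real.norm_of_nonneg (Real.exp_pos _).le, Real.exp_le_one_iff]
        have : 0 ≤ ε * r ^ 2 := mul_nonneg (le_of_lt hε) (sq_nonneg r)
        linarith
      · exact Real.abs_cos_le_one _
    · refine Eventually.of_forall fun r => ?_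
      have h1 : Tendsto (fun ε : ℝ => Real.exp (-ε * r ^ 2) *
          (Real.cos (s * r) * (hat h (r • θ)).re)) (𝓝 0)
          (𝓝 (Real.exp (-0 * r ^ 2) * (Real.cos (s * r) * (hat h (r • θ)).re))) :=
        Continuous.tendsto (by fun_prop) 0
      simp only [neg_zero, zero_mul, Real.exp_zero, one_mul] at h1
      exact h1.mono_left nhdsWithin_le_nhds
  have hswap : ∀ ε > 0, G ε = ∫ x, h x * (√(Real.pi / ε) / 4 *
      (Real.exp (-(s + ⟪θ, x⟫_ℝ) ^ 2 / (4 * ε)) + Real.exp (-(s - ⟪θ, x⟫_ℝ) ^ 2 / (4 * ε)))) := by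
    intro ε hε
    have e1 : ∀ r : ℝ, Real.exp (-ε * r ^ 2) * (Real.cos (s * r) * (hat h (r • θ)).re) =
        ∫ x, h x * (Real.exp (-ε * r ^ 2) * (Real.cos (s * r) * Real.cos (⟪θ, x⟫_ℝ * r))) := by
      intro r
      rw [re_hat hi, ← mul_assoc, ← integral_const_mul]
      refine integral_congr_ae (Eventually.of_forall fun x => ?_)
      simp only [inner_smul_left, conj_trivial]
      rw [mul_comm r]
      ring
    simp only [hG, e1]
    rw [integral_integral_swap]
    · refine integral_congr_ae (Eventually.of_forall fun x => ?_)
      simp only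
      rw [integral_const_mul, integral_Ioi_gaussian_mul_cos_mul_cos hε]
    · have hprod : Integrable (fun p : ℝ × E3 => Real.exp (-ε * p.1 ^ 2) * ‖h p.2‖)
          ((volume.restrict (Set.Ioi 0)).prod volume) :=
        (integrable_exp_neg_mul_sq hε).integrableOn.mul_prod hi.norm
      have hhc := hs.continuous
      refine hprod.mono' (Continuous.aestronglyMeasurable (by unfold Function.uncurry; fun_prop))
        (Eventually.of_forall fun p => ?_)
      simp only [Function.uncurry]
      rw [norm_mul, norm_mul, mul_comm, Real.norm_of_nonneg (Real.exp_pos _).le, norm_mul]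
      gcongr
      exact mul_le_of_le_one_right (Real.exp_pos _).le
        (mul_le_one₀ (Real.abs_cos_le_one _) (norm_nonneg _) (Real.abs_cos_le_one _))
  set δ := s - r₀ with hδ
  have hδ0 : 0 < δ := sub_pos.mpr hr
  have hexp : ∀ ε > 0, ∀ t : ℝ, δ ≤ |t| →
      √(Real.pi / ε) * Real.exp (-t ^ 2 / (4 * ε)) ≤ 4 * √(Real.pi * ε) / δ ^ 2 := by
    intro ε hε t ht
    have h1 : δ ^ 2 ≤ t ^ 2 := by
      rw [← sq_abs t]
      gcongr
    have hy : 0 < δ ^ 2 / (4 * ε) := by positivity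
    have h2 : Real.exp (-t ^ 2 / (4 * ε)) ≤ (δ ^ 2 / (4 * ε))⁻¹ := by
      calc Real.exp (-t ^ 2 / (4 * ε)) ≤ Real.exp (-(δ ^ 2 / (4 * ε))) := by
            rw [Real.exp_le_exp, neg_div, neg_le_neg_iff]
            gcongr
        _ = (Real.exp (δ ^ 2 / (4 * ε)))⁻¹ := Real.exp_neg _
        _ ≤ _ := by
            gcongr
            linarith [Real.add_one_le_exp (δ ^ 2 / (4 * ε))]
    have h3 : √(Real.pi / ε) * ε = √(Real.pi * ε) := by
      rw [Real.sqrt_div Real.pi_pos.le, Real.sqrt_mul Real.pi_pos.le]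
      nth_rewrite 2 [← Real.mul_self_sqrt hε.le]
      have : √ε ≠ 0 := (Real.sqrt_pos.mpr hε).ne'
      field_simp
    calc _ ≤ √(Real.pi / ε) * (δ ^ 2 / (4 * ε))⁻¹ := by gcongr
      _ = 4 * (√(Real.pi / ε) * ε) / δ ^ 2 := by
          field_simp
      _ = _ := by rw [h3]
  have hbound : ∀ ε > 0, ‖G ε‖ ≤ (∫ x, ‖h x‖) * (2 * √(Real.pi * ε) / δ ^ 2) := by
    intro ε hε
    rw [hswap ε hε, ← integral_mul_const]
    refine norm_integral_le_of_norm_le (hi.norm.mul_const _) (Eventually.of_forall fun x => ?_)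
    rw [norm_mul]
    by_cases hx : r₀ < ‖x‖
    · simp [hsupp x hx]
    push Not at hx
    have hin : |⟪θ, x⟫_ℝ| ≤ r₀ := by
      refine (abs_real_inner_le_norm θ x).trans ?_
      rwa [hθ, one_mul]
    have hin' := abs_le.mp hin
    have a1 := hexp ε hε (s + ⟪θ, x⟫_ℝ) ((by linarith : δ ≤ s + ⟪θ, x⟫_ℝ).trans (le_abs_self _))
    have a2 := hexp ε hε (s - ⟪θ, x⟫_ℝ) ((by linarith : δ ≤ s - ⟪θ, x⟫_ℝ).trans (le_abs_self _))
    gcongr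
    rw [Real.norm_of_nonneg (by positivity)]
    calc _ = (√(Real.pi / ε) * Real.exp (-(s + ⟪θ, x⟫_ℝ) ^ 2 / (4 * ε)) +
          √(Real.pi / ε) * Real.exp (-(s - ⟪θ, x⟫_ℝ) ^ 2 / (4 * ε))) / 4 := by ring
      _ ≤ (4 * √(Real.pi * ε) / δ ^ 2 + 4 * √(Real.pi * ε) / δ ^ 2) / 4 := by gcongr
      _ = _ := by ring
  have hzero : Tendsto G (𝓝[>] 0) (𝓝 0) := by
    refine squeeze_zero_norm' (eventually_nhdsWithin_of_forall hbound) ?_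
    have : Tendsto (fun ε : ℝ => (∫ x, ‖h x‖) * (2 * √(Real.pi * ε) / δ ^ 2)) (𝓝 0)
        (𝓝 ((∫ x, ‖h x‖) * (2 * √(Real.pi * 0) / δ ^ 2))) :=
      Continuous.tendsto (by fun_prop) 0
    simp only [mul_zero, Real.sqrt_zero, zero_div] at this
    exact this.mono_left nhdsWithin_le_nhds
  exact tendsto_nhds_unique hlim hzero

theorem integrable_rpow_mul_hat (hc : HasCompactSupport h) (hs : ContDiff ℝ ∞ h) {a : ℝ}
    (h1 : -(3 / 2) ≤ a) (h2 : a ≤ 5 / 2) {m : E3 → ℂ} (hm : Measurable m) {C : ℝ}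
    (hb : ∀ k, ‖m k‖ ≤ C * ‖k‖ ^ (-a)) : Integrable fun k => m k * hat h k := by
  have hi := hs.continuous.integrable_of_hasCompactSupport hc (μ := volume)
  obtain ⟨D, hD, hd⟩ := exists_norm_hat_le hc hs
  refine integrable_of_le_domFn (C := C * D)
    (hm.mul (continuous_hat hi).measurable).aestronglyMeasurable fun k hk => ?_
  have hC : 0 ≤ C * ‖k‖ ^ (-a) := (norm_nonneg _).trans (hb k)
  have hC' : 0 ≤ C := nonneg_of_mul_nonneg_left hC
    (Real.rpow_pos_of_pos (norm_pos_iff.mpr hk) _)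
  rw [norm_mul]
  calc _ ≤ (C * ‖k‖ ^ (-a)) * (D * ((1 + ‖k‖) ^ 5)⁻¹) := by
        gcongr
        exacts [hb k, hd k]
    _ = (C * D) * (‖k‖ ^ (-a) * ((1 + ‖k‖) ^ 5)⁻¹) := by ring
    _ ≤ _ := by
        gcongr
        exact rpow_mul_le_domFn hk h1 h2

/-- A sphere of radius `s` which carries the charge `s` has the same constant potential at all points
inside, whatever `s` is. The integral is the derivative of this potential with respect to `s`, tested
with `h`. -/
theorem integral_cos_mul_re_hat (hc : HasCompactSupport h) (hs : ContDiff ℝ ∞ h) {r₀ s : ℝ}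
    (hsupp : ∀ x, r₀ < ‖x‖ → h x = 0) (hr : r₀ < s) :
    ∫ k, ‖k‖ ^ (-2 : ℝ) * Real.cos (s * ‖k‖) * (hat h k).re = 0 := by
  have hint : Integrable fun k => ‖k‖ ^ (-2 : ℝ) * Real.cos (s * ‖k‖) * (hat h k).re := by
    have h1 := (integrable_rpow_mul_hat hc hs (a := 2) (by norm_num) (by norm_num)
      (m := fun k => ((‖k‖ ^ (-2 : ℝ) * Real.cos (s * ‖k‖) : ℝ) : ℂ)) (C := 1)
      (by fun_prop) fun k => ?_).re
    · refine h1.congr (Eventually.of_forall fun k => ?_)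
      simp only [RCLike.re_eq_complex_re, Complex.re_ofReal_mul]
    · rw [Complex.norm_real, norm_mul, Real.norm_of_nonneg (by positivity), one_mul]
      exact mul_le_of_le_one_right (by positivity) (Real.abs_cos_le_one _)
  rw [integral_eq_integral_sphere _ hint]
  refine integral_eq_zero_of_ae (Eventually.of_forall fun θ => ?_)
  have hθ : ‖(θ : E3)‖ = 1 := by simp
  simp only [Pi.zero_apply]
  refine Eq.trans (setIntegral_congr_fun measurableSet_Ioi fun r hr' => ?_)
    (integral_cos_mul_re_hat_line hc hs hsupp hr hθ)
  have hr0 : 0 < r := hr'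
  simp only [norm_smul, hθ, mul_one, Real.norm_of_nonneg hr0.le, smul_eq_mul]
  rw [show Module.finrank ℝ E3 - 1 = 2 by simp, ← mul_assoc, ← mul_assoc, ← Real.rpow_natCast,
    ← Real.rpow_add hr0]
  norm_num

end SphericalWaves

/-! ### Charged shells -/

section Shell

theorem integral_add_eq_zero {f g : E3 → ℝ} (hf : Integrable f ∧ ∫ k, f k = 0)
    (hg : Integrable g ∧ ∫ k, g k = 0) :
    (Integrable fun k => f k + g k) ∧ ∫ k, (f k + g k) = 0 :=
  ⟨hf.1.add hg.1, by rw [integral_add hf.1 hg.1, hf.2, hg.2, add_zero]⟩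

theorem integral_sub_eq_zero {f g : E3 → ℝ} (hf : Integrable f ∧ ∫ k, f k = 0)
    (hg : Integrable g ∧ ∫ k, g k = 0) :
    (Integrable fun k => f k - g k) ∧ ∫ k, (f k - g k) = 0 :=
  ⟨hf.1.sub hg.1, by rw [integral_sub hf.1 hg.1, hf.2, hg.2, sub_zero]⟩

variable {h g : E3 → ℝ}

theorem integrable_radial_mul_hat (hc : HasCompactSupport h) (hs : ContDiff ℝ ∞ h) {m : ℝ → ℝ}
    (hm : Measurable m) {C : ℝ} (hb : ∀ k : E3, |m ‖k‖| ≤ C * ‖k‖ ^ (-2 : ℝ)) :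
    Integrable fun k => ((m ‖k‖ : ℝ) : ℂ) * hat h k :=
  integrable_rpow_mul_hat hc hs (a := 2) (by norm_num) (by norm_num) (by fun_prop)
    fun k => by rw [Complex.norm_real]; exact hb k

theorem integrable_radial_mul_re_hat (hc : HasCompactSupport h) (hs : ContDiff ℝ ∞ h) {m : ℝ → ℝ}
    (hm : Measurable m) {C : ℝ} (hb : ∀ k : E3, |m ‖k‖| ≤ C * ‖k‖ ^ (-2 : ℝ)) :
    Integrable fun k => m ‖k‖ * (hat h k).re := by
  refine (integrable_radial_mul_hat hc hs hm hb).re.congr (Eventually.of_forall fun k => ?_)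
  simp only [RCLike.re_eq_complex_re, Complex.re_ofReal_mul]

theorem integrable_radial_mul_im_hat (hc : HasCompactSupport h) (hs : ContDiff ℝ ∞ h) {m : ℝ → ℝ}
    (hm : Measurable m) {C : ℝ} (hb : ∀ k : E3, |m ‖k‖| ≤ C * ‖k‖ ^ (-2 : ℝ)) :
    Integrable fun k => m ‖k‖ * (hat h k).im := by
  refine (integrable_radial_mul_hat hc hs hm hb).im.congr (Eventually.of_forall fun k => ?_)
  simp only [RCLike.im_eq_complex_im, Complex.im_ofReal_mul]

/-- The imaginary part of the Fourier transform of a real function is odd. -/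
theorem integral_radial_mul_im_hat (h : E3 → ℝ) (m : ℝ → ℝ) :
    ∫ k, m ‖k‖ * (hat h k).im = 0 := by
  have e := integral_neg_eq_self (fun k : E3 => m ‖k‖ * (hat h k).im) volume
  simp only [norm_neg, hat_neg, Complex.conj_im, mul_neg, integral_neg] at e
  linarith

/-- The difference of waves `sin (2Rω) - sin (Rω)`, which is radiated by two spherical shells. -/
noncomputable def shellSin (R w : ℝ) : ℝ := Real.sin (2 * R * w) - Real.sin (R * w)

@[fun_prop]
theorem continuous_shellSin (R : ℝ) : Continuous (shellSin R) := by
  unfold shellSin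
  fun_prop

theorem abs_shellSin_le_two (R w : ℝ) : |shellSin R w| ≤ 2 := by
  unfold shellSin
  have h1 := abs_le.mp (Real.abs_sin_le_one (2 * R * w))
  have h2 := abs_le.mp (Real.abs_sin_le_one (R * w))
  exact abs_le.mpr ⟨by linarith, by linarith⟩

theorem abs_shellSin_le {R w : ℝ} (hR : 0 < R) (hw : 0 ≤ w) : |shellSin R w| ≤ 3 * R * w := by
  unfold shellSin
  have h1 : |Real.sin (2 * R * w)| ≤ |2 * R * w| := Real.abs_sin_le_abs
  have h2 : |Real.sin (R * w)| ≤ |R * w| := Real.abs_sin_le_abs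
  rw [abs_of_nonneg (a := 2 * R * w) (by positivity)] at h1
  rw [abs_of_nonneg (a := R * w) (by positivity)] at h2
  refine (abs_sub _ _).trans ?_
  linarith

theorem rpow_neg_three_mul {w : ℝ} (hw : 0 ≤ w) : w ^ (-3 : ℝ) * w = w ^ (-2 : ℝ) := by
  rcases hw.eq_or_lt with rfl | hw
  · rw [mul_zero, Real.zero_rpow (by norm_num)]
  · nth_rewrite 2 [← Real.rpow_one w]
    rw [← Real.rpow_add hw]
    norm_num

theorem abs_rpow_mul_shellSin_le {R : ℝ} (hR : 0 < R) {w u : ℝ} (hw : 0 ≤ w) (hu : |u| ≤ 1) :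
    |w ^ (-3 : ℝ) * shellSin R w * u| ≤ 3 * R * w ^ (-2 : ℝ) := by
  have h0 : 0 ≤ w ^ (-3 : ℝ) := Real.rpow_nonneg hw _
  rw [abs_mul, abs_mul, abs_of_nonneg h0]
  calc w ^ (-3 : ℝ) * |shellSin R w| * |u| ≤ w ^ (-3 : ℝ) * (3 * R * w) * 1 := by
        gcongr
        exact abs_shellSin_le hR hw
    _ = 3 * R * w ^ (-2 : ℝ) := by rw [← rpow_neg_three_mul hw]; ring

theorem abs_rpow_mul_shellSin_le' (R : ℝ) {w u : ℝ} (hw : 0 ≤ w) (hu : |u| ≤ 1) :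
    |w ^ (-2 : ℝ) * shellSin R w * u| ≤ 2 * w ^ (-2 : ℝ) := by
  have h0 : 0 ≤ w ^ (-2 : ℝ) := Real.rpow_nonneg hw _
  rw [abs_mul, abs_mul, abs_of_nonneg h0]
  calc w ^ (-2 : ℝ) * |shellSin R w| * |u| ≤ w ^ (-2 : ℝ) * 2 * 1 := by
        gcongr
        exact abs_shellSin_le_two R w
    _ = _ := by ring

theorem integrable_cos_mul_re_hat (hc : HasCompactSupport h) (hs : ContDiff ℝ ∞ h) (s : ℝ) :
    Integrable fun k => ‖k‖ ^ (-2 : ℝ) * Real.cos (s * ‖k‖) * (hat h k).re := by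
  refine integrable_radial_mul_re_hat hc hs (m := fun w => w ^ (-2 : ℝ) * Real.cos (s * w))
    (by fun_prop) (C := 1) fun k => ?_
  rw [abs_mul, abs_of_nonneg (by positivity), one_mul]
  exact mul_le_of_le_one_right (by positivity) (Real.abs_cos_le_one _)

theorem integral_cos_mul_cos_mul_re_hat (hc : HasCompactSupport h) (hs : ContDiff ℝ ∞ h)
    {r₀ s t : ℝ} (hsupp : ∀ x, r₀ < ‖x‖ → h x = 0) (hr : r₀ + |t| < s) :
    ∫ k, ‖k‖ ^ (-2 : ℝ) * (Real.cos (s * ‖k‖) * Real.cos (t * ‖k‖)) * (hat h k).re = 0 := by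
  have ht := neg_abs_le t
  have ht' := le_abs_self t
  have e : ∀ k, ‖k‖ ^ (-2 : ℝ) * (Real.cos (s * ‖k‖) * Real.cos (t * ‖k‖)) * (hat h k).re =
      1 / 2 * (‖k‖ ^ (-2 : ℝ) * Real.cos ((s + t) * ‖k‖) * (hat h k).re +
        ‖k‖ ^ (-2 : ℝ) * Real.cos ((s - t) * ‖k‖) * (hat h k).re) := by
    intro k
    rw [add_mul, sub_mul, Real.cos_add, Real.cos_sub]
    ring
  simp only [e]
  rw [integral_const_mul, integral_add (integrable_cos_mul_re_hat hc hs _)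
    (integrable_cos_mul_re_hat hc hs _), integral_cos_mul_re_hat hc hs hsupp (by linarith),
    integral_cos_mul_re_hat hc hs hsupp (by linarith)]
  norm_num

theorem integral_shellSin_mul_cos (hc : HasCompactSupport h) (hs : ContDiff ℝ ∞ h)
    {r₀ R t : ℝ} (hR : 0 < R) (hsupp : ∀ x, r₀ < ‖x‖ → h x = 0) (hr : r₀ + |t| < R) :
    ∫ k, ‖k‖ ^ (-3 : ℝ) * shellSin R ‖k‖ * Real.cos (t * ‖k‖) * (hat h k).re = 0 := by
  -- `sin (2Rω) - sin (Rω)` is the integral of `ω cos (sω)` over `R ≤ s ≤ 2R`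
  have e : ∀ k, ‖k‖ ^ (-3 : ℝ) * shellSin R ‖k‖ * Real.cos (t * ‖k‖) * (hat h k).re =
      ∫ s in Set.Ioc R (2 * R),
        ‖k‖ ^ (-2 : ℝ) * (Real.cos (s * ‖k‖) * Real.cos (t * ‖k‖)) * (hat h k).re := by
    intro k
    have e1 : ∀ s, ‖k‖ ^ (-2 : ℝ) * (Real.cos (s * ‖k‖) * Real.cos (t * ‖k‖)) * (hat h k).re =
        (‖k‖ ^ (-3 : ℝ) * Real.cos (t * ‖k‖) * (hat h k).re) * (‖k‖ * Real.cos (s * ‖k‖)) := by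
      intro s
      rw [← rpow_neg_three_mul (norm_nonneg k)]
      ring
    simp only [e1]
    rw [integral_const_mul, ← intervalIntegral.integral_of_le (by linarith)]
    have e2 : ∫ s in R..2 * R, ‖k‖ * Real.cos (s * ‖k‖) = shellSin R ‖k‖ := by
      rw [intervalIntegral.integral_const_mul, ← smul_eq_mul,
        intervalIntegral.smul_integral_comp_mul_right (fun y => Real.cos y), integral_cos, shellSin]
    rw [e2]
    ring
  simp only [e]
  rw [integral_integral_swap]
  · refine integral_eq_zero_of_ae ?_
    filter_upwards [ae_restrict_mem measurableSet_Ioc] with s hs'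
    exact integral_cos_mul_cos_mul_re_hat hc hs hsupp (hr.trans hs'.1)
  · have h1 := integrable_cos_mul_re_hat hc hs t
    have h2 : Integrable (fun _ : ℝ => (1 : ℝ)) (volume.restrict (Set.Ioc R (2 * R))) :=
      integrable_const _
    have hcont := continuous_hat (hs.continuous.integrable_of_hasCompactSupport hc (μ := volume))
    refine (h1.norm.mul_prod h2).mono' ?_ (Eventually.of_forall fun p => ?_)
    · apply Measurable.aestronglyMeasurable
      have := hcont.measurable
      unfold Function.uncurry
      fun_prop
    · simp only [Function.uncurry, norm_mul, mul_one]
      gcongr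
      exact mul_le_of_le_one_left (norm_nonneg _) (Real.abs_cos_le_one _)

theorem integral_shellSin_mul_sin (hc : HasCompactSupport g) (hs : ContDiff ℝ ∞ g)
    {r₀ R t : ℝ} (hR : 0 < R) (hsupp : ∀ x, r₀ < ‖x‖ → g x = 0) (hr : r₀ + |t| < R) :
    ∫ k, ‖k‖ ^ (-2 : ℝ) * shellSin R ‖k‖ * Real.sin (t * ‖k‖) * (hat g k).re = 0 := by
  have ht := neg_abs_le t
  have ht' := le_abs_self t
  have hi := integrable_cos_mul_re_hat hc hs
  have e : ∀ k, ‖k‖ ^ (-2 : ℝ) * shellSin R ‖k‖ * Real.sin (t * ‖k‖) * (hat g k).re =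
      1 / 2 * ((‖k‖ ^ (-2 : ℝ) * Real.cos ((2 * R - t) * ‖k‖) * (hat g k).re -
        ‖k‖ ^ (-2 : ℝ) * Real.cos ((2 * R + t) * ‖k‖) * (hat g k).re) -
        (‖k‖ ^ (-2 : ℝ) * Real.cos ((R - t) * ‖k‖) * (hat g k).re -
        ‖k‖ ^ (-2 : ℝ) * Real.cos ((R + t) * ‖k‖) * (hat g k).re)) := by
    intro k
    rw [add_mul, sub_mul, add_mul, sub_mul, Real.cos_add, Real.cos_sub, Real.cos_add,
      Real.cos_sub, shellSin]
    ring
  simp only [e]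
  have z : ∀ s, r₀ < s → _ := fun s hs' =>
    And.intro (hi s) (integral_cos_mul_re_hat hc hs hsupp hs')
  rw [integral_const_mul, (integral_sub_eq_zero
    (integral_sub_eq_zero (z (2 * R - t) (by linarith)) (z (2 * R + t) (by linarith)))
    (integral_sub_eq_zero (z (R - t) (by linarith)) (z (R + t) (by linarith)))).2, mul_zero]

/-- The element `i ω^{-3/2} ρ̂` for the spherically symmetric distribution `ρ` which puts the charge
`-q` on the sphere of radius `R` and the charge `2q` on the sphere of radius `2R`. Its total charge
is `q` and its Coulomb potential vanishes in the ball of radius `R`. -/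
noncomputable def shellFn (q R : ℝ) (k : E3) : ℂ :=
  Complex.I * ((q / R * shellSin R ‖k‖ * ‖k‖ ^ (-(5 / 2) : ℝ) : ℝ) : ℂ)

@[fun_prop]
theorem measurable_shellFn (q R : ℝ) : Measurable (shellFn q R) := by
  unfold shellFn
  fun_prop

theorem exp_mul_hat_eq (t : ℝ) (y k : E3) (h : E3 → ℝ) :
    translationPhase (t, y) k * hat h k =
      Complex.exp (((t * ‖k‖ : ℝ) : ℂ) * Complex.I) * hat (fun x => h (x - y)) k := by
  rw [hat_translate, translationPhase, ← mul_assoc, ← Complex.exp_add]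
  congr 2
  push_cast
  ring

theorem conj_shellFn_mul {k : E3} (hk : k ≠ 0) (q R t : ℝ) (y : E3) (h g : E3 → ℝ) :
    starRingEnd ℂ (shellFn q R k) * (translationPhase (t, y) k * timeZeroFn h g k) =
      ((q / R : ℝ) : ℂ) *
        (-Complex.I * (Complex.exp (((t * ‖k‖ : ℝ) : ℂ) * Complex.I) *
            (((‖k‖ ^ (-3 : ℝ) * shellSin R ‖k‖ : ℝ) : ℂ) * hat (fun x => h (x - y)) k)) +
          Complex.exp (((t * ‖k‖ : ℝ) : ℂ) * Complex.I) *
            (((‖k‖ ^ (-2 : ℝ) * shellSin R ‖k‖ : ℝ) : ℂ) * hat (fun x => g (x - y)) k)) := by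
  have hk0 : 0 < ‖k‖ := norm_pos_iff.mpr hk
  have e3 : ‖k‖ ^ (-3 : ℝ) = ‖k‖ ^ (-(5 / 2) : ℝ) * ‖k‖ ^ (-(1 / 2) : ℝ) := by
    rw [← Real.rpow_add hk0]
    norm_num
  have e2 : ‖k‖ ^ (-2 : ℝ) = ‖k‖ ^ (-(5 / 2) : ℝ) * ‖k‖ ^ (1 / 2 : ℝ) := by
    rw [← Real.rpow_add hk0]
    norm_num
  have h1 := exp_mul_hat_eq t y k h
  have h2 := exp_mul_hat_eq t y k g
  rw [e3, e2, timeZeroFn, shellFn, map_mul, Complex.conj_I, Complex.conj_ofReal]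
  push_cast at h1 h2 ⊢
  linear_combination (-(Complex.I * (q / R * shellSin R ‖k‖ * ((‖k‖ ^ (-(5 / 2) : ℝ) : ℝ) : ℂ) *
      ((‖k‖ ^ (-(1 / 2) : ℝ) : ℝ) : ℂ)))) * h1 +
    (q / R * shellSin R ‖k‖ * ((‖k‖ ^ (-(5 / 2) : ℝ) : ℝ) : ℂ) *
      ((‖k‖ ^ (1 / 2 : ℝ) : ℝ) : ℂ)) * h2 -
    (translationPhase (t, y) k * hat g k * (q / R * shellSin R ‖k‖ *
      ((‖k‖ ^ (-(5 / 2) : ℝ) : ℝ) : ℂ) * ((‖k‖ ^ (1 / 2 : ℝ) : ℝ) : ℂ))) * Complex.I_sq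

theorem im_conj_shellFn_mul {k : E3} (hk : k ≠ 0) (q R t : ℝ) (y : E3) (h g : E3 → ℝ) :
    (starRingEnd ℂ (shellFn q R k) * (translationPhase (t, y) k * timeZeroFn h g k)).im =
      q / R *
        (((‖k‖ ^ (-3 : ℝ) * shellSin R ‖k‖ * Real.sin (t * ‖k‖)) *
            (hat (fun x => h (x - y)) k).im -
          (‖k‖ ^ (-3 : ℝ) * shellSin R ‖k‖ * Real.cos (t * ‖k‖)) *
            (hat (fun x => h (x - y)) k).re) +
        ((‖k‖ ^ (-2 : ℝ) * shellSin R ‖k‖ * Real.sin (t * ‖k‖)) *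
            (hat (fun x => g (x - y)) k).re +
          (‖k‖ ^ (-2 : ℝ) * shellSin R ‖k‖ * Real.cos (t * ‖k‖)) *
            (hat (fun x => g (x - y)) k).im)) := by
  rw [conj_shellFn_mul hk, Complex.im_ofReal_mul]
  congr 1
  simp only [Complex.add_im, Complex.mul_im, Complex.mul_re, Complex.neg_re, Complex.neg_im,
    Complex.I_re, Complex.I_im, Complex.ofReal_re, Complex.ofReal_im,
    Complex.exp_ofReal_mul_I_re, Complex.exp_ofReal_mul_I_im]
  ring

theorem integrable_conj_shellFn_mul (hc : HasCompactSupport h) (hs : ContDiff ℝ ∞ h)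
    (hc' : HasCompactSupport g) (hs' : ContDiff ℝ ∞ g) {q R : ℝ} (hR : 0 < R) (t : ℝ) (y : E3) :
    Integrable fun k =>
      starRingEnd ℂ (shellFn q R k) * (translationPhase (t, y) k * timeZeroFn h g k) := by
  have tc : ∀ {f : E3 → ℝ}, HasCompactSupport f → HasCompactSupport fun x => f (x - y) :=
    fun hf => hf.comp_homeomorph (Homeomorph.subRight y)
  have ts : ∀ {f : E3 → ℝ}, ContDiff ℝ ∞ f → ContDiff ℝ ∞ fun x => f (x - y) :=
    fun hf => hf.comp (contDiff_id.sub contDiff_const)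
  have h1 := integrable_radial_mul_hat (tc hc) (ts hs)
    (m := fun w => w ^ (-3 : ℝ) * shellSin R w) (by fun_prop) (C := 3 * R) fun k => by
      simpa using abs_rpow_mul_shellSin_le hR (norm_nonneg k) (u := 1) (by simp)
  have h2 := integrable_radial_mul_hat (tc hc') (ts hs')
    (m := fun w => w ^ (-2 : ℝ) * shellSin R w) (by fun_prop) (C := 2) fun k => by
      simpa using abs_rpow_mul_shellSin_le' R (norm_nonneg k) (u := 1) (by simp)
  have hexp : ∀ {F : E3 → ℂ}, Integrable F → Integrable fun k : E3 =>
      Complex.exp (((t * ‖k‖ : ℝ) : ℂ) * Complex.I) * F k := by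
    intro F hF
    refine hF.bdd_mul (c := 1) (by fun_prop) (Eventually.of_forall fun k => ?_)
    rw [Complex.norm_exp_ofReal_mul_I]
  refine ((((hexp h1).const_mul (-Complex.I)).add (hexp h2)).const_mul ((q / R : ℝ) : ℂ)).congr ?_
  filter_upwards [ae_ne_zero] with k hk
  exact (conj_shellFn_mul hk q R t y h g).symm

/-- No field localised in the double cone over the ball of radius `R` feels the charged shells
outside. -/
theorem im_integral_conj_shellFn_mul (hc : HasCompactSupport h) (hs : ContDiff ℝ ∞ h)
    (hc' : HasCompactSupport g) (hs' : ContDiff ℝ ∞ g) {q r₀ R t : ℝ} (hR : 0 < R) {y : E3}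
    (hh : ∀ x, r₀ < ‖x + y‖ → h x = 0) (hg : ∀ x, r₀ < ‖x + y‖ → g x = 0) (hr : r₀ + |t| < R) :
    (∫ k, starRingEnd ℂ (shellFn q R k) * (translationPhase (t, y) k * timeZeroFn h g k)).im =
      0 := by
  have tc : ∀ {f : E3 → ℝ}, HasCompactSupport f → HasCompactSupport fun x => f (x - y) :=
    fun hf => hf.comp_homeomorph (Homeomorph.subRight y)
  have ts : ∀ {f : E3 → ℝ}, ContDiff ℝ ∞ f → ContDiff ℝ ∞ fun x => f (x - y) :=
    fun hf => hf.comp (contDiff_id.sub contDiff_const)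
  have hh' : ∀ x, r₀ < ‖x‖ → h (x - y) = 0 := fun x hx => hh _ (by simpa using hx)
  have hg' : ∀ x, r₀ < ‖x‖ → g (x - y) = 0 := fun x hx => hg _ (by simpa using hx)
  have b1 : ∀ k : E3, |‖k‖ ^ (-3 : ℝ) * shellSin R ‖k‖ * Real.sin (t * ‖k‖)| ≤
      3 * R * ‖k‖ ^ (-2 : ℝ) := fun k =>
    abs_rpow_mul_shellSin_le hR (norm_nonneg k) (Real.abs_sin_le_one _)
  have b2 : ∀ k : E3, |‖k‖ ^ (-3 : ℝ) * shellSin R ‖k‖ * Real.cos (t * ‖k‖)| ≤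
      3 * R * ‖k‖ ^ (-2 : ℝ) := fun k =>
    abs_rpow_mul_shellSin_le hR (norm_nonneg k) (Real.abs_cos_le_one _)
  have b3 : ∀ k : E3, |‖k‖ ^ (-2 : ℝ) * shellSin R ‖k‖ * Real.sin (t * ‖k‖)| ≤
      2 * ‖k‖ ^ (-2 : ℝ) := fun k =>
    abs_rpow_mul_shellSin_le' R (norm_nonneg k) (Real.abs_sin_le_one _)
  have b4 : ∀ k : E3, |‖k‖ ^ (-2 : ℝ) * shellSin R ‖k‖ * Real.cos (t * ‖k‖)| ≤
      2 * ‖k‖ ^ (-2 : ℝ) := fun k =>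
    abs_rpow_mul_shellSin_le' R (norm_nonneg k) (Real.abs_cos_le_one _)
  have i1 := integrable_radial_mul_im_hat (tc hc) (ts hs)
    (m := fun w => w ^ (-3 : ℝ) * shellSin R w * Real.sin (t * w)) (by fun_prop) b1
  have i2 := integrable_radial_mul_re_hat (tc hc) (ts hs)
    (m := fun w => w ^ (-3 : ℝ) * shellSin R w * Real.cos (t * w)) (by fun_prop) b2
  have i3 := integrable_radial_mul_re_hat (tc hc') (ts hs')
    (m := fun w => w ^ (-2 : ℝ) * shellSin R w * Real.sin (t * w)) (by fun_prop) b3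
  have i4 := integrable_radial_mul_im_hat (tc hc') (ts hs')
    (m := fun w => w ^ (-2 : ℝ) * shellSin R w * Real.cos (t * w)) (by fun_prop) b4
  have z1 := integral_radial_mul_im_hat (fun x => h (x - y))
    fun w => w ^ (-3 : ℝ) * shellSin R w * Real.sin (t * w)
  have z2 := integral_shellSin_mul_cos (tc hc) (ts hs) hR hh' hr
  have z3 := integral_shellSin_mul_sin (tc hc') (ts hs') hR hg' hr
  have z4 := integral_radial_mul_im_hat (fun x => g (x - y))
    fun w => w ^ (-2 : ℝ) * shellSin R w * Real.cos (t * w)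
  rw [← RCLike.im_eq_complex_im, ← integral_im (integrable_conj_shellFn_mul hc hs hc' hs' hR t y)]
  have e := integral_congr_ae (μ := volume) (ae_ne_zero.mono fun k hk =>
    im_conj_shellFn_mul hk q R t y h g)
  refine e.trans ?_
  rw [integral_const_mul, (integral_add_eq_zero (integral_sub_eq_zero ⟨i1, z1⟩ ⟨i2, z2⟩)
    (integral_add_eq_zero ⟨i3, z3⟩ ⟨i4, z4⟩)).2, mul_zero]

end Shell

/-! ### Geometry of double cones and spacelike cones -/

theorem minkowski_self (z : Spacetime) : minkowski z z = z.1 ^ 2 - ‖z.2‖ ^ 2 := by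
  rw [minkowski, real_inner_self_eq_norm_sq]
  ring

theorem minkowski_self_neg {z : Spacetime} : minkowski z z < 0 ↔ |z.1| < ‖z.2‖ := by
  rw [minkowski_self, sub_neg, sq_lt_sq, abs_norm]

theorem mem_forwardCone {z : Spacetime} : z ∈ forwardCone ↔ ‖z.2‖ < z.1 := by
  rw [forwardCone, Set.mem_ofPred_eq, minkowski_self, sub_pos, sq_lt_sq, abs_norm]
  constructor
  · rintro ⟨h1, h2⟩
    rwa [abs_of_pos h2] at h1
  · intro h
    have : 0 < z.1 := (norm_nonneg _).trans_lt h
    exact ⟨by rwa [abs_of_pos this], this⟩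

theorem mem_causalCompl {X : Set Spacetime} {y : Spacetime} :
    y ∈ causalCompl X ↔ ∀ x ∈ X, |y.1 - x.1| < ‖y.2 - x.2‖ := by
  simp only [causalCompl, Set.mem_ofPred_eq, minkowski_self_neg, Prod.fst_sub, Prod.snd_sub]

theorem exists_unit_smul_eq (v : E3) : ∃ u : E3, ‖u‖ = 1 ∧ v = ‖v‖ • u := by
  by_cases hv : v = 0
  · exact ⟨EuclideanSpace.single 0 1, by simp, by simp [hv]⟩
  · have : ‖v‖ ≠ 0 := norm_ne_zero_iff.mpr hv
    exact ⟨‖v‖⁻¹ • v, by simp [norm_smul, this], by simp [smul_smul, this]⟩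

/-- The double cone over the ball of radius `r` around `c` at time `0`. -/
def diamond (c : E3) (r : ℝ) : Set Spacetime := {z | |z.1| + ‖z.2 - c‖ < r}

theorem mem_diamond {c : E3} {r : ℝ} {z : Spacetime} :
    z ∈ diamond c r ↔ |z.1| + ‖z.2 - c‖ < r := Iff.rfl

theorem mem_causalCompl_ball {c : E3} {r : ℝ} (hr : 0 < r) {y : Spacetime} :
    y ∈ causalCompl ({0} ×ˢ Metric.ball c r) ↔ r + |y.1| ≤ ‖y.2 - c‖ := by
  rw [mem_causalCompl]
  constructor
  · intro h
    by_contra! hlt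
    obtain ⟨u, hu, hv⟩ := exists_unit_smul_eq (y.2 - c)
    set d := ‖y.2 - c‖
    -- the point of the ball on the segment from `c` to `y`, at the distance `ρ` from `c`
    set ρ := max 0 (d - |y.1|)
    have hρ0 : 0 ≤ ρ := le_max_left _ _
    have hd0 : 0 ≤ d := norm_nonneg _
    have hρd : ρ ≤ d := max_le hd0 (by linarith [abs_nonneg y.1])
    have hρr : ρ < r := max_lt hr (by linarith)
    have h1 := h (0, c + ρ • u) ⟨rfl, by
      rw [Metric.mem_ball, dist_eq_norm, add_sub_cancel_left, norm_smul, hu, mul_one,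
        Real.norm_of_nonneg hρ0]
      exact hρr⟩
    have e : y.2 - (c + ρ • u) = (d - ρ) • u := by
      rw [sub_smul, ← hv]
      abel
    simp only [sub_zero] at h1
    rw [e, norm_smul, hu, mul_one, Real.norm_of_nonneg (by linarith)] at h1
    linarith [le_max_right 0 (d - |y.1|)]
  · rintro h ⟨t, x⟩ ⟨ht, hx⟩
    obtain rfl : t = 0 := ht
    rw [Metric.mem_ball, dist_eq_norm] at hx
    simp only [sub_zero]
    have := norm_sub_le_norm_sub_add_norm_sub y.2 x c
    linarith

theorem causalCompletion_ball {c : E3} {r : ℝ} (hr : 0 < r) :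
    causalCompletion ({0} ×ˢ Metric.ball c r) = diamond c r := by
  ext z
  rw [causalCompletion, mem_causalCompl, mem_diamond]
  constructor
  · intro h
    have hd : ‖z.2 - c‖ < r := by
      by_contra! hd
      have := h (0, z.2) ((mem_causalCompl_ball hr).mpr (by simpa using hd))
      simp only [sub_self, norm_zero] at this
      exact absurd this (not_lt.mpr (abs_nonneg _))
    obtain ⟨u, hu, hv⟩ := exists_unit_smul_eq (z.2 - c)
    have h1 := h (0, c + r • u) ((mem_causalCompl_ball hr).mpr (by
      simp [norm_smul, hu, abs_of_pos hr]))
    have e : z.2 - (c + r • u) = (‖z.2 - c‖ - r) • u := by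
      rw [sub_smul, ← hv]
      abel
    simp only [sub_zero] at h1
    rw [e, norm_smul, hu, mul_one, Real.norm_of_nonpos (by linarith)] at h1
    linarith
  · intro h y hy
    rw [mem_causalCompl_ball hr] at hy
    have h1 := norm_sub_le_norm_sub_add_norm_sub y.2 z.2 c
    have h2 := abs_sub z.1 y.1
    rw [norm_sub_rev y.2 z.2] at h1
    linarith

theorem isDoubleCone_diamond {r : ℝ} (hr : 0 < r) (c : E3) (a : Spacetime) :
    IsDoubleCone ((fun z => a + z) '' diamond c r) := by
  refine ⟨a + (-r, c), a + (r, c), ?_, ?_⟩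
  · rw [mem_forwardCone]
    simp
    linarith
  · ext z
    simp only [Set.mem_image, Set.mem_ofPred_eq, mem_forwardCone, mem_diamond]
    constructor
    · rintro ⟨w, hw, rfl⟩
      simp only [Prod.fst_sub, Prod.snd_sub, add_sub_add_left_eq_sub]
      rw [norm_sub_rev c]
      have := abs_lt.mp (show |w.1| < r - ‖w.2 - c‖ by linarith)
      exact ⟨by linarith, by linarith⟩
    · rintro ⟨h1, h2⟩
      refine ⟨z - a, ?_, by abel⟩
      simp only [Prod.fst_sub, Prod.snd_sub, Prod.fst_add, Prod.snd_add] at *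
      rw [show a.2 + c - z.2 = -(z.2 - a.2 - c) by abel, norm_neg] at h2
      rw [show z.2 - (a.2 + c) = z.2 - a.2 - c by abel] at h1
      have : |z.1 - a.1| < r - ‖z.2 - a.2 - c‖ := abs_lt.mpr ⟨by linarith, by linarith⟩
      linarith

theorem IsDoubleCone.exists_subset_diamond {O : Set Spacetime} (hO : IsDoubleCone O) :
    ∃ N : ℕ, ∀ n ≥ N, O ⊆ diamond 0 (n + 1) := by
  obtain ⟨p, q, -, rfl⟩ := hO
  obtain ⟨N, hN⟩ := exists_nat_gt (2 * (|p.1| + |q.1|) + ‖p.2‖)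
  refine ⟨N, fun n hn z ⟨h1, h2⟩ => ?_⟩
  rw [mem_forwardCone] at h1 h2
  simp only [Prod.fst_sub, Prod.snd_sub] at h1 h2
  have hn' : (N : ℝ) ≤ n := by exact_mod_cast hn
  have a1 := norm_nonneg (z.2 - p.2)
  have a2 := norm_nonneg (q.2 - z.2)
  have a3 := norm_sub_le_norm_sub_add_norm_sub z.2 p.2 0
  simp only [sub_zero] at a3
  have b1 := neg_abs_le p.1
  have b2 := le_abs_self q.1
  have b3 := abs_nonneg p.1
  have b4 := abs_nonneg q.1
  have b5 : |z.1| ≤ |p.1| + |q.1| := abs_le.mpr ⟨by linarith, by linarith⟩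
  rw [mem_diamond, sub_zero]
  linarith

theorem le_of_translate_diamond_subset {c : E3} {r R : ℝ} (hr : 0 < r) {a : Spacetime}
    (h : (fun z => a + z) '' diamond c r ⊆ diamond 0 R) : |a.1| + ‖c + a.2‖ + r ≤ R := by
  obtain ⟨u, hu, hv⟩ := exists_unit_smul_eq (c + a.2)
  set X := |a.1| + ‖c + a.2‖ with hX
  have key : ∀ s, 0 ≤ s → s < r → X + s < R := by
    intro s hs hsr
    have h1 := h ⟨(0, c + s • u), by simp [mem_diamond, norm_smul, hu, abs_of_nonneg hs, hsr], rfl⟩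
    rw [mem_diamond] at h1
    simp only [Prod.fst_add, Prod.snd_add, add_zero, sub_zero] at h1
    have e : a.2 + (c + s • u) = (‖c + a.2‖ + s) • u := by
      rw [add_smul, ← hv]
      abel
    rw [e, norm_smul, hu, mul_one, Real.norm_of_nonneg (by positivity)] at h1
    linarith
  by_contra! hlt
  have h0 := key 0 le_rfl hr
  have := key (R - X) (by linarith) (by linarith)
  linarith

/-- An open convex cone which is not the whole space lies in an open half space. -/
theorem IsOpenConvexCone.exists_inner_pos {C : Set E3} (hC : IsOpenConvexCone C)
    (hne : C ≠ Set.univ) : ∃ n : E3, ‖n‖ = 1 ∧ ∀ x ∈ C, 0 < ⟪n, x⟫_ℝ := by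
  have h0 : (0 : E3) ∉ C := by
    intro h0
    apply hne
    obtain ⟨ε, hε, hb⟩ := Metric.isOpen_iff.mp hC.isOpen 0 h0
    refine Set.eq_univ_of_forall fun x => ?_
    have hx : 0 < ‖x‖ + 1 := by positivity
    have h1 := hb (show (ε / (‖x‖ + 1)) • x ∈ Metric.ball 0 ε by
      rw [mem_ball_zero_iff, norm_smul, Real.norm_of_nonneg (by positivity), div_mul_eq_mul_div,
        div_lt_iff₀ hx]
      nlinarith)
    have h2 := hC.smul_mem ((ε / (‖x‖ + 1))⁻¹) (by positivity) _ h1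
    rwa [smul_smul, inv_mul_cancel₀ (by positivity), one_smul] at h2
  obtain ⟨f, hf⟩ := geometric_hahn_banach_open_point hC.convex hC.isOpen h0
  set m := (InnerProductSpace.toDual ℝ E3).symm f
  have hm : ∀ x ∈ C, ⟪m, x⟫_ℝ < 0 := by
    intro x hx
    have := hf x hx
    rwa [map_zero, ← InnerProductSpace.toDual_symm_apply] at this
  have hm0 : 0 < ‖m‖ := by
    rw [norm_pos_iff]
    intro h
    obtain ⟨x, hx⟩ := hC.nonempty
    have := hm x hx
    simp [h] at this
  refine ⟨-(‖m‖⁻¹ • m), by simp [norm_smul, hm0.ne'], fun x hx => ?_⟩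
  rw [inner_neg_left, inner_smul_left, conj_trivial]
  have := mul_neg_of_pos_of_neg (inv_pos.mpr hm0) (hm x hx)
  linarith

theorem minkowski_preserving_surjective {Λ : Spacetime →ₗ[ℝ] Spacetime}
    (hΛ : ∀ x y, minkowski (Λ x) (Λ y) = minkowski x y) : Function.Surjective Λ := by
  refine LinearMap.surjective_of_injective ((injective_iff_map_eq_zero Λ).mpr fun x hx => ?_)
  have h1 : ∀ y, minkowski x y = 0 := fun y => by
    rw [← hΛ, hx]
    simp [minkowski]
  have h2 := h1 (x.1, 0)
  have h3 := h1 (0, x.2)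
  simp only [minkowski, inner_zero_right, sub_zero, mul_zero, zero_sub, neg_eq_zero,
    inner_self_eq_zero, mul_self_eq_zero] at h2 h3
  exact Prod.ext h2 h3

theorem abs_minkowski_le (z w : Spacetime) : |minkowski z w| ≤ |z.1| * |w.1| + ‖z.2‖ * ‖w.2‖ := by
  rw [minkowski]
  refine (abs_sub _ _).trans ?_
  rw [abs_mul]
  gcongr
  exact abs_real_inner_le_norm _ _

/-- The causal complement of a spacelike cone contains a translate of a cone at time zero. The cone
lies in a wedge; the Poincaré image of the opposite wedge is given by two lightlike vectors with a
negative Minkowski product, and every such wedge meets the time zero hyperplane. -/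
theorem IsSpacelikeCone.exists_diamond_subset {S : Set Spacetime} (hS : IsSpacelikeCone S) :
    ∃ (a : Spacetime) (x₀ : E3) (r : ℝ), 0 < r ∧
      ∀ l : ℝ, 0 < l → (fun z => a + z) '' diamond (l • x₀) (l * r) ⊆ causalCompl S := by
  obtain ⟨C, Λ, a, hC, hne, hΛ, rfl⟩ := hS
  obtain ⟨n, hn, hnC⟩ := hC.exists_inner_pos hne
  -- the wedge opposite to `C`, in terms of the lightlike vectors `(∓1, n)`
  have hwedge : ∀ u : Spacetime, 0 ≤ minkowski u (-1, n) → 0 ≤ minkowski u (1, n) →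
      u ∈ causalCompl ({0} ×ˢ C) := by
    rintro ⟨s, y⟩ h1 h2
    simp only [minkowski, mul_neg, mul_one] at h1 h2
    rw [mem_causalCompl]
    rintro ⟨t, x⟩ ⟨ht, hx⟩
    obtain rfl : t = 0 := ht
    simp only [sub_zero]
    have h3 := hnC x hx
    have h4 : ⟪n, x - y⟫_ℝ ≤ ‖x - y‖ := by
      refine (real_inner_le_norm _ _).trans ?_
      rw [hn, one_mul]
    rw [inner_sub_right, real_inner_comm y n] at h4
    rw [norm_sub_rev]
    have : |s| ≤ -⟪y, n⟫_ℝ := abs_le.mpr ⟨by linarith, by linarith⟩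
    linarith
  have hnn : ⟪n, n⟫_ℝ = 1 := by rw [real_inner_self_eq_norm_sq, hn, one_pow]
  obtain ⟨⟨b₁, m₁⟩, hℓ₁⟩ : ∃ v, Λ (-1, n) = v := ⟨_, rfl⟩
  obtain ⟨⟨b₂, m₂⟩, hℓ₂⟩ : ∃ v, Λ (1, n) = v := ⟨_, rfl⟩
  have e11 := hΛ (-1, n) (-1, n)
  have e22 := hΛ (1, n) (1, n)
  have e12 := hΛ (-1, n) (1, n)
  rw [hℓ₁] at e11
  rw [hℓ₂] at e22
  rw [hℓ₁, hℓ₂] at e12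
  simp only [minkowski, hnn, real_inner_self_eq_norm_sq] at e11 e22 e12
  have hb₁ : |b₁| = ‖m₁‖ := by
    rw [← abs_norm, ← sq_eq_sq_iff_abs_eq_abs]
    linarith
  have hb₂ : |b₂| = ‖m₂‖ := by
    rw [← abs_norm, ← sq_eq_sq_iff_abs_eq_abs]
    linarith
  have hprod : 0 < ‖m₁‖ * ‖m₂‖ + ⟪m₁, m₂⟫_ℝ := by
    have := neg_abs_le (b₁ * b₂)
    rw [abs_mul, hb₁, hb₂] at this
    linarith
  have hm₁ : 0 < ‖m₁‖ := by
    rw [norm_pos_iff]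
    rintro rfl
    simp at hprod
  have hm₂ : 0 < ‖m₂‖ := by
    rw [norm_pos_iff]
    rintro rfl
    simp at hprod
  set K := ‖m₁‖ * ‖m₂‖ + ⟪m₁, m₂⟫_ℝ with hK
  set x₀ : E3 := -(‖m₂‖ • m₁ + ‖m₁‖ • m₂) with hx₀
  have hx1 : -⟪x₀, m₁⟫_ℝ = ‖m₁‖ * K := by
    rw [hx₀, inner_neg_left, inner_add_left, inner_smul_left, inner_smul_left,
      real_inner_self_eq_norm_sq, real_inner_comm m₁ m₂, hK]
    simp only [conj_trivial]
    ring
  have hx2 : -⟪x₀, m₂⟫_ℝ = ‖m₂‖ * K := by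
    rw [hx₀, inner_neg_left, inner_add_left, inner_smul_left, inner_smul_left,
      real_inner_self_eq_norm_sq, hK]
    simp only [conj_trivial]
    ring
  refine ⟨a, x₀, K, hprod, fun l hl => ?_⟩
  rintro _ ⟨p, hp, rfl⟩
  rw [mem_diamond] at hp
  have hpos : ∀ (b : ℝ) (m : E3), |b| = ‖m‖ → -⟪x₀, m⟫_ℝ = ‖m‖ * K →
      0 ≤ minkowski p (b, m) := by
    intro b m hb hxm
    have e : minkowski p (b, m) = minkowski (p.1, p.2 - l • x₀) (b, m) + l * (‖m‖ * K) := by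
      rw [← hxm]
      simp only [minkowski, inner_sub_left, inner_smul_left, conj_trivial]
      ring
    have h1 := (abs_le.mp (abs_minkowski_le (p.1, p.2 - l • x₀) (b, m))).1
    simp only [hb] at h1
    have h2 : (|p.1| + ‖p.2 - l • x₀‖) * ‖m‖ ≤ l * K * ‖m‖ := by gcongr
    rw [e]
    linarith
  obtain ⟨u, rfl⟩ := minkowski_preserving_surjective hΛ p
  have hu : u ∈ causalCompl ({0} ×ˢ C) := by
    refine hwedge u ?_ ?_
    · rw [← hΛ, hℓ₁]
      exact hpos _ _ hb₁ hx1
    · rw [← hΛ, hℓ₂]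
      exact hpos _ _ hb₂ hx2
  rintro _ ⟨z, hz, rfl⟩
  simp only [add_sub_add_left_eq_sub]
  rw [← map_sub, hΛ]
  have h1 := hz u hu
  rw [minkowski_self_neg] at h1 ⊢
  simpa only [Prod.fst_sub, Prod.snd_sub, abs_sub_comm, norm_sub_rev] using h1

theorem diamond_subset_causalCompletion {C : Set E3} {c : E3} {r : ℝ} (hr : 0 < r)
    (h : Metric.ball c r ⊆ C) : diamond c r ⊆ causalCompletion ({0} ×ˢ C) := by
  rw [← causalCompletion_ball hr]
  intro z hz y hy
  exact hz y fun x hx => hy x ⟨hx.1, h hx.2⟩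

/-! ### Regularised charges as one-particle vectors -/

section ChargeVectors

section TestFunctions

theorem RealTest.contDiff {Ω : TopologicalSpace.Opens E3} (h : RealTest Ω) : ContDiff ℝ ∞ h :=
  TestFunction.contDiff h

theorem RealTest.hasCompactSupport {Ω : TopologicalSpace.Opens E3} (h : RealTest Ω) :
    HasCompactSupport h :=
  TestFunction.hasCompactSupport h

theorem RealTest.integrable {Ω : TopologicalSpace.Opens E3} (h : RealTest Ω) :
    Integrable (h : E3 → ℝ) :=
  h.contDiff.continuous.integrable_of_hasCompactSupport h.hasCompactSupport

@[fun_prop]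
theorem RealTest.measurable_hat {Ω : TopologicalSpace.Opens E3} (h : RealTest Ω) :
    Measurable (hat h) :=
  (continuous_hat h.integrable).measurable

theorem RealTest.exists_lt {c : E3} {r : ℝ} (h : RealTest (ballOpens c r)) :
    ∃ r' < r, ∀ x, r' ≤ ‖x - c‖ → h x = 0 := by
  obtain ⟨r', hr', hsub⟩ := exists_lt_subset_ball (isClosed_tsupport (h : E3 → ℝ))
    (TestFunction.tsupport_subset h : tsupport (h : E3 → ℝ) ⊆ Metric.ball c r)
  refine ⟨r', hr', fun x hx => ?_⟩
  by_contra hne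
  have := hsub (subset_tsupport _ (Function.mem_support.mpr hne))
  rw [Metric.mem_ball, dist_eq_norm] at this
  linarith

end TestFunctions

theorem abs_sin_two_mul_sub_sin_sub_le {x : ℝ} (hx : 0 < x) :
    |Real.sin (2 * x) - Real.sin x - x| ≤ 8 * x * x := by
  rcases le_or_gt x (1 / 2) with h | h
  · have a1 := Real.sin_gt_sub_cube (x := 2 * x) (by linarith)
    have a2 := Real.sin_lt (x := 2 * x) (by linarith)
    have a3 := Real.sin_gt_sub_cube hx
    have a4 := Real.sin_lt hx
    have a5 : x ^ 3 ≤ x * x := by nlinarith [mul_pos hx hx]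
    rw [abs_le]
    constructor <;> nlinarith
  · have a1 : |Real.sin (2 * x)| ≤ |2 * x| := Real.abs_sin_le_abs
    have a2 : |Real.sin x| ≤ |x| := Real.abs_sin_le_abs
    rw [abs_of_pos (by linarith : 0 < 2 * x)] at a1
    rw [abs_of_pos hx] at a2
    have a3 := abs_le.mp a1
    have a4 := abs_le.mp a2
    rw [abs_le]
    constructor <;> nlinarith

variable (σ ρ : RealTest ⊤)

@[fun_prop]
theorem measurable_chargeFn : Measurable (chargeFn σ ρ) := by
  unfold chargeFn
  fun_prop

/-- The total charge of `ρ` equals that of the two shells, so the infrared singularities cancel. -/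
theorem exists_charge_difference_le {R : ℝ} (hR : 0 < R) : ∃ M, 0 ≤ M ∧ ∀ k : E3, k ≠ 0 →
    ‖hat ρ k - ((charge ρ * (shellSin R ‖k‖ / (R * ‖k‖)) : ℝ) : ℂ)‖ ≤ M * ‖k‖ ∧
    ‖hat ρ k - ((charge ρ * (shellSin R ‖k‖ / (R * ‖k‖)) : ℝ) : ℂ)‖ ≤ M * ‖k‖⁻¹ := by
  obtain ⟨C₁, hC₁, h₁⟩ := exists_norm_hat_le ρ.hasCompactSupport ρ.contDiff
  obtain ⟨C₂, hC₂, h₂⟩ := exists_norm_hat_sub_le ρ.hasCompactSupport ρ.contDiff.continuous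
  set q := charge ρ with hq
  refine ⟨C₁ + C₂ + |q| * (8 * R) + |q| * (2 / R), by positivity, fun k hk => ?_⟩
  have hk0 : 0 < ‖k‖ := norm_pos_iff.mpr hk
  have hRk : 0 < R * ‖k‖ := mul_pos hR hk0
  constructor
  · have e : hat ρ k - ((q * (shellSin R ‖k‖ / (R * ‖k‖)) : ℝ) : ℂ) = (hat ρ k - (q : ℂ)) -
        ((q * ((shellSin R ‖k‖ - R * ‖k‖) / (R * ‖k‖)) : ℝ) : ℂ) := by
      rw [sub_div, div_self hRk.ne']
      push_cast
      ring
    have a1 : |(shellSin R ‖k‖ - R * ‖k‖) / (R * ‖k‖)| ≤ 8 * (R * ‖k‖) := by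
      rw [abs_div, abs_of_pos hRk, div_le_iff₀ hRk, shellSin, mul_assoc 2 R]
      exact abs_sin_two_mul_sub_sin_sub_le hRk
    rw [e]
    refine (norm_sub_le _ _).trans ?_
    rw [Complex.norm_real, norm_mul, Real.norm_eq_abs, Real.norm_eq_abs]
    have a2 := h₂ k
    have a3 : |q| * |(shellSin R ‖k‖ - R * ‖k‖) / (R * ‖k‖)| ≤ |q| * (8 * (R * ‖k‖)) := by gcongr
    have a4 : 0 ≤ (C₁ + |q| * (2 / R)) * ‖k‖ := by positivity
    have a5 : ‖hat ρ k - (q : ℂ)‖ ≤ C₂ * ‖k‖ := a2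
    linarith
  · refine (norm_sub_le _ _).trans ?_
    rw [Complex.norm_real, norm_mul, Real.norm_eq_abs, Real.norm_eq_abs, abs_div, abs_of_pos hRk]
    have a1 : ‖hat ρ k‖ ≤ C₁ * ‖k‖⁻¹ := by
      refine (h₁ k).trans ?_
      gcongr
      calc ‖k‖ ≤ 1 + ‖k‖ := by linarith
        _ ≤ (1 + ‖k‖) ^ 5 := le_self_pow₀ (by linarith) (by norm_num)
    have a2 : |q| * (|shellSin R ‖k‖| / (R * ‖k‖)) ≤ |q| * (2 / (R * ‖k‖)) := by
      gcongr
      exact abs_shellSin_le_two _ _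
    have a3 : |q| * (2 / (R * ‖k‖)) = |q| * (2 / R) * ‖k‖⁻¹ := by field_simp
    have a4 : 0 ≤ (C₂ + |q| * (8 * R)) * ‖k‖⁻¹ := by positivity
    linarith

theorem chargeFn_sub_shellFn {k : E3} (hk : k ≠ 0) (R : ℝ) :
    chargeFn σ ρ k - shellFn (charge ρ) R k = ((‖k‖ ^ (-(1 / 2) : ℝ) : ℝ) : ℂ) * hat σ k +
      Complex.I * ((‖k‖ ^ (-(3 / 2) : ℝ) : ℝ) : ℂ) *
        (hat ρ k - ((charge ρ * (shellSin R ‖k‖ / (R * ‖k‖)) : ℝ) : ℂ)) := by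
  have hk0 : 0 < ‖k‖ := norm_pos_iff.mpr hk
  have e : ‖k‖ ^ (-(5 / 2) : ℝ) = ‖k‖ ^ (-(3 / 2) : ℝ) * ‖k‖⁻¹ := by
    rw [← Real.rpow_neg_one, ← Real.rpow_add hk0]
    norm_num
  rw [chargeFn, shellFn, e]
  push_cast
  field_simp
  ring

theorem rpow_neg_three_mul_sq_le {k : E3} (hk : k ≠ 0) {e M : ℝ} (he : 0 ≤ e)
    (h1 : e ≤ M * ‖k‖) (h2 : e ≤ M * ‖k‖⁻¹) : ‖k‖ ^ (-3 : ℝ) * e ^ 2 ≤ 2 * M ^ 2 * domFn k := by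
  have hk0 : 0 < ‖k‖ := norm_pos_iff.mpr hk
  have hM : 0 ≤ M := nonneg_of_mul_nonneg_left (he.trans h1) hk0
  rcases le_total ‖k‖ 1 with h | h
  · calc ‖k‖ ^ (-3 : ℝ) * e ^ 2 ≤ ‖k‖ ^ (-3 : ℝ) * (M * ‖k‖) ^ 2 := by gcongr
      _ = 2 * M ^ 2 * (‖k‖ ^ (-1 : ℝ) * 2⁻¹) := by
          rw [show (-1 : ℝ) = -3 + 2 by norm_num, Real.rpow_add hk0, Real.rpow_two]
          ring
      _ ≤ 2 * M ^ 2 * domFn k := by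
          rw [domFn]
          have a1 : ‖k‖ ^ (-1 : ℝ) ≤ ‖k‖ ^ (-(5 / 2) : ℝ) :=
            Real.rpow_le_rpow_of_exponent_ge hk0 h (by norm_num)
          gcongr
          linarith
  · calc ‖k‖ ^ (-3 : ℝ) * e ^ 2 ≤ ‖k‖ ^ (-3 : ℝ) * (M * ‖k‖⁻¹) ^ 2 := by gcongr
      _ = 2 * M ^ 2 * (‖k‖ ^ (-4 : ℝ) * (2 * ‖k‖)⁻¹) := by
          rw [show (-4 : ℝ) = -3 + -1 by norm_num, Real.rpow_add hk0, Real.rpow_neg_one]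
          ring
      _ ≤ 2 * M ^ 2 * domFn k := by
          rw [domFn]
          have a1 : ‖k‖ ^ (-4 : ℝ) ≤ ‖k‖ ^ (-(5 / 2) : ℝ) :=
            Real.rpow_le_rpow_of_exponent_le h (by norm_num)
          gcongr
          linarith

theorem rpow_mul_sq_norm_hat_le {Ω : TopologicalSpace.Opens E3} (h : RealTest Ω) :
    ∃ C, ∀ k ≠ 0, ‖((‖k‖ ^ (-(1 / 2) : ℝ) : ℝ) : ℂ) * hat h k‖ ^ 2 ≤ C * domFn k := by
  obtain ⟨C, hC, hb⟩ := exists_norm_hat_le h.hasCompactSupport h.contDiff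
  refine ⟨C ^ 2, fun k hk => ?_⟩
  have hk0 : 0 < ‖k‖ := norm_pos_iff.mpr hk
  have e : (‖k‖ ^ (-(1 / 2) : ℝ)) ^ 2 = ‖k‖ ^ (-1 : ℝ) := by
    rw [← Real.rpow_natCast, ← Real.rpow_mul hk0.le]
    norm_num
  have h1 : (1 : ℝ) ≤ (1 + ‖k‖) ^ 5 := one_le_pow₀ (by linarith)
  rw [norm_mul, mul_pow, Complex.norm_real, Real.norm_of_nonneg (by positivity), e]
  calc ‖k‖ ^ (-1 : ℝ) * ‖hat h k‖ ^ 2 ≤ ‖k‖ ^ (-1 : ℝ) * (C * ((1 + ‖k‖) ^ 5)⁻¹) ^ 2 := by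
        gcongr
        exact hb k
    _ = C ^ 2 * (‖k‖ ^ (-1 : ℝ) * ((1 + ‖k‖) ^ 5)⁻¹) * ((1 + ‖k‖) ^ 5)⁻¹ := by ring
    _ ≤ C ^ 2 * domFn k * 1 := by
        gcongr
        · exact mul_nonneg (sq_nonneg _) (domFn_nonneg k)
        · exact rpow_mul_le_domFn hk (by norm_num) (by norm_num)
        · exact inv_le_one_of_one_le₀ h1
    _ = _ := mul_one _

theorem memLp_of_sq_le_domFn {f : E3 → ℂ} (hf : Measurable f) {C : ℝ}
    (h : ∀ k ≠ 0, ‖f k‖ ^ 2 ≤ C * domFn k) : MemLp f 2 := by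
  rw [memLp_two_iff_integrable_sq_norm hf.aestronglyMeasurable]
  refine integrable_of_le_domFn (hf.norm.pow_const 2).aestronglyMeasurable C fun k hk => ?_
  rw [Real.norm_of_nonneg (by positivity)]
  exact h k hk

theorem memLp_chargeFn_sub_shellFn {R : ℝ} (hR : 0 < R) :
    MemLp (fun k => chargeFn σ ρ k - shellFn (charge ρ) R k) 2 := by
  obtain ⟨C, hC⟩ := rpow_mul_sq_norm_hat_le σ
  obtain ⟨M, hM, hb⟩ := exists_charge_difference_le ρ hR
  refine memLp_of_sq_le_domFn (C := 2 * (C + 2 * M ^ 2)) (by fun_prop) fun k hk => ?_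
  have hk0 : 0 < ‖k‖ := norm_pos_iff.mpr hk
  rw [chargeFn_sub_shellFn σ ρ hk R]
  set A := ((‖k‖ ^ (-(1 / 2) : ℝ) : ℝ) : ℂ) * hat σ k
  set D := hat ρ k - ((charge ρ * (shellSin R ‖k‖ / (R * ‖k‖)) : ℝ) : ℂ)
  have h1 : ‖Complex.I * ((‖k‖ ^ (-(3 / 2) : ℝ) : ℝ) : ℂ) * D‖ ^ 2 ≤ 2 * M ^ 2 * domFn k := by
    have e : (‖k‖ ^ (-(3 / 2) : ℝ)) ^ 2 = ‖k‖ ^ (-3 : ℝ) := by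
      rw [← Real.rpow_natCast, ← Real.rpow_mul hk0.le]
      norm_num
    rw [norm_mul, norm_mul, Complex.norm_I, one_mul, Complex.norm_real,
      Real.norm_of_nonneg (by positivity), mul_pow, e]
    exact rpow_neg_three_mul_sq_le hk (norm_nonneg _) (hb k hk).1 (hb k hk).2
  have h2 := hC k hk
  have h3 := add_sq_le (a := ‖A‖) (b := ‖Complex.I * ((‖k‖ ^ (-(3 / 2) : ℝ) : ℝ) : ℂ) * D‖)
  have h4 := pow_le_pow_left₀ (norm_nonneg _)
    (norm_add_le A (Complex.I * ((‖k‖ ^ (-(3 / 2) : ℝ) : ℝ) : ℂ) * D)) 2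
  linarith

/-- The one-particle vector whose Weyl operator implements the automorphism `γ` on the double cone
over the ball of radius `R`: the shells of charge outside compensate the charge of `γ`. -/
noncomputable def chargeVec (R : ℝ) (hR : 0 < R) : OneParticle :=
  (memLp_chargeFn_sub_shellFn σ ρ hR).toLp _

theorem integrable_conj_mul (v f : OneParticle) :
    Integrable fun k => starRingEnd ℂ (v k) * f k := by
  have := L2.integrable_inner (𝕜 := ℂ) v f
  simpa [RCLike.inner_apply, mul_comm] using this

theorem inner_eq_integral (v f : OneParticle) :
    ⟪v, f⟫_ℂ = ∫ k, starRingEnd ℂ (v k) * f k := by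
  rw [L2.inner_def]
  simp [RCLike.inner_apply, mul_comm]

theorem shellFn_orthogonal {O : Set Spacetime} {R : ℝ} (hR : 0 < R) (hO : O ⊆ diamond 0 R) (q : ℝ)
    {f : OneParticle} (hf : f ∈ localSpace O) :
    (Integrable fun k => starRingEnd ℂ (shellFn q R k) * f k) ∧
      (∫ k, starRingEnd ℂ (shellFn q R k) * f k).im = 0 := by
  refine Submodule.span_induction ?_ ?_ ?_ ?_ hf
  · rintro f ⟨c, r, a, h, g, hr, hsub, hfe⟩
    rw [causalCompletion_ball hr] at hsub
    have hle := le_of_translate_diamond_subset hr (hsub.trans hO)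
    obtain ⟨r₁, hr₁, hh⟩ := h.exists_lt
    obtain ⟨r₂, hr₂, hg⟩ := g.exists_lt
    have hsupp : ∀ x, max r₁ r₂ + ‖c + a.2‖ < ‖x + a.2‖ → max r₁ r₂ ≤ ‖x - c‖ := by
      intro x hx
      have := norm_add_le (x - c) (c + a.2)
      rw [show x - c + (c + a.2) = x + a.2 by abel] at this
      linarith
    have hmax : max r₁ r₂ < r := max_lt hr₁ hr₂
    have e : (fun k => starRingEnd ℂ (shellFn q R k) * f k) =ᵐ[volume]
        fun k => starRingEnd ℂ (shellFn q R k) *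
          (translationPhase (a.1, a.2) k * timeZeroFn h g k) := by
      filter_upwards [hfe] with k hk
      rw [hk]
    refine ⟨(integrable_congr e).mpr (integrable_conj_shellFn_mul h.hasCompactSupport h.contDiff
      g.hasCompactSupport g.contDiff hR _ _), ?_⟩
    rw [integral_congr_ae e]
    exact im_integral_conj_shellFn_mul h.hasCompactSupport h.contDiff g.hasCompactSupport
      g.contDiff hR (r₀ := max r₁ r₂ + ‖c + a.2‖)
      (fun x hx => hh x ((le_max_left _ _).trans (hsupp x hx)))
      (fun x hx => hg x ((le_max_right _ _).trans (hsupp x hx))) (by linarith)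
  · have e : (fun k => starRingEnd ℂ (shellFn q R k) * (0 : OneParticle) k) =ᵐ[volume]
        fun _ => (0 : ℂ) := by
      filter_upwards [Lp.coeFn_zero ℂ 2 (volume : Measure E3)] with k hk
      rw [hk]
      simp
    exact ⟨(integrable_congr e).mpr (integrable_zero _ _ _), by rw [integral_congr_ae e]; simp⟩
  · rintro f₁ f₂ - - ⟨i₁, h₁⟩ ⟨i₂, h₂⟩
    have e : (fun k => starRingEnd ℂ (shellFn q R k) * (f₁ + f₂ : OneParticle) k) =ᵐ[volume]
        fun k => starRingEnd ℂ (shellFn q R k) * f₁ k + starRingEnd ℂ (shellFn q R k) * f₂ k := by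
      filter_upwards [Lp.coeFn_add f₁ f₂] with k hk
      rw [hk, Pi.add_apply, mul_add]
    refine ⟨(integrable_congr e).mpr (i₁.add i₂), ?_⟩
    rw [integral_congr_ae e, integral_add i₁ i₂, Complex.add_im, h₁, h₂, add_zero]
  · rintro s f₁ - ⟨i₁, h₁⟩
    have e : (fun k => starRingEnd ℂ (shellFn q R k) * (s • f₁ : OneParticle) k) =ᵐ[volume]
        fun k => (s : ℂ) * (starRingEnd ℂ (shellFn q R k) * f₁ k) := by
      filter_upwards [Lp.coeFn_smul s f₁] with k hk
      rw [hk, Pi.smul_apply, Complex.real_smul]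
      ring
    refine ⟨(integrable_congr e).mpr (i₁.const_mul _), ?_⟩
    rw [integral_congr_ae e, integral_const_mul, Complex.im_ofReal_mul, h₁, mul_zero]

theorem chargeForm_eq_inner {O : Set Spacetime} {R : ℝ} (hR : 0 < R) (hO : O ⊆ diamond 0 R)
    {f : OneParticle} (hf : f ∈ localSpace O) :
    chargeForm (chargeFn σ ρ) f = -(⟪chargeVec σ ρ R hR, f⟫_ℂ).im := by
  obtain ⟨i₁, h₁⟩ := shellFn_orthogonal hR hO (charge ρ) hf
  have e : (fun k => starRingEnd ℂ (chargeFn σ ρ k) * f k) =ᵐ[volume]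
      fun k => starRingEnd ℂ (chargeVec σ ρ R hR k) * f k +
        starRingEnd ℂ (shellFn (charge ρ) R k) * f k := by
    filter_upwards [(memLp_chargeFn_sub_shellFn σ ρ hR).coeFn_toLp] with k hk
    rw [chargeVec, hk, ← add_mul, ← map_add, sub_add_cancel]
  rw [chargeForm, integral_congr_ae e, integral_add (integrable_conj_mul _ _) i₁, Complex.add_im,
    h₁, add_zero, inner_eq_integral]

/-- Without charge there are no shells, and `γ` itself is square integrable. -/
theorem chargeVec_eq_of_charge_eq_zero (hq : charge ρ = 0) {R R' : ℝ} (hR : 0 < R)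
    (hR' : 0 < R') : chargeVec σ ρ R hR = chargeVec σ ρ R' hR' := by
  refine MemLp.toLp_congr _ _ (Eventually.of_forall fun k => ?_)
  simp [shellFn, hq]

end ChargeVectors

/-! ### The double commutant theorem, weak continuity and limits of automorphisms -/

section Density

variable {H : Type*} [NormedAddCommGroup H] [InnerProductSpace ℂ H]

/-- The diagonal action of an operator on a finite direct sum of copies of the Hilbert space. -/
noncomputable def diagOp (ι : Type*) [Fintype ι] (T : H →L[ℂ] H) :
    PiLp 2 (fun _ : ι => H) →L[ℂ] PiLp 2 (fun _ : ι => H) :=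
  ((PiLp.continuousLinearEquiv 2 ℂ fun _ : ι => H).symm : (ι → H) →L[ℂ] _) ∘L
    ContinuousLinearMap.pi fun i => T ∘L PiLp.proj 2 (fun _ : ι => H) i

@[simp]
theorem diagOp_apply {ι : Type*} [Fintype ι] (T : H →L[ℂ] H) (x : PiLp 2 fun _ : ι => H) (i : ι) :
    diagOp ι T x i = T (x i) := rfl

theorem inner_diagOp_left [CompleteSpace H] {ι : Type*} [Fintype ι] (T : H →L[ℂ] H)
    (x y : PiLp 2 fun _ : ι => H) : ⟪diagOp ι T x, y⟫_ℂ = ⟪x, diagOp ι (star T) y⟫_ℂ := by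
  simp [PiLp.inner_apply, ContinuousLinearMap.star_eq_adjoint,
    ContinuousLinearMap.adjoint_inner_right]

/-- A projection commutes with an operator which maps its range and its kernel into themselves. -/
theorem starProjection_comm {K : Submodule ℂ H} [K.HasOrthogonalProjection] {T S : H →L[ℂ] H}
    (hTS : ∀ x y, ⟪S x, y⟫_ℂ = ⟪x, T y⟫_ℂ) (hT : ∀ x ∈ K, T x ∈ K) (hS : ∀ x ∈ K, S x ∈ K)
    (y : H) : K.starProjection (T y) = T (K.starProjection y) := by
  refine K.eq_starProjection_of_mem_orthogonal (hT _ (K.starProjection_apply_mem y)) ?_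
  rw [← map_sub, Submodule.mem_orthogonal]
  intro u hu
  rw [← hTS]
  exact (Submodule.mem_orthogonal _ _).mp (K.sub_starProjection_mem_orthogonal y) _ (hS u hu)

/-- The double commutant theorem: an operator which commutes with the commutant of a star algebra
`M` agrees with elements of `M`, up to `ε`, on finitely many vectors. -/
theorem exists_mem_approx [CompleteSpace H] (M : StarSubalgebra ℂ (H →L[ℂ] H)) {A : H →L[ℂ] H}
    (hA : ∀ T, (∀ B ∈ M, Commute B T) → Commute A T) (s : Finset H) {ε : ℝ} (hε : 0 < ε) :
    ∃ B ∈ M, ∀ x ∈ s, ‖B x - A x‖ < ε := by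
  classical
  set x : PiLp 2 fun _ : s => H := WithLp.toLp 2 fun i => (i : H)
  let K₀ : Submodule ℂ (PiLp 2 fun _ : s => H) :=
    { carrier := {y | ∃ B ∈ M, diagOp s B x = y}
      add_mem' := by
        rintro _ _ ⟨B, hB, rfl⟩ ⟨C, hC, rfl⟩
        exact ⟨B + C, add_mem hB hC, by ext i; simp⟩
      zero_mem' := ⟨0, zero_mem M, by ext i; simp⟩
      smul_mem' := by
        rintro c _ ⟨B, hB, rfl⟩
        exact ⟨c • B, M.smul_mem hB c, by ext i; simp⟩ }
  set K := K₀.topologicalClosure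
  have hKinv : ∀ B ∈ M, ∀ y ∈ K, diagOp s B y ∈ K := by
    intro B hB y hy
    refine map_mem_closure (diagOp s B).continuous hy ?_
    rintro _ ⟨C, hC, rfl⟩
    exact ⟨B * C, mul_mem hB hC, by ext i; simp⟩
  have hcomm : ∀ B ∈ M, ∀ y, K.starProjection (diagOp s B y) = diagOp s B (K.starProjection y) :=
    fun B hB => starProjection_comm (S := diagOp s (star B))
      (fun u v => by rw [inner_diagOp_left, star_star]) (hKinv B hB)
      (hKinv _ (star_mem hB))
  -- the matrix entries of the projection onto `K` lie in the commutant of `M`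
  let inc : s → H →L[ℂ] PiLp 2 fun _ : s => H := fun j =>
    ((PiLp.continuousLinearEquiv 2 ℂ fun _ : s => H).symm : (s → H) →L[ℂ] _) ∘L
      ContinuousLinearMap.single ℂ (fun _ : s => H) j
  have hinc : ∀ (T : H →L[ℂ] H) j v, diagOp s T (inc j v) = inc j (T v) := by
    intro T j v
    ext i
    by_cases hij : i = j
    · subst hij
      simp [inc]
    · simp [inc, hij]
  have hsum : ∀ y : PiLp 2 fun _ : s => H, y = ∑ j, inc j (y j) := by
    intro y
    ext i
    rw [WithLp.ofLp_sum, Finset.sum_apply, Finset.sum_eq_single i]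
    · simp [inc]
    · intro j _ hj
      simp [inc, hj.symm]
    · simp
  let P : s → s → H →L[ℂ] H := fun i j =>
    PiLp.proj 2 (fun _ : s => H) i ∘L K.starProjection ∘L inc j
  have hP : ∀ i j v, P i j v = K.starProjection (inc j v) i := fun _ _ _ => rfl
  have hPA : ∀ i j, Commute A (P i j) := by
    refine fun i j => hA _ fun B hB => ?_
    ext v
    rw [mul_apply_eq_comp, mul_apply_eq_comp, hP, hP, ← hinc, hcomm B hB, diagOp_apply]
  have hAP : ∀ y, K.starProjection (diagOp s A y) = diagOp s A (K.starProjection y) := by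
    intro y
    ext i
    nth_rewrite 1 [hsum y]
    nth_rewrite 2 [hsum y]
    simp only [map_sum, hinc, WithLp.ofLp_sum, Finset.sum_apply, diagOp_apply]
    refine Finset.sum_congr rfl fun j _ => ?_
    have := congrArg (fun T => T (y j)) (hPA i j).eq
    simp only [mul_apply_eq_comp, hP] at this
    exact this.symm
  have hxK : x ∈ K :=
    K₀.le_topologicalClosure ⟨1, one_mem M, by ext i; simp⟩
  have hAx : diagOp s A x ∈ K := by
    rw [← K.starProjection_eq_self_iff, hAP, K.starProjection_eq_self_iff.mpr hxK]
  obtain ⟨_, ⟨B, hB, rfl⟩, hd⟩ := Metric.mem_closure_iff.mp hAx ε hε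
  refine ⟨B, hB, fun v hv => lt_of_le_of_lt ?_ hd⟩
  have := PiLp.norm_apply_le (diagOp s A x - diagOp s B x) ⟨v, hv⟩
  rw [dist_eq_norm]
  refine le_trans (le_of_eq ?_) this
  rw [norm_sub_rev]
  rfl

/-- The bicommutant of a star algebra lies in its closure in the weak operator topology. -/
theorem mem_closure_weak [CompleteSpace H] (M : StarSubalgebra ℂ (H →L[ℂ] H)) {A : H →L[ℂ] H}
    (hA : ∀ T, (∀ B ∈ M, Commute B T) → Commute A T) :
    (ContinuousLinearMapWOT.ofCLM A : H →WOT[ℂ] H) ∈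
      closure ((fun B : H →L[ℂ] H => (ContinuousLinearMapWOT.ofCLM B : H →WOT[ℂ] H)) '' M) := by
  classical
  choose B hBM hB using fun p : Finset H × ℕ =>
    exists_mem_approx M hA p.1 (ε := 1 / ((p.2 : ℝ) + 1)) (by positivity)
  refine mem_closure_of_tendsto (f := fun p => ContinuousLinearMapWOT.ofCLM (B p)) (b := atTop) ?_
    (Eventually.of_forall fun p => ⟨B p, hBM p, rfl⟩)
  rw [ContinuousLinearMapWOT.tendsto_iff_forall_dual_apply_tendsto]
  intro x y
  refine (y.continuous.tendsto _).comp ?_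
  rw [tendsto_iff_norm_sub_tendsto_zero]
  have h0 : Tendsto (fun p : Finset H × ℕ => 1 / ((p.2 : ℝ) + 1)) atTop (𝓝 0) :=
    tendsto_one_div_add_atTop_nhds_zero_nat.comp (by
      rw [← prod_atTop_atTop_eq]
      exact tendsto_snd)
  refine squeeze_zero' (Eventually.of_forall fun _ => norm_nonneg _) ?_ h0
  filter_upwards [eventually_ge_atTop (({x} : Finset H), 0)] with p hp
  exact (hB p x (hp.1 (Finset.mem_singleton_self x))).le

end Density

section WeakContinuity

variable {H : Type*} [NormedAddCommGroup H] [InnerProductSpace ℂ H] [CompleteSpace H]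

/-- A weakly continuous map on `T` which agrees on the weakly dense subset `S` with the restriction
of a weakly continuous map `φ` agrees with it on `T`. -/
theorem eq_of_weaklyContinuous {𝓑 : StarSubalgebra ℂ (H →L[ℂ] H)} {α : 𝓑 → 𝓑}
    {φ : (H →L[ℂ] H) → (H →L[ℂ] H)} {S T : Set (H →L[ℂ] H)}
    (hφ : Continuous fun A : H →WOT[ℂ] H =>
      (ContinuousLinearMapWOT.ofCLM (φ (ContinuousLinearMapWOT.toCLM A)) : H →WOT[ℂ] H))
    (hα : @ContinuousOn _ _
      (TopologicalSpace.induced (fun A : 𝓑 =>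
        (ContinuousLinearMapWOT.ofCLM (A : H →L[ℂ] H) : H →WOT[ℂ] H)) inferInstance)
      (TopologicalSpace.induced (fun A : 𝓑 =>
        (ContinuousLinearMapWOT.ofCLM (A : H →L[ℂ] H) : H →WOT[ℂ] H)) inferInstance)
      α {A | (A : H →L[ℂ] H) ∈ T})
    (hST : S ⊆ T)
    (hTS : ∀ A ∈ T, (ContinuousLinearMapWOT.ofCLM A : H →WOT[ℂ] H) ∈
      closure ((fun B : H →L[ℂ] H => (ContinuousLinearMapWOT.ofCLM B : H →WOT[ℂ] H)) '' S))
    (h : ∀ A ∈ S, ∃ hA : A ∈ 𝓑, (α ⟨A, hA⟩ : H →L[ℂ] H) = φ A) (A : 𝓑)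
    (hA : (A : H →L[ℂ] H) ∈ T) : (α A : H →L[ℂ] H) = φ A := by
  let _ : TopologicalSpace 𝓑 := TopologicalSpace.induced (fun A : 𝓑 =>
    (ContinuousLinearMapWOT.ofCLM (A : H →L[ℂ] H) : H →WOT[ℂ] H)) inferInstance
  have hi : Continuous fun A : 𝓑 =>
      (ContinuousLinearMapWOT.ofCLM (A : H →L[ℂ] H) : H →WOT[ℂ] H) := continuous_induced_dom
  have key : Set.EqOn
      (fun B : 𝓑 => (ContinuousLinearMapWOT.ofCLM (α B : H →L[ℂ] H) : H →WOT[ℂ] H))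
      (fun B : 𝓑 => (ContinuousLinearMapWOT.ofCLM (φ B) : H →WOT[ℂ] H))
      {B : 𝓑 | (B : H →L[ℂ] H) ∈ T} := by
    refine Set.EqOn.of_subset_closure (s := {B : 𝓑 | (B : H →L[ℂ] H) ∈ S}) ?_
      (hi.comp_continuousOn hα) (hφ.comp hi).continuousOn (fun B hB => hST hB) fun B hB => ?_
    · intro B hB
      obtain ⟨_, e⟩ := h _ hB
      exact congrArg ContinuousLinearMapWOT.ofCLM e
    · refine closure_induced.mpr (closure_mono ?_ (hTS _ hB))
      rintro _ ⟨C, hC, rfl⟩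
      exact ⟨⟨C, (h C hC).1⟩, hC, rfl⟩
  exact congrArg ContinuousLinearMapWOT.toCLM (key hA)

theorem weaklyContinuousOn_of_eq {𝓑 : StarSubalgebra ℂ (H →L[ℂ] H)} {α : 𝓑 → 𝓑}
    {φ : (H →L[ℂ] H) → (H →L[ℂ] H)} {T : Set (H →L[ℂ] H)}
    (hφ : Continuous fun A : H →WOT[ℂ] H =>
      (ContinuousLinearMapWOT.ofCLM (φ (ContinuousLinearMapWOT.toCLM A)) : H →WOT[ℂ] H))
    (h : ∀ A : 𝓑, (A : H →L[ℂ] H) ∈ T → (α A : H →L[ℂ] H) = φ A) :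
    @ContinuousOn _ _
      (TopologicalSpace.induced (fun A : 𝓑 =>
        (ContinuousLinearMapWOT.ofCLM (A : H →L[ℂ] H) : H →WOT[ℂ] H)) inferInstance)
      (TopologicalSpace.induced (fun A : 𝓑 =>
        (ContinuousLinearMapWOT.ofCLM (A : H →L[ℂ] H) : H →WOT[ℂ] H)) inferInstance)
      α {A | (A : H →L[ℂ] H) ∈ T} := by
  let _ : TopologicalSpace 𝓑 := TopologicalSpace.induced (fun A : 𝓑 =>
    (ContinuousLinearMapWOT.ofCLM (A : H →L[ℂ] H) : H →WOT[ℂ] H)) inferInstance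
  have hi : Topology.IsInducing fun A : 𝓑 =>
      (ContinuousLinearMapWOT.ofCLM (A : H →L[ℂ] H) : H →WOT[ℂ] H) := ⟨rfl⟩
  refine hi.continuousOn_iff.mpr ((hφ.comp hi.continuous).continuousOn.congr fun A hA => ?_)
  exact congrArg ContinuousLinearMapWOT.ofCLM (h A hA)

end WeakContinuity

section LimitAutomorphism

variable {𝒜 : Type*} [CStarAlgebra 𝒜]

/-- Pointwise norm limits of automorphisms extend from generators to the closure of the algebra they
generate. -/
theorem exists_tendsto_of_adjoin {G : Set 𝒜} {ψ : ℕ → 𝒜 ≃⋆ₐ[ℂ] 𝒜}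
    (hψ : ∀ a ∈ G, ∃ b ∈ (StarAlgebra.adjoin ℂ G).topologicalClosure,
      Tendsto (fun n => ψ n a) atTop (𝓝 b))
    {a : 𝒜} (ha : a ∈ (StarAlgebra.adjoin ℂ G).topologicalClosure) :
    ∃ b ∈ (StarAlgebra.adjoin ℂ G).topologicalClosure, Tendsto (fun n => ψ n a) atTop (𝓝 b) := by
  set 𝓑 := (StarAlgebra.adjoin ℂ G).topologicalClosure
  have hclosed : IsClosed (𝓑 : Set 𝒜) := StarSubalgebra.isClosed_topologicalClosure _
  have hadj : ∀ a ∈ StarAlgebra.adjoin ℂ G, ∃ b ∈ 𝓑, Tendsto (fun n => ψ n a) atTop (𝓝 b) := by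
    intro a ha
    induction ha using StarAlgebra.adjoin_induction with
    | mem x hx => exact hψ x hx
    | algebraMap r =>
      refine ⟨algebraMap ℂ 𝒜 r, algebraMap_mem 𝓑 r, ?_⟩
      have e : ∀ n, ψ n (algebraMap ℂ 𝒜 r) = algebraMap ℂ 𝒜 r := fun n => by
        rw [Algebra.algebraMap_eq_smul_one, map_smul, map_one]
      simp only [e]
      exact tendsto_const_nhds
    | add x y _ _ hx hy =>
      obtain ⟨b, hb, h1⟩ := hx
      obtain ⟨c, hc, h2⟩ := hy
      exact ⟨b + c, add_mem hb hc, by simpa only [map_add] using h1.add h2⟩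
    | mul x y _ _ hx hy =>
      obtain ⟨b, hb, h1⟩ := hx
      obtain ⟨c, hc, h2⟩ := hy
      exact ⟨b * c, mul_mem hb hc, by simpa only [map_mul] using h1.mul h2⟩
    | star x _ hx =>
      obtain ⟨b, hb, h1⟩ := hx
      exact ⟨star b, star_mem hb, by simpa only [map_star] using h1.star⟩
  have hcauchy : CauchySeq fun n => ψ n a := by
    rw [Metric.cauchySeq_iff]
    intro ε hε
    obtain ⟨c, hc, hac⟩ := Metric.mem_closure_iff.mp ha (ε / 3) (by positivity)
    obtain ⟨b, -, hb⟩ := hadj c hc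
    obtain ⟨N, hN⟩ := Metric.cauchySeq_iff.mp hb.cauchySeq (ε / 3) (by positivity)
    refine ⟨N, fun m hm n hn => ?_⟩
    have h1 := hN m hm n hn
    have h2 : dist (ψ m a) (ψ m c) < ε / 3 := by rwa [(StarAlgEquiv.isometry (ψ m)).dist_eq]
    have h3 : dist (ψ n c) (ψ n a) < ε / 3 := by
      rwa [(StarAlgEquiv.isometry (ψ n)).dist_eq, dist_comm]
    have h4 := dist_triangle4 (ψ m a) (ψ m c) (ψ n c) (ψ n a)
    linarith
  obtain ⟨b, hb⟩ := cauchySeq_tendsto_of_complete hcauchy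
  refine ⟨b, ?_, hb⟩
  rw [← SetLike.mem_coe, ← hclosed.closure_eq]
  refine Metric.mem_closure_iff.mpr fun ε hε => ?_
  obtain ⟨c, hc, hac⟩ := Metric.mem_closure_iff.mp ha ε hε
  obtain ⟨d, hd, hcd⟩ := hadj c hc
  refine ⟨d, hd, lt_of_le_of_lt (le_of_tendsto (hb.dist hcd)
    (Eventually.of_forall fun n => ?_)) hac⟩
  rw [(StarAlgEquiv.isometry (ψ n)).dist_eq]

/-- If a sequence of automorphisms and the sequence of their inverses converge pointwise on the
generators, the limit is an automorphism of the algebra they generate. -/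
theorem exists_limit_automorphism {G : Set 𝒜} {𝓑 : StarSubalgebra ℂ 𝒜}
    (h𝓑 : 𝓑 = (StarAlgebra.adjoin ℂ G).topologicalClosure) {φ : ℕ → 𝒜 ≃⋆ₐ[ℂ] 𝒜}
    (h₁ : ∀ a ∈ G, ∃ b ∈ 𝓑, Tendsto (fun n => φ n a) atTop (𝓝 b))
    (h₂ : ∀ a ∈ G, ∃ b ∈ 𝓑, Tendsto (fun n => (φ n).symm a) atTop (𝓝 b)) :
    ∃ α : 𝓑 ≃⋆ₐ[ℂ] 𝓑, ∀ a : 𝓑, Tendsto (fun n => φ n (a : 𝒜)) atTop (𝓝 (α a : 𝒜)) := by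
  subst h𝓑
  choose f hfm hf using fun a : (StarAlgebra.adjoin ℂ G).topologicalClosure =>
    exists_tendsto_of_adjoin h₁ a.2
  choose g hgm hg using fun a : (StarAlgebra.adjoin ℂ G).topologicalClosure =>
    exists_tendsto_of_adjoin h₂ a.2
  have key : ∀ (ψ : ℕ → 𝒜 ≃⋆ₐ[ℂ] 𝒜) (a b c : 𝒜), Tendsto (fun n => ψ n a) atTop (𝓝 b) →
      Tendsto (fun n => (ψ n).symm b) atTop (𝓝 c) → c = a := by
    intro ψ a b c hb hc
    refine tendsto_nhds_unique hc ?_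
    rw [tendsto_iff_dist_tendsto_zero] at hb ⊢
    refine hb.congr fun n => ?_
    rw [← (StarAlgEquiv.isometry (ψ n)).dist_eq ((ψ n).symm b) a, StarAlgEquiv.apply_symm_apply,
      dist_comm]
  refine ⟨
    { toFun := fun a => ⟨f a, hfm a⟩
      invFun := fun a => ⟨g a, hgm a⟩
      left_inv := fun a => Subtype.ext (key φ _ _ _ (hf a) (hg ⟨f a, hfm a⟩))
      right_inv := fun a => Subtype.ext (key (fun n => (φ n).symm) _ _ _ (hg a)
        (by simpa only [StarAlgEquiv.symm_symm] using hf ⟨g a, hgm a⟩))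
      map_mul' := fun a b => Subtype.ext (tendsto_nhds_unique (hf (a * b))
        (by simpa only [MulMemClass.coe_mul, map_mul] using (hf a).mul (hf b)))
      map_add' := fun a b => Subtype.ext (tendsto_nhds_unique (hf (a + b))
        (by simpa only [AddMemClass.coe_add, map_add] using (hf a).add (hf b)))
      map_star' := fun a => Subtype.ext (tendsto_nhds_unique (hf (star a))
        (by simpa only [StarMemClass.coe_star, map_star] using (hf a).star))
      map_smul' := fun c a => Subtype.ext (tendsto_nhds_unique (hf (c • a))
        (by simpa only [SetLike.val_smul, map_smul] using (hf a).const_smul c)) }, hf⟩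

/-- An automorphism of a star subalgebra which agrees on `G` with an automorphism of the whole algebra
agrees with it on the star algebra generated by `G`. -/
theorem eq_of_mem_adjoin {𝓑 : StarSubalgebra ℂ 𝒜} {α : 𝓑 ≃⋆ₐ[ℂ] 𝓑} {φ : 𝒜 ≃⋆ₐ[ℂ] 𝒜} {G : Set 𝒜}
    (h : ∀ a ∈ G, ∃ ha : a ∈ 𝓑, (α ⟨a, ha⟩ : 𝒜) = φ a) {a : 𝒜} (ha : a ∈ StarAlgebra.adjoin ℂ G) :
    ∃ h : a ∈ 𝓑, (α ⟨a, h⟩ : 𝒜) = φ a := by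
  induction ha using StarAlgebra.adjoin_induction with
  | mem x hx => exact h x hx
  | algebraMap r =>
    refine ⟨algebraMap_mem 𝓑 r, ?_⟩
    have e : (⟨algebraMap ℂ 𝒜 r, algebraMap_mem 𝓑 r⟩ : 𝓑) = r • 1 := by
      ext1
      simp [Algebra.algebraMap_eq_smul_one]
    rw [e, map_smul, map_one, Algebra.algebraMap_eq_smul_one, map_smul, map_one]
    rfl
  | add x y _ _ hx hy =>
    obtain ⟨h1, e1⟩ := hx
    obtain ⟨h2, e2⟩ := hy
    refine ⟨add_mem h1 h2, ?_⟩
    rw [map_add, ← e1, ← e2, ← AddMemClass.coe_add, ← map_add]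
    rfl
  | mul x y _ _ hx hy =>
    obtain ⟨h1, e1⟩ := hx
    obtain ⟨h2, e2⟩ := hy
    refine ⟨mul_mem h1 h2, ?_⟩
    rw [map_mul, ← e1, ← e2, ← MulMemClass.coe_mul, ← map_mul]
    rfl
  | star x _ hx =>
    obtain ⟨h1, e1⟩ := hx
    refine ⟨star_mem h1, ?_⟩
    rw [map_star, ← e1, ← StarMemClass.coe_star, ← map_star]
    rfl

theorem continuous_of_starAlgEquiv {𝓑 : StarSubalgebra ℂ 𝒜} (h : IsClosed (𝓑 : Set 𝒜))
    (α : 𝓑 ≃⋆ₐ[ℂ] 𝓑) : Continuous α := by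
  let _ : CStarAlgebra 𝓑 := StarSubalgebra.cstarAlgebra _ (h_closed := h)
  exact (StarAlgEquiv.isometry α).continuous

/-- An automorphism of the algebra generated by `G` which agrees on `G` with an automorphism of the
whole algebra is its restriction. -/
theorem starAlgEquiv_eq_of_eqOn {G : Set 𝒜} {𝓑 : StarSubalgebra ℂ 𝒜}
    (h𝓑 : 𝓑 = (StarAlgebra.adjoin ℂ G).topologicalClosure) {α : 𝓑 ≃⋆ₐ[ℂ] 𝓑} {φ : 𝒜 ≃⋆ₐ[ℂ] 𝒜}
    (h : ∀ a : 𝓑, (a : 𝒜) ∈ G → (α a : 𝒜) = φ a) (a : 𝓑) : (α a : 𝒜) = φ a := by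
  subst h𝓑
  have hc : IsClosed ((StarAlgebra.adjoin ℂ G).topologicalClosure : Set 𝒜) :=
    StarSubalgebra.isClosed_topologicalClosure _
  have h1 : Continuous fun a : (StarAlgebra.adjoin ℂ G).topologicalClosure => (α a : 𝒜) :=
    continuous_subtype_val.comp (continuous_of_starAlgEquiv hc α)
  have h2 : Continuous fun a : (StarAlgebra.adjoin ℂ G).topologicalClosure => φ (a : 𝒜) :=
    (StarAlgEquiv.isometry φ).continuous.comp continuous_subtype_val
  refine closure_minimal (s := {b : (StarAlgebra.adjoin ℂ G).topologicalClosure |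
    (b : 𝒜) ∈ StarAlgebra.adjoin ℂ G}) (fun b hb => ?_) (isClosed_eq h1 h2)
    (closure_subtype.mpr (closure_mono ?_ a.2))
  · exact (eq_of_mem_adjoin (fun x hx => ⟨_, h ⟨x, StarSubalgebra.le_topologicalClosure _
      (StarAlgebra.subset_adjoin ℂ _ hx)⟩ hx⟩) hb).2
  · exact fun x hx => ⟨⟨x, StarSubalgebra.le_topologicalClosure _ hx⟩, hx, rfl⟩

/-- Automorphisms of the algebra generated by `G` are determined by their values on `G`. -/
theorem starAlgEquiv_ext_of_eqOn {G : Set 𝒜} {𝓑 : StarSubalgebra ℂ 𝒜}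
    (h𝓑 : 𝓑 = (StarAlgebra.adjoin ℂ G).topologicalClosure) {α β : 𝓑 ≃⋆ₐ[ℂ] 𝓑}
    (h : ∀ a : 𝓑, (a : 𝒜) ∈ G → α a = β a) : α = β := by
  subst h𝓑
  have hc : IsClosed ((StarAlgebra.adjoin ℂ G).topologicalClosure : Set 𝒜) :=
    StarSubalgebra.isClosed_topologicalClosure _
  refine StarAlgHomClass.ext_topologicalClosure (R := ℂ) (continuous_of_starAlgEquiv hc α)
    (continuous_of_starAlgEquiv hc β) fun x => ?_
  have e : (α : (StarAlgebra.adjoin ℂ G).topologicalClosure →⋆ₐ[ℂ]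
        (StarAlgebra.adjoin ℂ G).topologicalClosure).comp
      (StarSubalgebra.inclusion (StarSubalgebra.le_topologicalClosure (StarAlgebra.adjoin ℂ G))) =
      (β : (StarAlgebra.adjoin ℂ G).topologicalClosure →⋆ₐ[ℂ]
        (StarAlgebra.adjoin ℂ G).topologicalClosure).comp
      (StarSubalgebra.inclusion (StarSubalgebra.le_topologicalClosure (StarAlgebra.adjoin ℂ G))) :=
    StarAlgHom.ext_adjoin fun a ha => h _ ha
  exact DFunLike.congr_fun e x

end LimitAutomorphism

section Unitary

variable {𝒜 : Type*} [Monoid 𝒜] [StarMul 𝒜] {u v a : 𝒜}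

theorem commute_star_mul_of_conj_eq (hu : u ∈ unitary 𝒜) (hv : v ∈ unitary 𝒜)
    (h : v * a * star v = u * a * star u) : Commute a (star v * u) := by
  calc a * (star v * u) = star v * v * a * (star v * u) := by
        rw [Unitary.star_mul_self_of_mem hv, one_mul]
    _ = star v * (v * a * star v) * u := by simp only [mul_assoc]
    _ = star v * u * a * (star u * u) := by rw [h]; simp only [mul_assoc]
    _ = star v * u * a := by rw [Unitary.star_mul_self_of_mem hu, mul_one]

theorem conj_eq_of_commute_star_mul (hu : u ∈ unitary 𝒜) (hv : v ∈ unitary 𝒜)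
    (h : Commute a (star v * u)) : u * a * star u = v * a * star v := by
  calc u * a * star u = v * star v * u * a * star u := by
        rw [Unitary.mul_star_self_of_mem hv, one_mul]
    _ = v * (star v * u * a) * star u := by simp only [mul_assoc]
    _ = v * a * star v * (u * star u) := by rw [← h.eq]; simp only [mul_assoc]
    _ = v * a * star v := by rw [Unitary.mul_star_self_of_mem hu, mul_one]

end Unitary

/-! ### Weyl automorphisms and the charge automorphism -/

section Weyl

variable {K : Type*} [NormedAddCommGroup K] [InnerProductSpace ℂ K]

/-- The Weyl relations in the form of an exchange relation. -/
theorem weyl_mul_weyl (u f : K) :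
    weyl u * weyl f =
      Complex.exp (Complex.I * ((-(⟪u, f⟫_ℂ).im : ℝ) : ℂ)) • (weyl f * weyl u) := by
  rw [weyl_mul, weyl_mul, smul_smul, ← Complex.exp_add, add_comm u f, ← inner_conj_symm f u,
    Complex.conj_im]
  congr 2
  push_cast
  ring

theorem weyl_mul_star_weyl (u : K) : weyl u * star (weyl u) = 1 :=
  (Unitary.mem_iff.mp (weyl_mem_unitary u)).2

theorem star_weyl_mul_weyl (u : K) : star (weyl u) * weyl u = 1 :=
  (Unitary.mem_iff.mp (weyl_mem_unitary u)).1

theorem weyl_conj (u f : K) :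
    weyl u * weyl f * star (weyl u) =
      Complex.exp (Complex.I * ((-(⟪u, f⟫_ℂ).im : ℝ) : ℂ)) • weyl f := by
  rw [weyl_mul_weyl, smul_mul_assoc, mul_assoc, weyl_mul_star_weyl, mul_one]

/-- The automorphism of the bounded operators implemented by a Weyl operator. -/
noncomputable def weylAut (u : K) :
    (FockSpace K →L[ℂ] FockSpace K) ≃⋆ₐ[ℂ] (FockSpace K →L[ℂ] FockSpace K) :=
  Unitary.conjStarAlgAut ℂ _ ⟨weyl u, weyl_mem_unitary u⟩

theorem weylAut_apply (u : K) (A : FockSpace K →L[ℂ] FockSpace K) :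
    weylAut u A = weyl u * A * star (weyl u) := rfl

theorem weylAut_weyl (u f : K) :
    weylAut u (weyl f) = Complex.exp (Complex.I * ((-(⟪u, f⟫_ℂ).im : ℝ) : ℂ)) • weyl f :=
  weyl_conj u f

theorem weylAut_symm (u : K) : (weylAut u).symm = weylAut (-u) := by
  ext1 A
  rw [weylAut_apply, ← star_weyl, star_star]
  rfl

/-- The von Neumann algebra generated by the Weyl operators `W(f)`, `f ∈ L`, as the commutant of
their commutant. -/
def weylBicommutant (L : Submodule ℝ K) : Set (FockSpace K →L[ℂ] FockSpace K) :=
  {A | ∀ T, (∀ f ∈ L, Commute (weyl f) T) → Commute A T}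

theorem commute_star_of_forall_weyl {L : Submodule ℝ K} {T : FockSpace K →L[ℂ] FockSpace K}
    (hT : ∀ f ∈ L, Commute (weyl f) T) : ∀ f ∈ L, Commute (weyl f) (star T) := by
  intro f hf
  have h := (hT (-f) (neg_mem hf)).star_star
  rwa [star_weyl, neg_neg] at h

/-- Weyl automorphisms leave the algebra generated by Weyl operators invariant. -/
theorem weylAut_mem_weylBicommutant {L : Submodule ℝ K} (u : K)
    {A : FockSpace K →L[ℂ] FockSpace K} (hA : A ∈ weylBicommutant L) :
    weylAut u A ∈ weylBicommutant L := by
  intro T hT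
  have h := hA ((weylAut u).symm T) fun f hf => by
    have h1 := (hT f hf).map (weylAut u).symm
    rw [weylAut_symm, weylAut_weyl] at h1
    have h2 := h1.smul_left (Complex.exp (Complex.I * ((-(⟪-u, f⟫_ℂ).im : ℝ) : ℂ)))⁻¹
    rwa [smul_smul, inv_mul_cancel₀ (Complex.exp_ne_zero _), one_smul, ← weylAut_symm] at h2
  simpa using h.map (weylAut u)

/-- On the algebra generated by the `W(f)`, `f ∈ L`, the automorphism implemented by `W(u)` depends
only on the symplectic products of `u` with `L`. -/
theorem weylAut_congr {L : Submodule ℝ K} {u v : K}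
    (huv : ∀ f ∈ L, (⟪u, f⟫_ℂ).im = (⟪v, f⟫_ℂ).im) {A : FockSpace K →L[ℂ] FockSpace K}
    (hA : A ∈ weylBicommutant L) : weylAut u A = weylAut v A := by
  refine conj_eq_of_commute_star_mul (weyl_mem_unitary u) (weyl_mem_unitary v)
    (hA _ fun f hf => commute_star_mul_of_conj_eq (weyl_mem_unitary u) (weyl_mem_unitary v) ?_)
  exact (weyl_conj v f).trans ((weyl_conj u f).trans (by rw [huv f hf])).symm

theorem mem_closure_of_mem_weylBicommutant {L : Submodule ℝ K}
    {A : FockSpace K →L[ℂ] FockSpace K} (hA : A ∈ weylBicommutant L) :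
    (ContinuousLinearMapWOT.ofCLM A : FockSpace K →WOT[ℂ] FockSpace K) ∈
      closure ((fun B : FockSpace K →L[ℂ] FockSpace K =>
        (ContinuousLinearMapWOT.ofCLM B : FockSpace K →WOT[ℂ] FockSpace K)) ''
        StarAlgebra.adjoin ℂ (weyl '' (L : Set K))) :=
  mem_closure_weak _ fun T hT => hA T fun f hf =>
    hT _ (StarAlgebra.subset_adjoin ℂ _ ⟨f, hf, rfl⟩)

theorem continuous_weylAut_weak (u : K) :
    Continuous fun A : FockSpace K →WOT[ℂ] FockSpace K =>
      (ContinuousLinearMapWOT.ofCLM (weylAut u (ContinuousLinearMapWOT.toCLM A)) :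
        FockSpace K →WOT[ℂ] FockSpace K) :=
  ContinuousLinearMapWOT.continuous_of_dual_apply_continuous fun x y =>
    ContinuousLinearMapWOT.continuous_dual_apply (star (weyl u) x) (y ∘L weyl u)

end Weyl

theorem mem_centralizer_weylAlgebra {L : Submodule ℝ OneParticle} {T : Op}
    (hT : ∀ f ∈ L, Commute (weyl f) T) :
    T ∈ StarSubalgebra.centralizer ℂ (weylAlgebra L : Set Op) := by
  have hle : weylAlgebra L ≤ StarSubalgebra.centralizer ℂ {T} := by
    refine StarSubalgebra.topologicalClosure_minimal ?_ ?_
    · refine StarAlgebra.adjoin_le ?_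
      rintro _ ⟨f, hf, rfl⟩
      rw [SetLike.mem_coe, StarSubalgebra.mem_centralizer_iff]
      rintro _ rfl
      exact ⟨(hT f hf).eq.symm, (commute_star_of_forall_weyl hT f hf).eq.symm⟩
    · exact Set.isClosed_centralizer _
  rw [StarSubalgebra.mem_centralizer_iff]
  intro B hB
  have h1 := (StarSubalgebra.mem_centralizer_iff ℂ).mp (hle hB) T rfl
  have h2 := (StarSubalgebra.mem_centralizer_iff ℂ).mp (hle (star_mem hB)) T rfl
  exact ⟨h1.1.symm, h2.1.symm⟩

theorem mem_localAlgebra_iff {O : Set Spacetime} {A : Op} :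
    A ∈ localAlgebra O ↔ A ∈ weylBicommutant (localSpace O) := by
  rw [localAlgebra, StarSubalgebra.mem_centralizer_iff]
  constructor
  · intro h T hT
    exact (h T (mem_centralizer_weylAlgebra hT)).1.symm
  · intro h T hT
    rw [SetLike.mem_coe, StarSubalgebra.mem_centralizer_iff] at hT
    have hT' : ∀ f ∈ localSpace O, Commute (weyl f) T := fun f hf =>
      (hT _ (StarSubalgebra.le_topologicalClosure _ (StarAlgebra.subset_adjoin ℂ _
        ⟨f, hf, rfl⟩))).1
    exact ⟨(h T hT').eq.symm, (h _ (commute_star_of_forall_weyl hT')).eq.symm⟩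

theorem localAlgebra_le_quasilocal {O : Set Spacetime} (hO : IsDoubleCone O) :
    localAlgebra O ≤ quasilocal := fun _ hA =>
  StarSubalgebra.le_topologicalClosure _
    (StarAlgebra.subset_adjoin ℂ _ ⟨O, hO, Set.subset_univ O, hA⟩)

theorem weylAut_mem_quasilocal (u : OneParticle) {O : Set Spacetime} (hO : IsDoubleCone O)
    {A : Op} (hA : A ∈ localAlgebra O) : weylAut u A ∈ quasilocal :=
  localAlgebra_le_quasilocal hO (mem_localAlgebra_iff.mpr
    (weylAut_mem_weylBicommutant u (mem_localAlgebra_iff.mp hA)))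

theorem adjoin_weyl_le_localAlgebra (O : Set Spacetime) :
    StarAlgebra.adjoin ℂ (weyl '' (localSpace O : Set OneParticle)) ≤ localAlgebra O := by
  refine StarAlgebra.adjoin_le ?_
  rintro _ ⟨f, hf, rfl⟩
  exact weyl_mem_localAlgebra hf

/-- A charge automorphism is implemented on a local algebra by any Weyl operator which acts in the
same way on the local Weyl operators. -/
theorem IsChargeAut.eq_weylAut {γ : E3 → ℂ} {α : quasilocal ≃⋆ₐ[ℂ] quasilocal}
    (hα : IsChargeAut γ α) {O : Set Spacetime} (hO : IsDoubleCone O) {v : OneParticle}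
    (hv : ∀ f ∈ localSpace O, chargeForm γ f = -(⟪v, f⟫_ℂ).im) (A : quasilocal)
    (hA : (A : Op) ∈ localAlgebra O) : (α A : Op) = weylAut v A := by
  have hadj : ∀ B ∈ StarAlgebra.adjoin ℂ (weyl '' (localSpace O : Set OneParticle)),
      ∃ hB : B ∈ quasilocal, (α ⟨B, hB⟩ : Op) = weylAut v B :=
    fun B hB => eq_of_mem_adjoin (φ := weylAut v) (fun x hx => by
      obtain ⟨f, hf, rfl⟩ := hx
      refine ⟨weyl_mem_quasilocal hO hf, ?_⟩
      rw [hα.map_weyl O hO f hf, weylAut_weyl, hv f hf]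
      rfl) hB
  exact eq_of_weaklyContinuous (continuous_weylAut_weak v) (hα.weaklyContinuous O hO)
    (adjoin_weyl_le_localAlgebra O)
    (fun B hB => mem_closure_of_mem_weylBicommutant (mem_localAlgebra_iff.mp hB)) hadj A hA

section ChargeAut

variable (σ ρ : RealTest ⊤)

theorem im_inner_chargeVec {O : Set Spacetime} {R R' : ℝ} (hR : 0 < R) (hR' : 0 < R')
    (hO : O ⊆ diamond 0 R) (hO' : O ⊆ diamond 0 R') {f : OneParticle} (hf : f ∈ localSpace O) :
    (⟪chargeVec σ ρ R hR, f⟫_ℂ).im = (⟪chargeVec σ ρ R' hR', f⟫_ℂ).im := by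
  have h1 := chargeForm_eq_inner σ ρ hR hO hf
  have h2 := chargeForm_eq_inner σ ρ hR' hO' hf
  linarith

/-- The implementing vectors of an exhausting sequence of double cones. -/
noncomputable def chargeSeq (n : ℕ) : OneParticle := chargeVec σ ρ (n + 1) (by positivity)

theorem chargeSeq_stable {O : Set Spacetime} (hO : IsDoubleCone O) : ∃ N, ∀ n ≥ N,
    (∀ f ∈ localSpace O, chargeForm (chargeFn σ ρ) f = -(⟪chargeSeq σ ρ n, f⟫_ℂ).im) ∧
    ∀ A ∈ localAlgebra O, weylAut (chargeSeq σ ρ n) A = weylAut (chargeSeq σ ρ N) A ∧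
      weylAut (-chargeSeq σ ρ n) A = weylAut (-chargeSeq σ ρ N) A := by
  obtain ⟨N, hN⟩ := hO.exists_subset_diamond
  refine ⟨N, fun n hn => ⟨fun f hf => chargeForm_eq_inner σ ρ _ (hN n hn) hf, fun A hA => ?_⟩⟩
  have h : ∀ f ∈ localSpace O,
      (⟪chargeSeq σ ρ n, f⟫_ℂ).im = (⟪chargeSeq σ ρ N, f⟫_ℂ).im := fun f hf =>
    im_inner_chargeVec σ ρ _ _ (hN n hn) (hN N le_rfl) hf
  refine ⟨weylAut_congr h (mem_localAlgebra_iff.mp hA),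
    weylAut_congr (fun f hf => ?_) (mem_localAlgebra_iff.mp hA)⟩
  rw [inner_neg_left, inner_neg_left, Complex.neg_im, Complex.neg_im, h f hf]

set_option maxHeartbeats 2000000 in
theorem exists_isChargeAut :
    ∃ α : quasilocal ≃⋆ₐ[ℂ] quasilocal, IsChargeAut (chargeFn σ ρ) α := by
  have h₁ : ∀ A ∈ {A : Op | ∃ O, IsDoubleCone O ∧ O ⊆ Set.univ ∧ A ∈ localAlgebra O},
      ∃ B ∈ quasilocal, Tendsto (fun n => weylAut (chargeSeq σ ρ n) A) atTop (𝓝 B) := by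
    rintro A ⟨O, hO, -, hA⟩
    obtain ⟨N, hN⟩ := chargeSeq_stable σ ρ hO
    exact ⟨weylAut (chargeSeq σ ρ N) A, weylAut_mem_quasilocal _ hO hA,
      tendsto_atTop_of_eventually_const fun n hn => ((hN n hn).2 A hA).1⟩
  have h₂ : ∀ A ∈ {A : Op | ∃ O, IsDoubleCone O ∧ O ⊆ Set.univ ∧ A ∈ localAlgebra O},
      ∃ B ∈ quasilocal, Tendsto (fun n => (weylAut (chargeSeq σ ρ n)).symm A) atTop (𝓝 B) := by
    rintro A ⟨O, hO, -, hA⟩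
    obtain ⟨N, hN⟩ := chargeSeq_stable σ ρ hO
    simp only [weylAut_symm]
    exact ⟨weylAut (-chargeSeq σ ρ N) A, weylAut_mem_quasilocal _ hO hA,
      tendsto_atTop_of_eventually_const fun n hn => ((hN n hn).2 A hA).2⟩
  obtain ⟨α, hα⟩ := exists_limit_automorphism (𝓑 := quasilocal) rfl h₁ h₂
  have hloc : ∀ O, IsDoubleCone O → ∃ v : OneParticle,
      (∀ f ∈ localSpace O, chargeForm (chargeFn σ ρ) f = -(⟪v, f⟫_ℂ).im) ∧
      ∀ A : quasilocal, (A : Op) ∈ localAlgebra O → (α A : Op) = weylAut v A := by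
    intro O hO
    obtain ⟨N, hN⟩ := chargeSeq_stable σ ρ hO
    refine ⟨chargeSeq σ ρ N, (hN N le_rfl).1, fun A hA => ?_⟩
    exact tendsto_nhds_unique (hα A)
      (tendsto_atTop_of_eventually_const fun n hn => ((hN n hn).2 A hA).1)
  refine ⟨α, ⟨fun O hO f hf => ?_, fun O hO => ?_⟩⟩
  · obtain ⟨v, hv, hA⟩ := hloc O hO
    ext1
    rw [hA _ (weyl_mem_localAlgebra hf), weylAut_weyl, hv f hf]
    rfl
  · obtain ⟨v, -, hA⟩ := hloc O hO
    exact weaklyContinuousOn_of_eq (continuous_weylAut_weak v) hA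

variable {σ ρ}

theorem IsChargeAut.unique {α β : quasilocal ≃⋆ₐ[ℂ] quasilocal}
    (hα : IsChargeAut (chargeFn σ ρ) α) (hβ : IsChargeAut (chargeFn σ ρ) β) : α = β := by
  refine starAlgEquiv_ext_of_eqOn (𝓑 := quasilocal) rfl fun A hA => ?_
  obtain ⟨O, hO, -, hA⟩ := hA
  obtain ⟨N, hN⟩ := chargeSeq_stable σ ρ hO
  ext1
  rw [hα.eq_weylAut hO (hN N le_rfl).1 _ hA, hβ.eq_weylAut hO (hN N le_rfl).1 _ hA]

end ChargeAut

/-! ### Weak limits of Weyl operators -/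

section WeakLimit

/-- Weak convergence of a bounded sequence of vectors may be tested on a total set. -/
theorem tendsto_inner_of_total {ι E : Type*} [NormedAddCommGroup E] [InnerProductSpace ℂ E]
    {l : Filter ι} {u : ι → E} {v : E} {C : ℝ} (hC : ∀ i, ‖u i‖ ≤ C) {S : Set E}
    (hS : (Submodule.span ℂ S).topologicalClosure = ⊤)
    (h : ∀ x ∈ S, Tendsto (fun i => ⟪x, u i⟫_ℂ) l (𝓝 ⟪x, v⟫_ℂ)) (x : E) :
    Tendsto (fun i => ⟪x, u i⟫_ℂ) l (𝓝 ⟪x, v⟫_ℂ) := by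
  have hspan : ∀ x ∈ Submodule.span ℂ S, Tendsto (fun i => ⟪x, u i⟫_ℂ) l (𝓝 ⟪x, v⟫_ℂ) := by
    intro x hx
    induction hx using Submodule.span_induction with
    | mem x hx => exact h x hx
    | zero => simpa only [inner_zero_left] using tendsto_const_nhds
    | add x y _ _ hx hy => simpa only [inner_add_left] using hx.add hy
    | smul c x _ hx => simpa only [inner_smul_left] using hx.const_mul _
  have heq : Equicontinuous fun (i : ι) (x : E) => ⟪x, u i⟫_ℂ := by
    refine Metric.equicontinuous_of_continuity_modulus (fun d => d * C) ?_ _ fun x y i => ?_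
    · exact Continuous.tendsto' (by fun_prop) _ _ (zero_mul C)
    · rw [dist_eq_norm, dist_eq_norm, ← inner_sub_left]
      exact (norm_inner_le_norm _ _).trans (by gcongr; exact hC i)
  have hcl := heq.isClosed_setOfPred_tendsto (l := l) (f := fun x : E => ⟪x, v⟫_ℂ) (by fun_prop)
  have hx : x ∈ (Submodule.span ℂ S).topologicalClosure := hS ▸ Submodule.mem_top
  exact closure_minimal hspan hcl hx

variable {K : Type*} [NormedAddCommGroup K] [InnerProductSpace ℂ K]

theorem norm_weyl_apply (u : K) (φ : FockSpace K) : ‖weyl u φ‖ = ‖φ‖ := by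
  exact ContinuousLinearMap.norm_map_of_mem_unitary (weyl_mem_unitary u) φ

/-- If the vectors `u i` have norm `N` and tend weakly to zero, the Weyl operators `W(u i)` tend
weakly to a multiple of the identity. -/
theorem tendsto_inner_weyl {ι : Type*} {l : Filter ι} {u : ι → K} {N : ℝ} (hN : ∀ i, ‖u i‖ = N)
    (h : ∀ g, Tendsto (fun i => ⟪g, u i⟫_ℂ) l (𝓝 0)) (ψ φ : FockSpace K) :
    Tendsto (fun i => ⟪ψ, weyl (u i) φ⟫_ℂ) l (𝓝 ⟪ψ, Complex.exp (-(N : ℂ) ^ 2 / 4) • φ⟫_ℂ) := by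
  have h' : ∀ g, Tendsto (fun i => ⟪u i, g⟫_ℂ) l (𝓝 0) := fun g => by
    simpa only [Function.comp_def, inner_conj_symm, map_zero] using
      (Complex.continuous_conj.tendsto 0).comp (h g)
  have hexp : ∀ x y : K, Tendsto (fun i => ⟪expVec x, weyl (u i) (expVec y)⟫_ℂ) l
      (𝓝 ⟪expVec x, Complex.exp (-(N : ℂ) ^ 2 / 4) • expVec y⟫_ℂ) := by
    intro x y
    simp only [weyl_expVec, inner_smul_right, inner_expVec, inner_add_right, hN]
    refine Tendsto.mul ((Complex.continuous_exp.tendsto _).comp ?_)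
      ((Complex.continuous_exp.tendsto _).comp ?_)
    · simpa using tendsto_const_nhds.sub ((h' y).div_const ((√2 : ℝ) : ℂ))
    · simpa using tendsto_const_nhds.add ((h x).const_mul (((√2 : ℝ) : ℂ)⁻¹))
  have h1 : ∀ (y : K) (ψ : FockSpace K), Tendsto (fun i => ⟪ψ, weyl (u i) (expVec y)⟫_ℂ) l
      (𝓝 ⟪ψ, Complex.exp (-(N : ℂ) ^ 2 / 4) • expVec y⟫_ℂ) := fun y =>
    tendsto_inner_of_total (C := ‖expVec y‖) (fun i => (norm_weyl_apply _ _).le) expVec_dense (by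
      rintro _ ⟨x, rfl⟩
      exact hexp x y)
  -- the roles of the two vectors are exchanged by passing to adjoints
  have h2 := tendsto_inner_of_total (l := l) (x := φ) (C := ‖ψ‖) (u := fun i => weyl (-u i) ψ)
    (v := Complex.exp (-(N : ℂ) ^ 2 / 4) • ψ)
    (fun i => (norm_weyl_apply _ _).le) expVec_dense ?_
  · have h3 := (Complex.continuous_conj.tendsto _).comp h2
    have e : ∀ i, starRingEnd ℂ ⟪φ, weyl (-u i) ψ⟫_ℂ = ⟪ψ, weyl (u i) φ⟫_ℂ := fun i => by
      rw [inner_conj_symm, ← star_weyl, ContinuousLinearMap.star_eq_adjoint,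
        ContinuousLinearMap.adjoint_inner_left]
    simp only [Function.comp_def, e] at h3
    convert h3 using 2
    rw [inner_conj_symm, inner_smul_left, inner_smul_right, ← Complex.exp_conj]
    simp [map_ofNat]
  · rintro _ ⟨y, rfl⟩
    have h3 := (Complex.continuous_conj.tendsto _).comp (h1 y ψ)
    have e : ∀ i, starRingEnd ℂ ⟪ψ, weyl (u i) (expVec y)⟫_ℂ = ⟪expVec y, weyl (-u i) ψ⟫_ℂ :=
      fun i => by
        rw [inner_conj_symm, ← star_weyl, ContinuousLinearMap.star_eq_adjoint,
          ContinuousLinearMap.adjoint_inner_right]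
    simp only [Function.comp_def, e] at h3
    convert h3 using 2
    rw [inner_conj_symm, inner_smul_left, inner_smul_right, ← Complex.exp_conj]
    simp [map_ofNat]

end WeakLimit

/-! ### Positivity of the Coulomb potential -/

section Coulomb

variable {h : E3 → ℝ}

theorem integral_gaussian_mul_hat (hi : Integrable h) {s : ℝ} (hs : 0 < s) :
    ∫ k, (Real.exp (-s * ‖k‖ ^ 2) : ℂ) * hat h k =
      ((∫ x, (Real.pi / s) ^ (3 / 2 : ℝ) * Real.exp (-‖x‖ ^ 2 / (4 * s)) * h x : ℝ) : ℂ) := by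
  have hg : Integrable fun k : E3 => (Real.exp (-s * ‖k‖ ^ 2) : ℂ) := by
    have := GaussianFourier.integrable_cexp_neg_mul_sq_norm_add (V := E3) (b := (s : ℂ))
      (by simpa using hs) 0 0
    refine this.congr (Eventually.of_forall fun k => ?_)
    simp
  have hint : Integrable (Function.uncurry fun k x : E3 => (Real.exp (-s * ‖k‖ ^ 2) : ℂ) *
      (Complex.exp (-(Complex.I * ((⟪k, x⟫_ℝ : ℝ) : ℂ))) * (h x : ℂ))) (volume.prod volume) := by
    have h1 := hg.mul_prod (hi.ofReal (𝕜 := ℂ))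
    refine h1.mono ?_ (Eventually.of_forall fun p => ?_)
    · have e : (Function.uncurry fun k x : E3 => (Real.exp (-s * ‖k‖ ^ 2) : ℂ) *
          (Complex.exp (-(Complex.I * ((⟪k, x⟫_ℝ : ℝ) : ℂ))) * (h x : ℂ))) = fun p : E3 × E3 =>
          Complex.exp (-(Complex.I * ((⟪p.1, p.2⟫_ℝ : ℝ) : ℂ))) *
            ((Real.exp (-s * ‖p.1‖ ^ 2) : ℂ) * (h p.2 : ℂ)) := by
        ext p
        simp only [Function.uncurry]
        ring
      rw [e]
      exact (Continuous.aestronglyMeasurable (by fun_prop)).mul h1.1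
    · simp only [Function.uncurry, norm_mul, norm_exp_neg_I_mul, one_mul]
      exact le_rfl
  simp only [hat, ← integral_const_mul]
  rw [integral_integral_swap hint, ← integral_complex_ofReal]
  refine integral_congr_ae (Eventually.of_forall fun x => ?_)
  have key := GaussianFourier.integral_cexp_neg_mul_sq_norm_add (V := E3) (b := (s : ℂ))
      (by simpa using hs) (-Complex.I) x
  simp only
  have e : ∀ k : E3, (Real.exp (-s * ‖k‖ ^ 2) : ℂ) *
      (Complex.exp (-(Complex.I * ((⟪k, x⟫_ℝ : ℝ) : ℂ))) * (h x : ℂ)) =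
      Complex.exp (-s * ‖k‖ ^ 2 + -Complex.I * ⟪x, k⟫_ℝ) * (h x : ℂ) := fun k => by
    rw [Complex.ofReal_exp, ← mul_assoc, ← Complex.exp_add, real_inner_comm]
    congr 2
    push_cast
    ring
  simp only [e]
  rw [integral_mul_const, key]
  have e3 : (Module.finrank ℝ E3 : ℂ) / 2 = ((3 / 2 : ℝ) : ℂ) := by simp
  rw [e3, ← Complex.ofReal_div, ← Complex.ofReal_cpow (by positivity)]
  push_cast
  congr 3
  rw [neg_sq, Complex.I_sq]
  ring

theorem integral_gaussian_mul_pos (hc : HasCompactSupport h) (hs : Continuous h)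
    (h0 : ∀ x, 0 ≤ h x) {x₀ : E3} (hx : h x₀ ≠ 0) {s : ℝ} (hs0 : 0 < s) :
    0 < ∫ x, (Real.pi / s) ^ (3 / 2 : ℝ) * Real.exp (-‖x‖ ^ 2 / (4 * s)) * h x := by
  refine Continuous.integral_pos_of_hasCompactSupport_nonneg_nonzero (x := x₀) (by fun_prop)
    hc.mul_left (fun x => mul_nonneg (by positivity) (h0 x)) ?_
  have : (Real.pi / s) ^ (3 / 2 : ℝ) ≠ 0 := (by positivity : (0 : ℝ) < _).ne'
  simp [hx, this, Real.exp_ne_zero]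

theorem integral_Ioi_exp_neg_mul {c : ℝ} (hc : 0 < c) :
    ∫ s in Set.Ioi (0 : ℝ), Real.exp (-s * c) = c⁻¹ := by
  have := integral_exp_mul_Ioi (a := -c) (by linarith) 0
  simp only [mul_zero, Real.exp_zero] at this
  rw [← one_div, ← neg_div_neg_eq, ← this]
  refine integral_congr_ae (Eventually.of_forall fun s => ?_)
  simp only
  ring_nf

/-- The integral is, up to a positive factor, the Coulomb potential `∫ h(x) / |x| d³x` at the origin,
so it is positive for nonnegative `h`. -/
theorem re_integral_inv_sq_mul_hat_pos (hc : HasCompactSupport h) (hs : ContDiff ℝ ∞ h)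
    (h0 : ∀ x, 0 ≤ h x) {x₀ : E3} (hx : h x₀ ≠ 0) :
    0 < (∫ k, ((‖k‖ ^ (-2 : ℝ) : ℝ) : ℂ) * hat h k).re := by
  have hi : Integrable h := hs.continuous.integrable_of_hasCompactSupport hc
  have hI : Integrable fun k => ((‖k‖ ^ (-2 : ℝ) : ℝ) : ℂ) * hat h k :=
    integrable_rpow_mul_hat hc hs (a := 2) (by norm_num) (by norm_num) (C := 1) (by fun_prop)
      fun k => by rw [Complex.norm_real, one_mul, Real.norm_of_nonneg (by positivity)]
  have hm : Measurable (hat h) := (continuous_hat hi).measurable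
  -- `‖k‖⁻² = ∫ exp (-s ‖k‖²) ds` reduces the claim to Gaussians
  have hpow : ∀ k : E3, k ≠ 0 →
      ∫ s in Set.Ioi (0 : ℝ), Real.exp (-s * ‖k‖ ^ 2) = ‖k‖ ^ (-2 : ℝ) := fun k hk => by
    rw [integral_Ioi_exp_neg_mul (by positivity), Real.rpow_neg (norm_nonneg _)]
    norm_num
  have hint : Integrable (Function.uncurry fun (k : E3) (s : ℝ) =>
      (Real.exp (-s * ‖k‖ ^ 2) : ℂ) * hat h k)
      (volume.prod (volume.restrict (Set.Ioi (0 : ℝ)))) := by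
    refine (integrable_prod_iff (Measurable.aestronglyMeasurable ?_)).mpr ⟨?_, ?_⟩
    · unfold Function.uncurry
      fun_prop
    · filter_upwards [ae_ne_zero] with k hk
      simp only [Function.uncurry]
      refine Integrable.mul_const (Integrable.ofReal (𝕜 := ℂ) (f := fun s : ℝ =>
        Real.exp (-s * ‖k‖ ^ 2)) ?_) _
      have hp : 0 < ‖k‖ ^ 2 := by positivity
      have := integrableOn_exp_mul_Ioi (a := -‖k‖ ^ 2) (by linarith) 0
      refine this.congr (Eventually.of_forall fun s => ?_)
      simp only
      rw [neg_mul, neg_mul, mul_comm]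
    · refine hI.norm.congr ?_
      filter_upwards [ae_ne_zero] with k hk
      simp only [Function.uncurry, norm_mul, Complex.norm_real]
      rw [integral_mul_const]
      congr 1
      rw [← hpow k hk, Real.norm_of_nonneg (by positivity)]
      simp only [Real.norm_eq_abs, Real.abs_exp]
  have e : ∫ k, ((‖k‖ ^ (-2 : ℝ) : ℝ) : ℂ) * hat h k =
      ∫ s in Set.Ioi (0 : ℝ), ∫ k, (Real.exp (-s * ‖k‖ ^ 2) : ℂ) * hat h k := by
    rw [← integral_integral_swap hint]
    refine integral_congr_ae ?_
    filter_upwards [ae_ne_zero] with k hk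
    rw [integral_mul_const, ← hpow k hk, integral_complex_ofReal]
  have hint2 := hint.integral_prod_right
  simp only [Function.uncurry] at hint2
  rw [e, ← RCLike.re_eq_complex_re, ← integral_re hint2]
  have hpos : ∀ s ∈ Set.Ioi (0 : ℝ),
      0 < RCLike.re (∫ k, (Real.exp (-s * ‖k‖ ^ 2) : ℂ) * hat h k) := fun s hs0 => by
    rw [integral_gaussian_mul_hat hi hs0]
    simpa only [RCLike.re_eq_complex_re, Complex.ofReal_re] using
      integral_gaussian_mul_pos hc hs.continuous h0 hx hs0
  rw [setIntegral_pos_iff_support_of_nonneg_ae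
    ((ae_restrict_iff' measurableSet_Ioi).mpr (Eventually.of_forall fun s hs0 => (hpos s hs0).le))
    hint2.re]
  refine lt_of_lt_of_le ?_ (measure_mono (Set.subset_inter (fun s hs0 => (hpos s hs0).ne')
    Set.Subset.rfl))
  simp

end Coulomb

/-! ### Dilated wave packets -/

section Dilation

variable {F : E3 → ℂ}

theorem integral_comp_dilate {G : Type*} [NormedAddCommGroup G] [NormedSpace ℝ G] (f : E3 → G)
    {l : ℝ} (hl : 0 < l) : ∫ k, f k = l ^ 3 • ∫ k, f (l • k) := by
  rw [Measure.integral_comp_smul, smul_smul, abs_of_nonneg (by positivity)]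
  simp [hl.ne']

theorem norm_eq_of_dilate {l : ℝ} (hl : 0 < l) {f : OneParticle}
    (hf : ∀ᵐ k, ‖f k‖ = l ^ (3 / 2 : ℝ) * ‖F (l • k)‖) : ‖f‖ = √(∫ k, ‖F k‖ ^ 2) := by
  have h := inner_self_eq_norm_sq_to_K (𝕜 := ℂ) f
  rw [inner_eq_integral] at h
  have e : ∫ k, starRingEnd ℂ (f k) * f k = ((∫ k, ‖F k‖ ^ 2 : ℝ) : ℂ) := by
    rw [integral_comp_dilate (fun k => ‖F k‖ ^ 2) hl, ← integral_smul, ← integral_complex_ofReal]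
    refine integral_congr_ae ?_
    filter_upwards [hf] with k hk
    have e : (l ^ (3 / 2 : ℝ)) ^ 2 = l ^ 3 := by
      rw [← Real.rpow_natCast, ← Real.rpow_mul hl.le]
      norm_num
    rw [Complex.conj_mul', hk, smul_eq_mul, ← Complex.ofReal_pow, mul_pow, e]
  rw [e] at h
  have h2 : ∫ k, ‖F k‖ ^ 2 = ‖f‖ ^ 2 := Complex.ofReal_injective (by rw [h]; push_cast; rfl)
  rw [h2, Real.sqrt_sq (norm_nonneg _)]

/-- The essentially bounded functions are dense in the one-particle space. -/
theorem topologicalClosure_span_bounded :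
    (Submodule.span ℂ {v : OneParticle | ∃ M : ℝ, ∀ᵐ k, ‖v k‖ ≤ M}).topologicalClosure = ⊤ := by
  refine (Submodule.eq_top_iff').mpr fun g => ?_
  refine closure_mono Submodule.subset_span (EMetric.mem_closure_iff.mpr fun ε hε => ?_)
  obtain ⟨ε', hε', hlt⟩ := exists_between hε
  obtain ⟨v, hc, hle, hv, hm⟩ := (Lp.memLp g).exists_hasCompactSupport_eLpNorm_sub_le
    ENNReal.ofNat_ne_top hε'.ne'
  obtain ⟨M, hM⟩ := hv.bounded_above_of_compact_support hc
  refine ⟨hm.toLp v, ⟨M, ?_⟩, ?_⟩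
  · filter_upwards [hm.coeFn_toLp] with k hk
    rw [hk]
    exact hM k
  · refine lt_of_le_of_lt ?_ hlt
    rw [Lp.edist_def]
    refine le_trans (le_of_eq (eLpNorm_congr_ae ?_)) hle
    filter_upwards [hm.coeFn_toLp] with k hk
    simp [hk]

/-- Unitarily dilated functions tend weakly to zero. -/
theorem tendsto_inner_dilate {ι : Type*} {L : Filter ι} {l : ι → ℝ} (hl : ∀ i, 0 < l i)
    (hlim : Tendsto l L atTop) (hF : Integrable F) {f : ι → OneParticle}
    (hf : ∀ i, ∀ᵐ k, ‖f i k‖ = l i ^ (3 / 2 : ℝ) * ‖F (l i • k)‖) (g : OneParticle) :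
    Tendsto (fun i => ⟪g, f i⟫_ℂ) L (𝓝 0) := by
  have key := tendsto_inner_of_total (l := L) (u := f) (v := 0)
    (fun i => (norm_eq_of_dilate (hl i) (hf i)).le) topologicalClosure_span_bounded ?_ g
  · simpa only [inner_zero_right] using key
  rintro v ⟨M, hM⟩
  rw [inner_zero_right, tendsto_zero_iff_norm_tendsto_zero]
  have hlim2 : Tendsto (fun i => M * (∫ k, ‖F k‖) * l i ^ (-(3 / 2) : ℝ)) L (𝓝 0) := by
    simpa using ((tendsto_rpow_neg_atTop (by norm_num : (0 : ℝ) < 3 / 2)).comp hlim).const_mul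
      (M * ∫ k, ‖F k‖)
  refine squeeze_zero (fun _ => norm_nonneg _) (fun i => ?_) hlim2
  rw [inner_eq_integral]
  have hint : Integrable fun k => M * (l i ^ (3 / 2 : ℝ) * ‖F (l i • k)‖) :=
    ((hF.norm.comp_smul (hl i).ne').const_mul _).const_mul _
  refine (norm_integral_le_of_norm_le hint ?_).trans (le_of_eq ?_)
  · filter_upwards [hM, hf i] with k h1 h2
    rw [norm_mul, RCLike.norm_conj, h2]
    gcongr
    have := hl i
    positivity
  · rw [integral_const_mul, integral_const_mul, integral_comp_dilate (fun k => ‖F k‖) (hl i),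
      smul_eq_mul]
    have e : l i ^ (3 / 2 : ℝ) = l i ^ (3 : ℕ) * l i ^ (-(3 / 2) : ℝ) := by
      rw [← Real.rpow_natCast, ← Real.rpow_add (hl i)]
      norm_num
    rw [e]
    ring

end Dilation

section Packets

/-- The function `l⁻² h(x / l)`. The power of `l` makes the Coulomb interaction `∫ h(x) / |x| d³x`
with a point charge at the origin independent of `l`. -/
noncomputable def dilate (h : E3 → ℝ) (l : ℝ) (x : E3) : ℝ := (l ^ 2)⁻¹ * h (l⁻¹ • x)

theorem hat_const_mul (c : ℝ) (h : E3 → ℝ) (k : E3) :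
    hat (fun x => c * h x) k = c * hat h k := by
  rw [hat, hat, ← integral_const_mul]
  refine integral_congr_ae (Eventually.of_forall fun x => ?_)
  simp only
  push_cast
  ring

theorem hat_dilate_eq (h : E3 → ℝ) {l : ℝ} (hl : 0 < l) (k : E3) :
    hat (dilate h l) k = l * hat h (l • k) := by
  have hl' : (l : ℂ) ≠ 0 := by exact_mod_cast hl.ne'
  unfold dilate
  rw [hat_const_mul, hat_dilate h hl]
  push_cast
  field_simp

/-- The dilated test function. -/
noncomputable def RealTest.dilate {c : E3} {r : ℝ} (h : RealTest (ballOpens c r)) {l : ℝ}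
    (hl : 0 < l) : RealTest (ballOpens (l • c) (l * r)) where
  toFun := ScalarField.dilate h l
  contDiff' := by
    have := h.contDiff
    unfold ScalarField.dilate
    exact contDiff_const.mul (this.comp (contDiff_const_smul _))
  hasCompactSupport' :=
    (h.hasCompactSupport.comp_homeomorph
      (Homeomorph.smulOfNeZero l⁻¹ (inv_ne_zero hl.ne'))).mul_left
  tsupport_subset' := by
    refine (tsupport_mul_subset_right).trans fun x hx => ?_
    have h1 : l⁻¹ • x ∈ tsupport (h : E3 → ℝ) :=
      tsupport_comp_subset_preimage (h : E3 → ℝ) (continuous_const_smul l⁻¹) hx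
    have h2 : l⁻¹ • x ∈ Metric.ball c r := TestFunction.tsupport_subset h h1
    change x ∈ Metric.ball (l • c) (l * r)
    rw [mem_ball_iff_norm] at h2 ⊢
    have e : x - l • c = l • (l⁻¹ • x - c) := by
      rw [smul_sub, smul_smul, mul_inv_cancel₀ hl.ne', one_smul]
    rw [e, norm_smul, Real.norm_of_nonneg hl.le]
    gcongr

/-- The function `ω^{-1/2} ĥ_l`, where `h_l` is `dilate h l`, translated by `a` in spacetime. -/
noncomputable def packetFn (a : Spacetime) (h : E3 → ℝ) (l : ℝ) (k : E3) : ℂ :=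
  translationPhase a k * (((‖k‖ ^ (-(1 / 2) : ℝ) : ℝ) : ℂ) * (l * hat h (l • k)))

theorem norm_translationPhase (a : Spacetime) (k : E3) : ‖translationPhase a k‖ = 1 := by
  rw [translationPhase, mul_comm, Complex.norm_exp_ofReal_mul_I]

@[fun_prop]
theorem continuous_translationPhase (a : Spacetime) : Continuous (translationPhase a) := by
  unfold translationPhase
  fun_prop

theorem packetFn_eq (a : Spacetime) (h : E3 → ℝ) {l : ℝ} (hl : 0 < l) (k : E3) :
    packetFn a h l k = translationPhase a k * timeZeroFn (dilate h l) 0 k := by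
  have h0 : hat 0 k = 0 := by simp [hat]
  rw [packetFn, timeZeroFn, hat_dilate_eq h hl, h0, mul_zero, add_zero]

theorem norm_packetFn (a : Spacetime) (h : E3 → ℝ) {l : ℝ} (hl : 0 < l) (k : E3) :
    ‖packetFn a h l k‖ =
      l ^ (3 / 2 : ℝ) * ‖((‖l • k‖ ^ (-(1 / 2) : ℝ) : ℝ) : ℂ) * hat h (l • k)‖ := by
  have e : l = l ^ (3 / 2 : ℝ) * l ^ (-(1 / 2) : ℝ) := by
    rw [← Real.rpow_add hl]
    norm_num
  rw [packetFn, norm_mul, norm_translationPhase, one_mul, norm_mul, norm_mul, norm_mul,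
    Complex.norm_real, Complex.norm_real, Complex.norm_real, Real.norm_of_nonneg hl.le,
    Real.norm_of_nonneg (by positivity), Real.norm_of_nonneg (by positivity), norm_smul,
    Real.norm_of_nonneg hl.le, Real.mul_rpow hl.le (norm_nonneg _)]
  nth_rewrite 1 [e]
  ring

variable {c : E3} {r : ℝ} (a : Spacetime) (h : RealTest (ballOpens c r))

theorem memLp_packetFn {l : ℝ} (hl : 0 < l) : MemLp (packetFn a h l) 2 := by
  obtain ⟨C, hC⟩ := rpow_mul_sq_norm_hat_le h
  have h1 : MemLp (fun k : E3 => ((‖k‖ ^ (-(1 / 2) : ℝ) : ℝ) : ℂ) * hat h k) 2 :=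
    memLp_of_sq_le_domFn (by fun_prop) hC
  have h2 := (memLp_two_iff_integrable_sq_norm h1.1).mp h1
  have hm : Measurable (packetFn a h l) := by
    have := (h.measurable_hat).comp (measurable_const_smul l)
    unfold packetFn
    fun_prop
  rw [memLp_two_iff_integrable_sq_norm hm.aestronglyMeasurable]
  simp only [norm_packetFn a h hl, mul_pow]
  exact (h2.comp_smul hl.ne').const_mul _

/-- The vector of the one-particle space given by `packetFn`. -/
noncomputable def packet {l : ℝ} (hl : 0 < l) : OneParticle := (memLp_packetFn a h hl).toLp _

theorem packet_ae {l : ℝ} (hl : 0 < l) : packet a h hl =ᵐ[volume] packetFn a h l :=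
  MemLp.coeFn_toLp _

theorem packet_mem_localSpace (hr : 0 < r) {l : ℝ} (hl : 0 < l) :
    packet a h hl ∈ localSpace ((fun z => a + z) '' diamond (l • c) (l * r)) := by
  refine Submodule.subset_span ⟨l • c, l * r, a, h.dilate hl, 0, by positivity, ?_, ?_⟩
  · rw [causalCompletion_ball (by positivity)]
  · filter_upwards [packet_ae a h hl] with k hk
    rw [hk, packetFn_eq a h hl]
    rfl

theorem norm_packet_ae {l : ℝ} (hl : 0 < l) : ∀ᵐ k, ‖packet a h hl k‖ =
    l ^ (3 / 2 : ℝ) * ‖((‖l • k‖ ^ (-(1 / 2) : ℝ) : ℝ) : ℂ) * hat h (l • k)‖ := by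
  filter_upwards [packet_ae a h hl] with k hk
  rw [hk, norm_packetFn a h hl]

/-- The norm of a packet does not depend on the scale. -/
theorem norm_packet {l : ℝ} (hl : 0 < l) :
    ‖packet a h hl‖ = √(∫ k : E3, ‖((‖k‖ ^ (-(1 / 2) : ℝ) : ℝ) : ℂ) * hat h k‖ ^ 2) :=
  norm_eq_of_dilate (F := fun k => ((‖k‖ ^ (-(1 / 2) : ℝ) : ℝ) : ℂ) * hat h k) hl
    (norm_packet_ae a h hl)

theorem tendsto_inner_packet {ι : Type*} {L : Filter ι} {l : ι → ℝ} (hl : ∀ i, 0 < l i)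
    (hlim : Tendsto l L atTop) (g : OneParticle) :
    Tendsto (fun i => ⟪g, packet a h (hl i)⟫_ℂ) L (𝓝 0) := by
  refine tendsto_inner_dilate (F := fun k => ((‖k‖ ^ (-(1 / 2) : ℝ) : ℝ) : ℂ) * hat h k) hl hlim
    (integrable_rpow_mul_hat h.hasCompactSupport h.contDiff (a := 1 / 2) (by norm_num)
      (by norm_num) (C := 1) (by fun_prop) fun k => ?_)
    (fun i => norm_packet_ae a h (hl i)) g
  rw [Complex.norm_real, one_mul, Real.norm_of_nonneg (by positivity)]

variable (σ ρ : RealTest ⊤)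

/-- The pairing of the charge with a packet, in the momentum variable of the unscaled packet. -/
theorem conj_chargeFn_mul_packetFn {l : ℝ} (hl : 0 < l) {k : E3} (hk : k ≠ 0) :
    starRingEnd ℂ (chargeFn σ ρ (l⁻¹ • k)) * packetFn a h l (l⁻¹ • k) =
      (l : ℂ) ^ 3 * (((((l⁻¹ * ‖k‖ ^ (-1 : ℝ) : ℝ) : ℂ) * starRingEnd ℂ (hat σ (l⁻¹ • k)) -
        Complex.I * ((‖k‖ ^ (-2 : ℝ) : ℝ) : ℂ) * starRingEnd ℂ (hat ρ (l⁻¹ • k))) *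
          translationPhase a (l⁻¹ • k)) * hat h k) := by
  have hk0 : 0 < ‖k‖ := norm_pos_iff.mpr hk
  have e1 : ‖l⁻¹ • k‖ = l⁻¹ * ‖k‖ := by rw [norm_smul, Real.norm_of_nonneg (by positivity)]
  have hp : 0 < ‖l⁻¹ • k‖ := by rw [e1]; positivity
  have hl' : (l : ℂ) ≠ 0 := by exact_mod_cast hl.ne'
  have e2 : ‖l⁻¹ • k‖ ^ (-(1 / 2) : ℝ) * ‖l⁻¹ • k‖ ^ (-(1 / 2) : ℝ) = l * ‖k‖ ^ (-1 : ℝ) := by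
    rw [← Real.rpow_add hp, e1]
    norm_num [Real.rpow_neg_one, mul_comm]
  have e3 : ‖l⁻¹ • k‖ ^ (-(3 / 2) : ℝ) * ‖l⁻¹ • k‖ ^ (-(1 / 2) : ℝ) = l ^ 2 * ‖k‖ ^ (-2 : ℝ) := by
    rw [← Real.rpow_add hp, e1, Real.mul_rpow (by positivity) hk0.le, Real.inv_rpow hl.le]
    norm_num [Real.rpow_neg hl.le]
  have e2' : ((‖l⁻¹ • k‖ ^ (-(1 / 2) : ℝ) : ℝ) : ℂ) * ((‖l⁻¹ • k‖ ^ (-(1 / 2) : ℝ) : ℝ) : ℂ) =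
      l * ((‖k‖ ^ (-1 : ℝ) : ℝ) : ℂ) := by exact_mod_cast e2
  have e3' : ((‖l⁻¹ • k‖ ^ (-(3 / 2) : ℝ) : ℝ) : ℂ) * ((‖l⁻¹ • k‖ ^ (-(1 / 2) : ℝ) : ℝ) : ℂ) =
      l ^ 2 * ((‖k‖ ^ (-2 : ℝ) : ℝ) : ℂ) := by exact_mod_cast e3
  rw [chargeFn, packetFn, smul_smul, mul_inv_cancel₀ hl.ne', one_smul]
  simp only [map_add, map_mul, Complex.conj_ofReal, Complex.conj_I]
  have e4 : (((l⁻¹ * ‖k‖ ^ (-1 : ℝ) : ℝ) : ℂ)) * l ^ 3 = l ^ 2 * ((‖k‖ ^ (-1 : ℝ) : ℝ) : ℂ) := by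
    push_cast
    field_simp
  linear_combination (translationPhase a (l⁻¹ • k) * l * hat h k) *
    (starRingEnd ℂ (hat σ (l⁻¹ • k)) * e2' -
      Complex.I * starRingEnd ℂ (hat ρ (l⁻¹ • k)) * e3') -
    starRingEnd ℂ (hat σ (l⁻¹ • k)) * translationPhase a (l⁻¹ • k) * hat h k * e4

theorem chargeForm_packet {l : ℝ} (hl : 0 < l) :
    chargeForm (chargeFn σ ρ) (packet a h hl) =
      -(∫ k, ((((l⁻¹ * ‖k‖ ^ (-1 : ℝ) : ℝ) : ℂ) * starRingEnd ℂ (hat σ (l⁻¹ • k)) -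
        Complex.I * ((‖k‖ ^ (-2 : ℝ) : ℝ) : ℂ) * starRingEnd ℂ (hat ρ (l⁻¹ • k))) *
          translationPhase a (l⁻¹ • k)) * hat h k).im := by
  have hl' : (l : ℂ) ≠ 0 := by exact_mod_cast hl.ne'
  have e1 : ∫ k, starRingEnd ℂ (chargeFn σ ρ k) * packet a h hl k =
      ∫ k, starRingEnd ℂ (chargeFn σ ρ k) * packetFn a h l k := by
    refine integral_congr_ae ?_
    filter_upwards [packet_ae a h hl] with k hk
    rw [hk]
  rw [chargeForm, e1, integral_comp_dilate _ (inv_pos.mpr hl), ← integral_smul]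
  congr 2
  refine integral_congr_ae ?_
  filter_upwards [ae_ne_zero] with k hk
  rw [conj_chargeFn_mul_packetFn a h σ ρ hl hk, Complex.real_smul, ← mul_assoc]
  push_cast
  rw [← mul_pow, inv_mul_cancel₀ hl', one_pow, one_mul]

/-- At large scales a packet measures the total charge. -/
theorem tendsto_chargeForm_packet {l : ℕ → ℝ} (hl : ∀ i, 1 ≤ l i) (hlim : Tendsto l atTop atTop) :
    Tendsto (fun i => chargeForm (chargeFn σ ρ) (packet a h (one_pos.trans_le (hl i)))) atTop
      (𝓝 (charge ρ * (∫ k, ((‖k‖ ^ (-2 : ℝ) : ℝ) : ℂ) * hat h k).re)) := by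
  have hinv : Tendsto (fun i => (l i)⁻¹) atTop (𝓝 0) := tendsto_inv_atTop_zero.comp hlim
  have hσ := continuous_hat σ.integrable
  have hρ := continuous_hat ρ.integrable
  have hb : ∀ m : ℝ, 0 ≤ m → m ≤ 2 → Integrable fun k : E3 => ‖k‖ ^ (-m) * ‖hat h k‖ := by
    intro m h1 h2
    refine (integrable_rpow_mul_hat h.hasCompactSupport h.contDiff (a := m) (by linarith)
      (by linarith) (m := fun k => ((‖k‖ ^ (-m) : ℝ) : ℂ)) (C := 1) (by fun_prop)
      fun k => ?_).norm.congr (Eventually.of_forall fun k => ?_)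
    · rw [Complex.norm_real, one_mul, Real.norm_of_nonneg (by positivity)]
    · simp only
      rw [norm_mul, Complex.norm_real, Real.norm_of_nonneg (by positivity)]
  have key : Tendsto (fun i => ∫ k, ((((((l i)⁻¹ * ‖k‖ ^ (-1 : ℝ) : ℝ) : ℂ) *
      starRingEnd ℂ (hat σ ((l i)⁻¹ • k)) -
        Complex.I * ((‖k‖ ^ (-2 : ℝ) : ℝ) : ℂ) * starRingEnd ℂ (hat ρ ((l i)⁻¹ • k))) *
          translationPhase a ((l i)⁻¹ • k)) * hat h k)) atTop
      (𝓝 (∫ k, -Complex.I * (charge ρ : ℂ) * (((‖k‖ ^ (-2 : ℝ) : ℝ) : ℂ) * hat h k))) := by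
    refine tendsto_integral_of_dominated_convergence
      (fun k => (∫ x, ‖σ x‖) * (‖k‖ ^ (-1 : ℝ) * ‖hat h k‖) +
        (∫ x, ‖ρ x‖) * (‖k‖ ^ (-2 : ℝ) * ‖hat h k‖)) (fun i => ?_)
      (((hb 1 (by norm_num) (by norm_num)).const_mul _).add
        ((hb 2 (by norm_num) (by norm_num)).const_mul _))
      (fun i => Eventually.of_forall fun k => ?_) (Eventually.of_forall fun k => ?_)
    · have h1 := hσ.measurable.comp (measurable_const_smul (l i)⁻¹)
      have h2 := hρ.measurable.comp (measurable_const_smul (l i)⁻¹)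
      have h3 := h.measurable_hat
      have h4 := (continuous_translationPhase a).measurable.comp (measurable_const_smul (l i)⁻¹)
      simp only [Function.comp_def] at h1 h2 h4
      exact Measurable.aestronglyMeasurable (by fun_prop)
    · rw [norm_mul, norm_mul, norm_translationPhase, mul_one, ← mul_assoc, ← mul_assoc, ← add_mul]
      gcongr
      refine (norm_sub_le _ _).trans ?_
      rw [norm_mul, norm_mul, norm_mul, RCLike.norm_conj, RCLike.norm_conj, Complex.norm_I, one_mul,
        Complex.norm_real, Complex.norm_real,
        Real.norm_of_nonneg (mul_nonneg (inv_nonneg.mpr (zero_le_one.trans (hl i)))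
          (Real.rpow_nonneg (norm_nonneg k) _)),
        Real.norm_of_nonneg (Real.rpow_nonneg (norm_nonneg k) _),
        mul_comm (∫ x, ‖σ x‖), mul_comm (∫ x, ‖ρ x‖)]
      gcongr
      · exact mul_le_of_le_one_left (by positivity) (inv_le_one_of_one_le₀ (hl i))
      · exact norm_hat_le_integral _ _
      · exact norm_hat_le_integral _ _
    · have hk : Tendsto (fun i => (l i)⁻¹ • k) atTop (𝓝 0) := by
        simpa using hinv.smul_const k
      have t1 : Tendsto (fun i => (((l i)⁻¹ * ‖k‖ ^ (-1 : ℝ) : ℝ) : ℂ)) atTop (𝓝 0) := by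
        simpa only [Function.comp_def, zero_mul, Complex.ofReal_zero] using
          (Complex.continuous_ofReal.tendsto _).comp (hinv.mul_const (‖k‖ ^ (-1 : ℝ)))
      have t2 := (Complex.continuous_conj.tendsto _).comp ((hσ.tendsto 0).comp hk)
      have t3 := (Complex.continuous_conj.tendsto _).comp ((hρ.tendsto 0).comp hk)
      have t4 := ((continuous_translationPhase a).tendsto 0).comp hk
      rw [hat_zero, Complex.conj_ofReal] at t3
      have e4 : translationPhase a 0 = 1 := by simp [translationPhase]
      rw [e4] at t4
      have t := (((t1.mul t2).sub (t3.const_mul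
        (Complex.I * ((‖k‖ ^ (-2 : ℝ) : ℝ) : ℂ)))).mul t4).mul_const (hat h k)
      refine t.congr' (Eventually.of_forall fun i => rfl) |>.trans (le_of_eq ?_)
      congr 1
      rw [charge]
      ring
  have key2 := ((Complex.continuous_im.tendsto _).comp key).neg
  refine (key2.congr fun i => (chargeForm_packet a h σ ρ _).symm).trans (le_of_eq ?_)
  congr 1
  rw [integral_const_mul]
  simp [Complex.mul_im]

end Packets

/-- In any ball there is a test function with a prescribed Coulomb interaction with a charge `q ≠ 0`
at the origin. -/
theorem exists_realTest_coulomb {q : ℝ} (hq : q ≠ 0) (c : E3) {r : ℝ} (hr : 0 < r) (t : ℝ) :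
    ∃ h : RealTest (ballOpens c r), q * (∫ k, ((‖k‖ ^ (-2 : ℝ) : ℝ) : ℂ) * hat h k).re = t := by
  let b : ContDiffBump c := ⟨r / 4, r / 2, by positivity, by linarith⟩
  have hpos := re_integral_inv_sq_mul_hat_pos b.hasCompactSupport b.contDiff
    (fun x => b.nonneg) (x₀ := c) (by
      rw [b.one_of_mem_closedBall (Metric.mem_closedBall_self (by positivity))]
      exact one_ne_zero)
  set J := (∫ k, ((‖k‖ ^ (-2 : ℝ) : ℝ) : ℂ) * hat b k).re with hJ
  refine ⟨⟨fun x => t / (q * J) * b x, contDiff_const.mul b.contDiff,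
    b.hasCompactSupport.mul_left, tsupport_mul_subset_right.trans ?_⟩, ?_⟩
  · rw [b.tsupport_eq]
    exact Metric.closedBall_subset_ball (by change r / 2 < r; linarith)
  · rw [TestFunction.coe_mk]
    simp only [hat_const_mul, mul_left_comm _ ((t / (q * J) : ℝ) : ℂ)]
    rw [integral_const_mul, Complex.re_ofReal_mul, ← hJ]
    field_simp

/-! ### Equivalence to the vacuum representation -/

theorem inner_mul_star_self {H : Type*} [NormedAddCommGroup H] [InnerProductSpace ℂ H]
    [CompleteSpace H] (V A : H →L[ℂ] H) (ψ φ : H) :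
    ⟪ψ, (V * A * star V) φ⟫_ℂ = ⟪star V ψ, A (star V φ)⟫_ℂ := by
  rw [ContinuousLinearMap.star_eq_adjoint, ContinuousLinearMap.adjoint_inner_left]
  rfl

/-- If a unitary intertwines the Weyl operators `W(u i)`, where the `u i` have constant norm and tend
weakly to zero, with their multiples by phases, these phases tend to `1`. -/
theorem phase_limit_eq_one {K : Type*} [NormedAddCommGroup K] [InnerProductSpace ℂ K] {u : ℕ → K}
    {N : ℝ} (hN : ∀ i, ‖u i‖ = N) (h : ∀ g, Tendsto (fun i => ⟪g, u i⟫_ℂ) atTop (𝓝 0))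
    {V : FockSpace K →L[ℂ] FockSpace K} (hV : V ∈ unitary (FockSpace K →L[ℂ] FockSpace K))
    {c : ℕ → ℂ} {z : ℂ} (hc : Tendsto c atTop (𝓝 z))
    (heq : ∀ i, V * (c i • weyl (u i)) * star V = weyl (u i)) : z = 1 := by
  set Ω : FockSpace K := expVec 0
  have hΩ : ⟪Ω, Ω⟫_ℂ = 1 := by rw [inner_expVec, inner_zero_left, Complex.exp_zero]
  have hΩ' : ⟪star V Ω, star V Ω⟫_ℂ = 1 := by
    rw [← hΩ]
    have e := inner_mul_star_self V 1 Ω Ω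
    rw [mul_one, Unitary.mul_star_self_of_mem hV] at e
    exact e.symm
  have t1 := tendsto_inner_weyl hN h Ω Ω
  have t2 := hc.mul (tendsto_inner_weyl hN h (star V Ω) (star V Ω))
  have e : ∀ i, c i * ⟪star V Ω, weyl (u i) (star V Ω)⟫_ℂ = ⟪Ω, weyl (u i) Ω⟫_ℂ := fun i => by
    nth_rewrite 2 [← heq i]
    rw [inner_mul_star_self, smul_apply, inner_smul_right]
  simp only [e, inner_smul_right, hΩ, hΩ', mul_one] at t1 t2
  exact mul_right_cancel₀ (Complex.exp_ne_zero _) ((tendsto_nhds_unique t2 t1).trans (one_mul _).symm)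

theorem existsUnique_isChargeAut (σ ρ : RealTest ⊤) :
    ∃! α : quasilocal ≃⋆ₐ[ℂ] quasilocal, IsChargeAut (chargeFn σ ρ) α :=
  existsUnique_of_exists_of_unique (exists_isChargeAut σ ρ) fun _ _ hα hβ => hα.unique hβ

section Sectors

variable {σ ρ : RealTest ⊤} {α : quasilocal ≃⋆ₐ[ℂ] quasilocal}

/-- In a region which contains arbitrarily large dilated balls at a fixed time, a charge can be
measured at infinity. -/
theorem IsChargeAut.not_equivIdOn (hα : IsChargeAut (chargeFn σ ρ) α) (hq : charge ρ ≠ 0)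
    {R : Set Spacetime} {a : Spacetime} {x₀ : E3} {r : ℝ} (hr : 0 < r)
    (hR : ∀ l : ℝ, 0 < l → (fun z => a + z) '' diamond (l • x₀) (l * r) ⊆ R) :
    ¬ EquivIdOn α R := by
  rintro ⟨V, hV, hVα⟩
  -- the packets are normalised so that the limit of the phases is `exp (iπ) = -1`
  obtain ⟨h, hh⟩ := exists_realTest_coulomb hq x₀ hr Real.pi
  let l : ℕ → ℝ := fun n => n + 1
  have hl : ∀ n, 1 ≤ l n := fun n => by simp [l]
  have hl0 : ∀ n, 0 < l n := fun n => one_pos.trans_le (hl n)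
  have hlim : Tendsto l atTop atTop :=
    tendsto_atTop_add_const_right _ _ tendsto_natCast_atTop_atTop
  have hc := tendsto_chargeForm_packet a h σ ρ hl hlim
  rw [hh] at hc
  have hc' : Tendsto (fun n => Complex.exp (Complex.I *
      ((chargeForm (chargeFn σ ρ) (packet a h (hl0 n)) : ℝ) : ℂ))) atTop
      (𝓝 (Complex.exp (Complex.I * (Real.pi : ℂ)))) :=
    (Complex.continuous_exp.tendsto _).comp
      (((Complex.continuous_ofReal.tendsto _).comp hc).const_mul _)
  have key := phase_limit_eq_one (fun n => norm_packet a h (hl0 n))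
    (tendsto_inner_packet a h hl0 hlim) hV hc' fun n => by
      have hO := isDoubleCone_diamond (mul_pos (hl0 n) hr) (l n • x₀) a
      have hf := packet_mem_localSpace a h hr (hl0 n)
      have e := hVα ⟨weyl (packet a h (hl0 n)), weyl_mem_quasilocal hO hf⟩
        (StarSubalgebra.le_topologicalClosure _ (StarAlgebra.subset_adjoin ℂ _
          ⟨_, hO, hR _ (hl0 n), weyl_mem_localAlgebra hf⟩))
      rw [hα.map_weyl _ hO _ hf] at e
      exact e
  rw [mul_comm, Complex.exp_pi_mul_I] at key
  norm_num at key

/-- An automorphism without charge is implemented by a Weyl operator on the whole algebra. -/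
theorem IsChargeAut.equivIdOn (hα : IsChargeAut (chargeFn σ ρ) α) (hq : charge ρ = 0)
    (R : Set Spacetime) : EquivIdOn α R := by
  set v := chargeVec σ ρ 1 one_pos
  have hloc : ∀ O, IsDoubleCone O → ∀ f ∈ localSpace O,
      chargeForm (chargeFn σ ρ) f = -(⟪v, f⟫_ℂ).im := by
    intro O hO f hf
    obtain ⟨N, hN⟩ := hO.exists_subset_diamond
    rw [chargeForm_eq_inner σ ρ (by positivity) (hN N le_rfl) hf,
      chargeVec_eq_of_charge_eq_zero σ ρ hq _ one_pos]
  have hα' : ∀ A : quasilocal, (α A : Op) = weylAut v A :=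
    starAlgEquiv_eq_of_eqOn (𝓑 := quasilocal) rfl fun A ⟨O, hO, _, hA⟩ =>
      hα.eq_weylAut hO (hloc O hO) A hA
  refine ⟨star (weyl v), Unitary.star_mem (weyl_mem_unitary v), fun A _ => ?_⟩
  rw [hα', weylAut_apply, star_star, ← mul_assoc, ← mul_assoc, star_weyl_mul_weyl, one_mul,
    mul_assoc, star_weyl_mul_weyl, mul_one]

theorem IsOpenConvexCone.exists_diamond_subset {C : Set E3} (hC : IsOpenConvexCone C) :
    ∃ (x₀ : E3) (r : ℝ), 0 < r ∧ ∀ l : ℝ, 0 < l →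
      (fun z => (0 : Spacetime) + z) '' diamond (l • x₀) (l * r) ⊆ causalCompletion ({0} ×ˢ C) := by
  obtain ⟨x₀, hx₀⟩ := hC.nonempty
  obtain ⟨r, hr, hb⟩ := Metric.isOpen_iff.mp hC.isOpen x₀ hx₀
  refine ⟨x₀, r, hr, fun l hl => ?_⟩
  simp only [zero_add, Set.image_id']
  refine diamond_subset_causalCompletion (by positivity) fun x hx => ?_
  have e : x = l • (l⁻¹ • x) := by rw [smul_smul, mul_inv_cancel₀ hl.ne', one_smul]
  rw [e]
  refine hC.smul_mem l hl _ (hb ?_)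
  rw [mem_ball_iff_norm] at hx ⊢
  have e2 : l⁻¹ • x - x₀ = l⁻¹ • (x - l • x₀) := by
    rw [smul_sub, smul_smul, inv_mul_cancel₀ hl.ne', one_smul]
  rw [e2, norm_smul, Real.norm_of_nonneg (by positivity), inv_mul_lt_iff₀ hl]
  exact hx

end Sectors

end ScalarField

theorem proposition2p1 (σ ρ : ScalarField.RealTest ⊤) :
    (∃! α : ScalarField.quasilocal ≃⋆ₐ[ℂ] ScalarField.quasilocal,
      ScalarField.IsChargeAut (ScalarField.chargeFn σ ρ) α) ∧
    ∀ α : ScalarField.quasilocal ≃⋆ₐ[ℂ] ScalarField.quasilocal,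
      ScalarField.IsChargeAut (ScalarField.chargeFn σ ρ) α →
        (∀ C : Set ScalarField.E3, ScalarField.IsOpenConvexCone C →
          (ScalarField.EquivIdOn α (ScalarField.causalCompletion ({0} ×ˢ C)) ↔ ScalarField.charge ρ = 0)) ∧
        (ScalarField.charge ρ ≠ 0 → ∀ S : Set ScalarField.Spacetime, ScalarField.IsSpacelikeCone S →
          ¬ ScalarField.EquivIdOn α (ScalarField.causalCompl S)) := by
  refine ⟨ScalarField.existsUnique_isChargeAut σ ρ, fun α hα => ?_⟩
  constructor
  · intro C hC
    constructor
    · intro h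
      by_contra hq
      obtain ⟨x₀, r, hr, hR⟩ := hC.exists_diamond_subset
      exact hα.not_equivIdOn hq hr hR h
    · intro hq
      exact hα.equivIdOn hq _
  · intro hq S hS
    obtain ⟨a, x₀, r, hr, hR⟩ := hS.exists_diamond_subset
    exact hα.not_equivIdOn hq hr hR
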